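/- Let $L\ge 0$, $N=L^2$, and let qubits sit at the sites $(r,c)$, $0\le r,c<L$, of the $L\times L$ grid. The snake order numbers the sites by $\mathrm{jw}(r,c)=rL+c$ for even $r$ and $\mathrm{jw}(r,c)=rL+(L-1-c)$ for odd $r$; qubits are identified with $\{0,\dots,N-1\}$ through it. For $\pi\in S_N$ the fermionic permutation is $$F_\pi=P_\pi V_\pi,\qquad V_\pi=\prod_{i<j,\ \pi(i)>\pi(j)}\mathrm{CZ}_{i,j},$$ where $P_\pi$ moves the content of qubit $j$ to qubit $\pi(j)$. Circuits are built from the gates $H$, $Z$, $\mathrm{CNOT}$ and $\mathrm{CZ}$ on these $N$ qubits only (no ancillas, measurements or feedforward). Their CNOT depth is the number of layers of two-qubit gates when each gate is executed as soon as possible, one-qubit gates being free. $\mathrm{FSWAP}\,|s_p s_q\rangle=(-1)^{s_ps_q}|s_qs_p\rangle$ is executed as $H_q$, $\mathrm{CNOT}_{q\to p}$, $\mathrm{CNOT}_{p\to q}$, $H_p$. *Sorting stages.* Odd–even transposition (OET) sort of a permutation of a line of $L$ positions has rounds $k=0,\dots,L-1$; round $k$ applies $\mathrm{FSWAP}$ to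 those pairs of positions $(i,i+1)$, $i\equiv k \bmod 2$, whose items have destinations in the wrong order. $\mathrm{Row}(\rho)$ performs OET in all rows for a within-row permutation $\rho$, and $\mathrm{Col}(\kappa)$ performs OET in all columns for a within-column permutation $\kappa$ (with bare FSWAPs, i.e. without any parity correction). *The circuit $\Gamma$.* For a row $r$ and lists $G_{\rm fwd},G_{\rm undo}$ of pairs (offset $\delta$, gadget $g$), $\mathrm{PipeSweep}(r;G_{\rm fwd},G_{\rm undo})$ runs steps $t=0,1,2,\dots$, firing at step $t$ the gate $\mathrm{CNOT}((r,t)\to(r,t+1))$ (for $0\le t\le L-2$) and the gates $g(t+\delta)$, $(\delta,g)\in G_{\rm fwd}$; then it runs steps $t=L-2,L-3,\dots$ in the same way with $G_{\rm undo}$. Gates with a qubit off the grid are omitted. The gadgets are - $S^{\pm}(c)$: $\mathrm{CZ}((r+1,c),(r+2,c))$, $\mathrm{CNOT}((r,c\pm1)\to(r+1,c\pm1))$, $\mathrm{CZ}((r+1,c\pm2),(r+2,c\pm2))$, $\mathrm{CNOT}((r,c\pm3)\to(r+1,c\pm3))$; - $X(c)$: $\mathrm{CZ}((r,c),(r+1,c))$;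 - $E(c)$: $\mathrm{CZ}((r,c-1),(r,c))$; - $R(c)$: $Z(r,c)$ if $L-1-c$ is odd, otherwise nothing. $\Gamma$ consists of: (1) in each column $c$, $\mathrm{CNOT}((r+1,c)\to(r,c))$ for $r=L-2,\dots,0$; (2) for the rows $r\equiv0\bmod 4$ and then for the rows $r\equiv 2\bmod 4$, $\mathrm{PipeSweep}$ over $r$ with $G_{\rm fwd}$ consisting of $(-1,S^-)$ if $r+2\le L-1$ and $(-5,E)$ if $r\ge2$, and $G_{\rm undo}$ consisting of $(1,S^+)$ if $r+2\le L-1$ and $(5,R)$ if $r\ge 2$; (3) in each column $c$, $\mathrm{CNOT}((r+1,c)\to(r,c))$ for $r=0,\dots,L-2$; (4) for each even $r$ with $r+1\le L-1$, $\mathrm{PipeSweep}(r;\{(-2,X),(-3,E)\},\{(2,X),(3,R)\})$; (5) if $L$ is odd, $\mathrm{PipeSweep}(L-1;\{(-3,E)\},\{(3,R)\})$. **Theorem.** There is an absolute constant $C$ such that for every $L$ and every $\pi\in S_N$ the following holds. There are permutations $\rho_A,\kappa,\rho_B$ of the grid, with $\rho_A,\rho_B$ within rows and $\kappa$ within columns,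 such that $\pi=\rho_B\circ\kappa\circ\rho_A$ in the snake numbering. For every such triple, the circuit that performs successively $\mathrm{Row}(\rho_A)$, $\Gamma$, $\mathrm{Col}(\kappa)$, $\Gamma$, $\mathrm{Row}(\rho_B)$ 1. implements $F_\pi$ exactly, with no global phase; 2. has all its two-qubit gates on grid neighbours; 3. has CNOT depth at most $22L+20=22\sqrt N+20$; 4. has at most $C\,N\sqrt N$ two-qubit gates. Moreover each of the three sorting stages has CNOT depth at most $2L$ and at most $NL$ two-qubit gates, and $\Gamma$ has CNOT depth at most $8L+10$ and at most $C\,N$ two-qubit gates. -/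

import Mathlib

namespace FermionicPermutation

/-! ### Qubits, basis states, gates and circuits -/

/-- The qubits: the sites `(r, c)` (row, column) of the `L × L` grid. There are no others. -/
abbrev Site (L : ℕ) : Type := Fin L × Fin L

/-- Computational basis states of a register of qubits labelled by `Q`. -/
abbrev Basis (Q : Type) : Type := Q → ZMod 2

/-- The sign `(-1)^b` of a bit. -/
def sign (b : ZMod 2) : ℂ := (-1) ^ b.val

/-- The eigenvalue of `CZ` on the pair `i, j`, as a function of the basis state. -/
def czSign {Q : Type} (i j : Q) (s : Basis Q) : ℂ := sign (s i * s j)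

/-- Elementary gates. All of them are unitary: there is no measurement, no reset and no
classically controlled operation. `cnot p q` has control `p` and target `q`. -/
inductive Gate (L : ℕ) : Type
  | had (q : Site L) : Gate L
  | z (q : Site L) : Gate L
  | cnot (p q : Site L) : Gate L
  | cz (p q : Site L) : Gate L

/-- A circuit is the list of its gates in the order of execution. -/
abbrev Circuit (L : ℕ) : Type := List (Gate L)

/-- The operator of a gate; the entry `(t, s)` is `⟨t| g |s⟩`. -/
noncomputable def Gate.op {L : ℕ} : Gate L → Matrix (Basis (Site L)) (Basis (Site L)) ℂ
  | .had q => Matrix.of fun t s =>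
      if ∀ x, x ≠ q → t x = s x then sign (s q * t q) / (Real.sqrt 2 : ℂ) else 0
  | .z q => Matrix.diagonal fun s => sign (s q)
  | .cnot p q => Matrix.of fun t s => if t = Function.update s q (s q + s p) then 1 else 0
  | .cz p q => Matrix.diagonal (czSign p q)

/-- The operator of a circuit; the head of the list acts first. -/
noncomputable def circuitOp {L : ℕ} : Circuit L → Matrix (Basis (Site L)) (Basis (Site L)) ℂ
  | [] => 1
  | g :: C => circuitOp C * g.op

/-- Grid neighbours: Manhattan distance one. -/
def Adjacent {L : ℕ} (p q : Site L) : Prop :=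
  ((p.1 : ℤ) - (q.1 : ℤ)).natAbs + ((p.2 : ℤ) - (q.2 : ℤ)).natAbs = 1

/-- A gate respects the nearest-neighbour connectivity of the grid. -/
def Gate.NearestNeighbor {L : ℕ} : Gate L → Prop
  | .had _ => True
  | .z _ => True
  | .cnot p q => Adjacent p q
  | .cz p q => Adjacent p q

/-- Two-qubit gates; each of them costs one CNOT (`CZ` is a CNOT between two Hadamards). -/
def Gate.isEntangling {L : ℕ} : Gate L → Bool
  | .had _ => false
  | .z _ => false
  | .cnot _ _ => true
  | .cz _ _ => true

/-- The number of two-qubit gates of a circuit. -/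
def gateCount {L : ℕ} (C : Circuit L) : ℕ := C.countP Gate.isEntangling

/-- `τ q` is the layer of the last two-qubit gate on `q` so far; a new two-qubit gate goes into
the first layer after those of both its qubits. -/
def Gate.advance {L : ℕ} (τ : Site L → ℕ) : Gate L → Site L → ℕ
  | .had _ => τ
  | .z _ => τ
  | .cnot p q => fun x => if x = p ∨ x = q then max (τ p) (τ q) + 1 else τ x
  | .cz p q => fun x => if x = p ∨ x = q then max (τ p) (τ q) + 1 else τ x

/-- CNOT depth: the number of layers of two-qubit gates when every gate is executed as soon as the
preceding gates on its qubits allow (the longest chain of successive two-qubit gates); one-qubit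
gates are free. -/
def cnotDepth {L : ℕ} (C : Circuit L) : ℕ :=
  Finset.univ.sup (C.foldl Gate.advance (fun _ => 0))

/-! ### Snake order and fermionic permutations -/

/-- The snake order: even rows are traversed left to right, odd rows right to left. -/
def jw (L : ℕ) : Site L ≃ Fin (L * L) :=
  (Equiv.prodShear (Equiv.refl (Fin L))
    (fun r => if r.val % 2 = 0 then Equiv.refl (Fin L) else Fin.revPerm)).trans finProdFinEquiv

theorem jw_val (L : ℕ) (r c : Fin L) :
    (jw L (r, c)).val = if r.val % 2 = 0 then r.val * L + c.val
      else r.val * L + (L - 1 - c.val) := by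
  have := c.isLt
  by_cases h : r.val % 2 = 0
  · simp [jw, h, Nat.mul_comm, Nat.add_comm]
  · simp [jw, h, Fin.val_rev, Nat.mul_comm, Nat.add_comm]
    omega

/-- The inversions of a permutation of `{0, …, N-1}`. -/
def inversions {N : ℕ} (π : Equiv.Perm (Fin N)) : Finset (Fin N × Fin N) :=
  Finset.univ.filter fun p => p.1 < p.2 ∧ π p.2 < π p.1

/-- `P_π`: the content of qubit `j` moves to qubit `π j`. -/
def permOp {N : ℕ} (π : Equiv.Perm (Fin N)) : Matrix (Basis (Fin N)) (Basis (Fin N)) ℂ :=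
  Matrix.of fun t s => if t = s ∘ π.symm then 1 else 0

/-- `V_π`: the product of the (diagonal) gates `CZ_{i,j}` over the inversions `(i, j)` of `π`. -/
noncomputable def phaseOp {N : ℕ} (π : Equiv.Perm (Fin N)) :
    Matrix (Basis (Fin N)) (Basis (Fin N)) ℂ :=
  Matrix.diagonal (∏ p ∈ inversions π, czSign p.1 p.2)

/-- The fermionic permutation `F_π = P_π V_π`. -/
noncomputable def fermionicPerm {N : ℕ} (π : Equiv.Perm (Fin N)) :
    Matrix (Basis (Fin N)) (Basis (Fin N)) ℂ :=
  permOp π * phaseOp π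

/-- A circuit on the grid, read as an operator on the modes: mode `j` is the qubit at the `j`-th
site of the snake. -/
noncomputable def modeOp {L : ℕ} (C : Circuit L) :
    Matrix (Basis (Fin (L * L))) (Basis (Fin (L * L))) ℂ :=
  Matrix.reindex (Equiv.arrowCongr (jw L) (Equiv.refl (ZMod 2)))
    (Equiv.arrowCongr (jw L) (Equiv.refl (ZMod 2))) (circuitOp C)

/-! ### Sorting stages -/

/-- The FSWAP gate `|s_p s_q⟩ ↦ (-1)^{s_p s_q} |s_q s_p⟩` as two CNOTs and two Hadamards. -/
def fswap {L : ℕ} (p q : Site L) : Circuit L :=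
  [.had q, .cnot q p, .cnot p q, .had p]

/-- The swaps of round `k` of odd-even transposition sort on a line of length `L`, where `a i` is
the destination of the item now at position `i`: the pairs `(i, i+1)` with `i ≡ k mod 2` whose
items are in the wrong order. -/
def oetRound {L : ℕ} (k : ℕ) (a : Fin L → Fin L) : List (Fin L × Fin L) :=
  (List.finRange L).flatMap fun i =>
    if h : i.val + 1 < L then
      if i.val % 2 = k % 2 ∧ a ⟨i.val + 1, h⟩ < a i then [(i, ⟨i.val + 1, h⟩)] else []
    else []

/-- The destinations after a list of swaps of positions. -/
def applySwaps {L : ℕ} (a : Fin L → Fin L) (w : List (Fin L × Fin L)) : Fin L → Fin L :=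
  w.foldl (fun b p => b ∘ Equiv.swap p.1 p.2) a

/-- The swaps of `n` rounds, starting with round `k`. -/
def oetRounds {L : ℕ} : ℕ → ℕ → (Fin L → Fin L) → List (Fin L × Fin L)
  | 0, _, _ => []
  | n + 1, k, a => oetRound k a ++ oetRounds n (k + 1) (applySwaps a (oetRound k a))

/-- The odd-even transposition network: `L` rounds. -/
def oet {L : ℕ} (a : Fin L → Fin L) : List (Fin L × Fin L) := oetRounds L 0 a

/-- Row stage: odd-even transposition sort by FSWAPs in every row. -/
def rowStage {L : ℕ} (ρ : Equiv.Perm (Site L)) : Circuit L :=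
  (List.finRange L).flatMap fun r =>
    (oet fun c => (ρ (r, c)).2).flatMap fun p => fswap (r, p.1) (r, p.2)

/-- Bare column stage: odd-even transposition sort by FSWAPs on vertical neighbours in every
column, without any parity correction. -/
def colStage {L : ℕ} (κ : Equiv.Perm (Site L)) : Circuit L :=
  (List.finRange L).flatMap fun c =>
    (oet fun r => (κ (r, c)).1).flatMap fun p => fswap (p.1, c) (p.2, c)

/-! ### The diagonal unitary `Γ` -/

/-- The site with the given integer coordinates, if it lies in the grid. -/
def site? (L : ℕ) (r c : ℤ) : Option (Site L) :=
  if h : (0 ≤ r ∧ r < L) ∧ (0 ≤ c ∧ c < L) then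
    some (⟨r.toNat, by omega⟩, ⟨c.toNat, by omega⟩)
  else none

/-- `CNOT((r, c) → (r', c'))`, omitted if a qubit is off the grid. -/
def cnotAt (L : ℕ) (r c r' c' : ℤ) : Circuit L :=
  match site? L r c, site? L r' c' with
  | some p, some q => [.cnot p q]
  | _, _ => []

/-- `CZ((r, c), (r', c'))`, omitted if a qubit is off the grid. -/
def czAt (L : ℕ) (r c r' c' : ℤ) : Circuit L :=
  match site? L r c, site? L r' c' with
  | some p, some q => [.cz p q]
  | _, _ => []

/-- `Z((r, c))`, omitted if the qubit is off the grid. -/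
def zAt (L : ℕ) (r c : ℤ) : Circuit L :=
  match site? L r c with
  | some q => [.z q]
  | none => []

/-- A gadget: for each (integer) column, gates on disjoint qubits. -/
abbrev Gadget (L : ℕ) : Type := ℤ → Circuit L

/-- Skip-row gadget on rows `r, r+1, r+2`; `e = -1` in forward legs, `e = 1` in undo legs. -/
def gSkip (L : ℕ) (r e : ℤ) : Gadget L := fun c =>
  czAt L (r + 1) c (r + 2) c ++
  cnotAt L r (c + e) (r + 1) (c + e) ++
  czAt L (r + 1) (c + 2 * e) (r + 2) (c + 2 * e) ++
  cnotAt L r (c + 3 * e) (r + 1) (c + 3 * e)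

def gCross (L : ℕ) (r : ℤ) : Gadget L := fun c => czAt L r c (r + 1) c

def gSame (L : ℕ) (r : ℤ) : Gadget L := fun c => czAt L r (c - 1) r c

def gZ (L : ℕ) (r : ℤ) : Gadget L := fun c =>
  if ((L : ℤ) - 1 - c) % 2 = 1 then zAt L r c else []

/-- One time step of a sweep over row `r`: the cascade gate and the trailing gadgets `(δ, g)`. -/
def sweepStep (L : ℕ) (r : ℤ) (G : List (ℤ × Gadget L)) (t : ℤ) : Circuit L :=
  (if 0 ≤ t then cnotAt L r t r (t + 1) else []) ++ G.flatMap fun g => g.2 (t + g.1)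

/-- A pipelined sweep over row `r`: the forward leg `t = 0, 1, 2, …`, then the undo leg
`t = L-2, L-3, …`. All offsets used below have absolute value at most `5`, so that a leg fires no
gate after its first `L + 8` steps. -/
def pipeSweep (L : ℕ) (r : ℤ) (Gfwd Gundo : List (ℤ × Gadget L)) : Circuit L :=
  ((List.range (L + 8)).flatMap fun k => sweepStep L r Gfwd (k : ℤ)) ++
  ((List.range (L + 8)).flatMap fun k => sweepStep L r Gundo ((L : ℤ) - 2 - (k : ℤ)))

/-- Enter the column-parity basis: in each column `CNOT((r+1,c) → (r,c))`, `r = L-2, …, 0`. -/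
def phase1 (L : ℕ) : Circuit L :=
  (List.range L).flatMap fun c => (List.range (L - 1)).reverse.flatMap fun r =>
    cnotAt L ((r : ℤ) + 1) c r c

/-- The sweep over an even row `r` in the column-parity basis. -/
def sweepA (L r : ℕ) : Circuit L :=
  pipeSweep L r
    ((if r + 2 < L then [(-1, gSkip L r (-1))] else []) ++
      (if 2 ≤ r then [(-5, gSame L r)] else []))
    ((if r + 2 < L then [(1, gSkip L r 1)] else []) ++
      (if 2 ≤ r then [(5, gZ L r)] else []))

/-- The two batches `r ≡ 0` and `r ≡ 2 mod 4` of sweeps in the column-parity basis. The sweeps of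
one batch act on disjoint sets of qubits, so they run in parallel. -/
def phase2 (L : ℕ) : Circuit L :=
  (((List.range L).filter fun r => r % 4 = 0).flatMap (sweepA L)) ++
  (((List.range L).filter fun r => r % 4 = 2).flatMap (sweepA L))

/-- Leave the column-parity basis: in each column `CNOT((r+1,c) → (r,c))`, `r = 0, …, L-2`. -/
def phase3 (L : ℕ) : Circuit L :=
  (List.range L).flatMap fun c => (List.range (L - 1)).flatMap fun r =>
    cnotAt L ((r : ℤ) + 1) c r c

/-- The sweeps over the even rows in the original basis. -/
def phase4 (L : ℕ) : Circuit L :=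
  ((List.range L).filter fun r => r % 2 = 0 ∧ r + 1 < L).flatMap fun r =>
    pipeSweep L r [(-2, gCross L r), (-3, gSame L r)] [(2, gCross L r), (3, gZ L r)]

/-- For odd `L`, the sweep over the last row, which has no row below it. -/
def phase5 (L : ℕ) : Circuit L :=
  if L % 2 = 1 then
    pipeSweep L ((L : ℤ) - 1) [(-3, gSame L ((L : ℤ) - 1))] [(3, gZ L ((L : ℤ) - 1))]
  else []

/-- The ancilla-free circuit for `Γ`; it depends on `L` only. -/
def gammaCircuit (L : ℕ) : Circuit L :=
  phase1 L ++ phase2 L ++ phase3 L ++ phase4 L ++ phase5 L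

/-! ### The algorithm -/

/-- A row-column-row plan for `π`: within-row, within-column and within-row permutations of the
grid such that `π = ρB ∘ κ ∘ ρA` in the snake labelling. -/
def IsRowColRowPlan {L : ℕ} (π : Equiv.Perm (Fin (L * L))) (ρA κ ρB : Equiv.Perm (Site L)) :
    Prop :=
  (∀ x, (ρA x).1 = x.1) ∧ (∀ x, (κ x).2 = x.2) ∧ (∀ x, (ρB x).1 = x.1) ∧
    ∀ x, jw L (ρB (κ (ρA x))) = π (jw L x)

/-- The five-stage circuit: row sort, `Γ`, bare column sort, `Γ`, row sort. -/
def fiveStage {L : ℕ} (ρA κ ρB : Equiv.Perm (Site L)) : Circuit L :=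
  rowStage ρA ++ gammaCircuit L ++ colStage κ ++ gammaCircuit L ++ rowStage ρB

end FermionicPermutation

namespace FermionicPermutation

/-! ### Monomial operators -/

/-! Every FSWAP and every gate of Γ is monomial, |s⟩ ↦ (-1)^{q s} |f s⟩. Equality of operators,
global phase included, thus reduces to composing the maps f and adding the phases q in `ZMod 2`.

The phase of a fermionic permutation is a `disorder`: the sum of s_x s_y over the pairs of sites
that two orders arrange differently. Modulo 2 it is a cocycle (`disorder_add`), and permuting the
state amounts to relabelling both orders (`disorder_comp`). FSWAPs on neighbours of an order w
implement a permutation σ with phase disorder(w, w ∘ σ) (`implements_fswaps`). Row neighbours are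
neighbours in the snake order; column neighbours are neighbours in `colOrder`. Since Γ is diagonal
with phase disorder(snake, colOrder), the phases of the five stages form a chain of orders from
snake to snake ∘ ρB ∘ κ ∘ ρA and telescope (`implements_row_col_row`). The plan comes from edge
colouring of a regular bipartite multigraph, and the sorting network from the zero-one principle.

For Γ, write s_r for row r, u_r for the sum of the rows from r on, and ⟨f,g⟩ for the sum of f(a)
g(b) over a < b. The form of Γ is the sum over m of ⟨s_{2m}, u_{2m}⟩ + ⟨s_{2m+1}, u_{2m+2}⟩, which
modulo 2 equals ⟨u_{2m}, u_{2m+2}⟩ + ⟨u_{2m+2}, u_{2m+2}⟩ + ⟨s_{2m}, s_{2m+1}⟩ + ⟨s_{2m}, s_{2m}⟩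
(`sum_blocks`). Only nearby rows occur: the first two terms are applied in the column-parity basis,
the last two in the original one. Each ⟨f,g⟩ is local once row f is replaced by its prefix sums,
which a CNOT cascade does. A pipelined sweep equals its untangled version because the gates trailing
the cascade commute with all later cascade gates (`circuitOp_interleave`, `implements_pipeSweep`).

As-soon-as-possible execution is never later than a valid explicit schedule
(`layers_le_of_schedule`). For Γ the schedules end the successive phases by layers L-1, 3L+4 (first
batch), 5L+10 (second batch), 6L+8 and 8L+10; with three sorts of depth 2L this gives 22L+20. Depth
D bounds the number of two-qubit gates by N·D/2; only the linear count for Γ is made directly. -/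

theorem sign_add (a b : ZMod 2) : sign (a + b) = sign a * sign b := by
  have h01 : ∀ b : ZMod 2, b = 0 ∨ b = 1 := by decide
  have h11 : (1 : ZMod 2) + 1 = 0 := by decide
  rcases h01 a with rfl | rfl <;> rcases h01 b with rfl | rfl <;>
    simp [sign, ZMod.val_one, h11]

theorem sign_zero : sign 0 = 1 := by simp [sign]

theorem sign_sum {ι : Type*} (S : Finset ι) (f : ι → ZMod 2) :
    ∏ i ∈ S, sign (f i) = sign (∑ i ∈ S, f i) := by
  classical
  induction S using Finset.induction_on with
  | empty => simp [sign_zero]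
  | insert a S ha ih => rw [Finset.prod_insert ha, Finset.sum_insert ha, sign_add, ih]

/-- The operator `|s⟩ ↦ (-1)^{q s} |f s⟩`. -/
noncomputable def mono {B : Type} [DecidableEq B] (f : B → B) (q : B → ZMod 2) : Matrix B B ℂ :=
  Matrix.of fun t s => if t = f s then sign (q s) else 0

theorem mono_mul {B : Type} [DecidableEq B] [Fintype B] (f f' : B → B) (q q' : B → ZMod 2) :
    mono f' q' * mono f q = mono (f' ∘ f) (fun s => q s + q' (f s)) := by
  ext t s
  simp [mono, Matrix.mul_apply, sign_add, mul_comm]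

theorem mono_id_zero {B : Type} [DecidableEq B] :
    mono (id : B → B) (fun _ => 0) = 1 := by
  ext t s
  simp [mono, Matrix.one_apply, sign_zero]

theorem diagonal_eq_mono {B : Type} [DecidableEq B] (q : B → ZMod 2) :
    Matrix.diagonal (fun s => sign (q s)) = mono id q := by
  ext t s
  by_cases h : t = s
  · subst h; simp [mono]
  · simp [mono, h]

variable {L : ℕ}

theorem circuitOp_append (C D : Circuit L) : circuitOp (C ++ D) = circuitOp D * circuitOp C := by
  induction C with
  | nil => simp [circuitOp]
  | cons g C ih => simp [circuitOp, ih, Matrix.mul_assoc]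

/-- The circuit `C` acts as `|s⟩ ↦ (-1)^{q s} |f s⟩`. -/
def Implements (C : Circuit L) (f : Basis (Site L) → Basis (Site L))
    (q : Basis (Site L) → ZMod 2) : Prop :=
  circuitOp C = mono f q

theorem implements_nil : Implements ([] : Circuit L) id (fun _ => 0) := by
  simp [Implements, circuitOp, mono_id_zero]

theorem Implements.append {C D : Circuit L} {f f' q q'} (h : Implements C f q)
    (h' : Implements D f' q') : Implements (C ++ D) (f' ∘ f) (fun s => q s + q' (f s)) := by
  unfold Implements at *
  rw [circuitOp_append, h, h', mono_mul]

theorem Implements.congr {C : Circuit L} {f f' q q'} (h : Implements C f q)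
    (hf : ∀ s, f s = f' s) (hq : ∀ s, q s = q' s) : Implements C f' q' := by
  rwa [← funext hf, ← funext hq]

theorem implements_z (p : Site L) : Implements [.z p] id (fun s => s p) := by
  simp [Implements, circuitOp, Gate.op, diagonal_eq_mono]

theorem implements_cz (p q : Site L) : Implements [.cz p q] id (fun s => s p * s q) := by
  simp only [Implements, circuitOp, Gate.op, one_mul]
  exact diagonal_eq_mono fun s : Basis (Site L) => s p * s q

theorem implements_cnot (p q : Site L) :
    Implements [.cnot p q] (fun s => Function.update s q (s q + s p)) (fun _ => 0) := by
  simp [Implements, circuitOp, Gate.op, mono, sign_zero]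

/-! ### The FSWAP gate from Hadamards and CNOTs -/

theorem had_mul_apply {M : Matrix (Basis (Site L)) (Basis (Site L)) ℂ} (p : Site L)
    (t s : Basis (Site L)) :
    ((Gate.had p).op * M) t s =
      (M (Function.update t p 0) s + sign (t p) * M (Function.update t p 1) s) /
        (Real.sqrt 2 : ℂ) := by
  rw [Matrix.mul_apply]
  have hne : Function.update t p (0 : ZMod 2) ≠ Function.update t p 1 := by
    intro h
    have := congrFun h p
    simp at this
  rw [← Finset.sum_subset (Finset.subset_univ {Function.update t p 0, Function.update t p 1})]
  · rw [Finset.sum_pair hne]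
    have h0 : ∀ b : ZMod 2, ∀ x, x ≠ p → t x = Function.update t p b x := by
      intro b x hx; simp [hx]
    simp only [Gate.op, Matrix.of_apply]
    rw [if_pos (h0 0), if_pos (h0 1)]
    simp [sign_zero]
    ring
  · intro u _ hu
    have : ¬ ∀ x, x ≠ p → t x = u x := by
      intro h
      apply hu
      have hu' : u = Function.update t p (u p) := by
        ext x
        by_cases hx : x = p
        · subst hx; simp
        · simp [hx, h x hx]
      have h01 : ∀ b : ZMod 2, b = 0 ∨ b = 1 := by decide
      rcases h01 (u p) with h0 | h0 <;> rw [hu', h0] <;> simp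
    simp only [Gate.op, Matrix.of_apply, if_neg this, zero_mul]

theorem sign_one : sign 1 = -1 := by simp [sign, ZMod.val_one]

/-- The first Hadamard replaces the bit at q by a summation variable b with sign (-1)^{s_q b}. The
CNOTs then put s_p + b on p and s_p on q. The last Hadamard sums over b, which forces the output bit
at p to be s_q and leaves the sign (-1)^{s_p s_q}. -/
theorem implements_fswap {p q : Site L} (hpq : p ≠ q) :
    Implements (fswap p q) (fun s => s ∘ Equiv.swap p q) (fun s => s p * s q) := by
  have hc := (implements_cnot q p).append (implements_cnot p q)
  unfold Implements at *
  have e : circuitOp (fswap p q) =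
      (Gate.had p).op * (circuitOp ([.cnot q p] ++ [.cnot p q]) * (Gate.had q).op) := by
    simp [fswap, circuitOp, Matrix.mul_assoc]
  rw [e, hc]
  ext t s
  rw [had_mul_apply]
  set f : Basis (Site L) → Basis (Site L) :=
    (fun s => Function.update s q (s q + s p)) ∘ fun s => Function.update s p (s p + s q) with hf
  -- The entry before the last Hadamard; b = u p + s p is the value that the first Hadamard gave to
  -- q.
  have key : ∀ u : Basis (Site L),
      (mono f (fun s => (fun _ => 0) s + (fun _ => 0)
        ((fun s => Function.update s p (s p + s q)) s)) * (Gate.had q).op) u s =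
      if ∀ x, x ≠ p → x ≠ q → u x = s x then
        if u q = s p then sign (s q * (u p + s p)) / (Real.sqrt 2 : ℂ) else 0
      else 0 := by
    intro u
    have hfp : ∀ v, f v p = v p + v q := by intro v; simp [f, hpq]
    have hfq : ∀ v, f v q = v q + (v p + v q) := by intro v; simp [f, hpq.symm]
    have hfx : ∀ v x, x ≠ p → x ≠ q → f v x = v x := by
      intro v x hx hx'; simp [f, hx, hx']
    -- The two CNOTs are invertible, so the matrix product has a single summand.
    have hinv : ∀ v, u = f v ↔ v = Function.update (Function.update u q (u p + u q)) p (u q) := by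
      have c₁ : ∀ a b : ZMod 2, a = b + (a + b) := by decide
      have c₂ : ∀ a b : ZMod 2, b = a + b + (b + (a + b)) := by decide
      intro v
      constructor
      · rintro rfl
        ext x
        by_cases hx : x = p
        · subst hx
          rw [Function.update_self, hfq]
          exact c₁ _ _
        · by_cases hx' : x = q
          · subst hx'
            rw [Function.update_of_ne hx, Function.update_self, hfp, hfq]
            exact c₂ _ _
          · rw [Function.update_of_ne hx, Function.update_of_ne hx', hfx v x hx hx']
      · rintro rfl
        ext x
        by_cases hx : x = p
        · subst hx
          rw [hfp, Function.update_self, Function.update_of_ne hpq.symm, Function.update_self]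
          exact c₁ _ _
        · by_cases hx' : x = q
          · subst hx'
            rw [hfq, Function.update_self, Function.update_of_ne hx, Function.update_self]
            exact c₂ _ _
          · rw [hfx _ x hx hx', Function.update_of_ne hx, Function.update_of_ne hx']
    rw [Matrix.mul_apply]
    simp only [mono, Matrix.of_apply, hinv]
    simp only [ite_mul, zero_mul, Finset.sum_ite_eq', Finset.mem_univ, if_true, add_zero, sign_zero,
      one_mul]
    simp only [Gate.op, Matrix.of_apply]
    by_cases h1 : ∀ x, x ≠ p → x ≠ q → u x = s x
    · rw [if_pos h1]
      by_cases h2 : u q = s p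
      · rw [if_pos, if_pos h2]
        · simp [hpq.symm, h2]
        · intro x hx
          by_cases hx' : x = p
          · subst hx'; simpa using h2
          · simp [hx, hx', h1 x hx' hx]
      · rw [if_neg, if_neg h2]
        intro h
        apply h2
        simpa using h p hpq
    · rw [if_neg, if_neg h1]
      intro h
      apply h1
      intro x hx hx'
      simpa [hx, hx'] using h x hx'
  rw [key, key]
  have sq : (Real.sqrt 2 : ℂ) * Real.sqrt 2 = 2 := by
    rw [← Complex.ofReal_mul, Real.mul_self_sqrt (by norm_num)]; norm_num
  have sq0 : (Real.sqrt 2 : ℂ) ≠ 0 := by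
    intro h; rw [h] at sq; norm_num at sq
  simp only [mono, Matrix.of_apply]
  have hup : ∀ b : ZMod 2, (∀ x, x ≠ p → x ≠ q → Function.update t p b x = s x) ↔
      (∀ x, x ≠ p → x ≠ q → t x = s x) := by
    intro b
    refine forall_congr' fun x => ?_
    constructor
    · intro h hx hx'; simpa [hx] using h hx hx'
    · intro h hx hx'; simpa [hx] using h hx hx'
  have hts : t = s ∘ Equiv.swap p q ↔
      (∀ x, x ≠ p → x ≠ q → t x = s x) ∧ t q = s p ∧ t p = s q := by
    constructor
    · rintro rfl
      refine ⟨fun x hx hx' => ?_, by simp, by simp⟩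
      simp [Equiv.swap_apply_of_ne_of_ne hx hx']
    · rintro ⟨h1, h2, h3⟩
      ext x
      by_cases hx : x = p
      · subst hx; simp [h3]
      · by_cases hx' : x = q
        · subst hx'; simp [h2]
        · simp [Equiv.swap_apply_of_ne_of_ne hx hx', h1 x hx hx']
  simp only [hup, hts]
  by_cases h1 : ∀ x, x ≠ p → x ≠ q → t x = s x
  · have h1' : (∀ x, x ≠ p → x ≠ q → t x = s x) = True := eq_true h1
    simp only [h1', if_true, true_and, Function.update_of_ne hpq.symm, Function.update_self]
    by_cases h2 : t q = s p
    · simp only [h2, if_true, true_and]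
      have h01 : ∀ b : ZMod 2, b = 0 ∨ b = 1 := by decide
      have h11 : (1 : ZMod 2) + 1 = 0 := by decide
      rcases h01 (t p) with ht | ht <;> rcases h01 (s q) with hs | hs <;>
        rcases h01 (s p) with hp | hp <;>
        simp [ht, hs, hp, sign_zero, sign_one, h11] <;> field_simp <;>
        simp [pow_two, sq] <;> norm_num
    · simp [h2]
  · have h1' : (∀ x, x ≠ p → x ≠ q → t x = s x) = False := eq_false h1
    simp only [h1', if_false, false_and]
    simp

/-! ### Quadratic forms comparing two orders -/

section Disorder

variable {Q : Type} [Fintype Q]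

/-- The sum of `s x * s y` over the pairs which the orders `a` and `b` arrange differently. -/
def disorder (a b : Q → ℕ) (s : Basis Q) : ZMod 2 :=
  ∑ x, ∑ y, if a x < a y ∧ b y < b x then s x * s y else 0

/-- The auxiliary order e lists each pair once, and a and b disagree on a pair exactly when their
two indicators add up to 1 in `ZMod 2`. In this form sums of disorders can be compared term by term.
-/
theorem disorder_eq {a b e : Q → ℕ} (ha : a.Injective) (hb : b.Injective) (he : e.Injective)
    (s : Basis Q) :
    disorder a b s = ∑ x, ∑ y, if e x < e y then
      ((if a x < a y then 1 else 0) + (if b x < b y then 1 else 0)) * (s x * s y) else 0 := by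
  set g : Q → Q → ZMod 2 := fun x y => if a x < a y ∧ b y < b x then s x * s y else 0 with hg
  have h1 : disorder a b s =
      ∑ x, ∑ y, ((if e x < e y then g x y else 0) + (if e y < e x then g x y else 0)) := by
    refine Finset.sum_congr rfl fun x _ => Finset.sum_congr rfl fun y _ => ?_
    rcases lt_trichotomy (e x) (e y) with h | h | h
    · simp [h, h.not_gt, hg]
    · have : x = y := he h
      subst this
      simp
    · simp [h, h.not_gt, hg]
  rw [h1]
  simp only [Finset.sum_add_distrib]
  rw [Finset.sum_comm (f := fun x y => if e y < e x then g x y else 0)]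
  simp only [← Finset.sum_add_distrib]
  refine Finset.sum_congr rfl fun x _ => Finset.sum_congr rfl fun y _ => ?_
  by_cases h : e x < e y
  · have hxy : x ≠ y := by rintro rfl; exact lt_irrefl _ h
    have hax := ha.ne hxy
    have hbx := hb.ne hxy
    have h11 : (1 : ZMod 2) + 1 = 0 := by decide
    simp only [if_pos h, hg]
    by_cases h2 : a x < a y <;> by_cases h3 : b x < b y
    · rw [if_neg (by omega), if_neg (by omega), if_pos h2, if_pos h3, h11]; simp
    · rw [if_pos (by omega), if_neg (by omega), if_pos h2, if_neg h3]; simp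
    · rw [if_neg (by omega), if_pos (by omega), if_neg h2, if_pos h3]; simp [mul_comm]
    · rw [if_neg (by omega), if_neg (by omega), if_neg h2, if_neg h3]; simp
  · simp [h]

/-- Over a common reference order the indicator of the middle order b occurs twice and cancels. -/
theorem disorder_add {a b c : Q → ℕ} (ha : a.Injective) (hb : b.Injective) (hc : c.Injective)
    (s : Basis Q) : disorder a b s + disorder b c s = disorder a c s := by
  rw [disorder_eq ha hb ha, disorder_eq hb hc ha, disorder_eq ha hc ha]
  simp only [← Finset.sum_add_distrib]
  refine Finset.sum_congr rfl fun x _ => Finset.sum_congr rfl fun y _ => ?_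
  have char2 : ∀ u v w z : ZMod 2, (u + v) * z + (v + w) * z = (u + w) * z := by decide
  split_ifs <;> first | exact char2 _ _ _ _ | simp

theorem disorder_comm (a b : Q → ℕ) (s : Basis Q) : disorder a b s = disorder b a s := by
  unfold disorder
  rw [Finset.sum_comm]
  refine Finset.sum_congr rfl fun x _ => Finset.sum_congr rfl fun y _ => ?_
  simp only [and_comm, mul_comm]

theorem disorder_comp (a b : Q → ℕ) (σ : Equiv.Perm Q) (s : Basis Q) :
    disorder a b (s ∘ σ.symm) = disorder (a ∘ σ) (b ∘ σ) s := by
  unfold disorder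
  rw [← Equiv.sum_comp σ]
  refine Finset.sum_congr rfl fun x _ => ?_
  rw [← Equiv.sum_comp σ]
  simp

theorem disorder_self (a : Q → ℕ) (s : Basis Q) : disorder a a s = 0 := by
  unfold disorder
  refine Finset.sum_eq_zero fun x _ => Finset.sum_eq_zero fun y _ => ?_
  rw [if_neg]
  omega

/-- No third site lies between p and q, so their exchange reverses this pair only. -/
theorem disorder_swap_of_lt [DecidableEq Q] {a : Q → ℕ} (ha : a.Injective) {p q : Q}
    (h : a q = a p + 1) (s : Basis Q) : disorder a (a ∘ Equiv.swap p q) s = s p * s q := by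
  have hpq : p ≠ q := by rintro rfl; omega
  have key : ∀ x y, (a x < a y ∧ (a ∘ Equiv.swap p q) y < (a ∘ Equiv.swap p q) x) ↔
      x = p ∧ y = q := by
    intro x y
    have inj : ∀ u v, a u = a v ↔ u = v := fun u v => ha.eq_iff
    have e1 := inj x p
    have e2 := inj x q
    have e3 := inj y p
    have e4 := inj y q
    simp only [Function.comp, Equiv.swap_apply_def]
    split_ifs <;> grind
  unfold disorder
  rw [Finset.sum_eq_single p, Finset.sum_eq_single q]
  · rw [if_pos ((key _ _).2 ⟨rfl, rfl⟩)]
  · intro y _ hy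
    rw [if_neg]
    exact fun h => hy ((key _ _).1 h).2
  · simp
  · intro x _ hx
    refine Finset.sum_eq_zero fun y _ => ?_
    rw [if_neg]
    exact fun h => hx ((key _ _).1 h).1
  · simp

theorem disorder_swap [DecidableEq Q] {a : Q → ℕ} (ha : a.Injective) {p q : Q}
    (h : a q = a p + 1 ∨ a p = a q + 1) (s : Basis Q) :
    disorder a (a ∘ Equiv.swap p q) s = s p * s q := by
  rcases h with h | h
  · exact disorder_swap_of_lt ha h s
  · rw [Equiv.swap_comm, disorder_swap_of_lt ha h s, mul_comm]

end Disorder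

/-! ### Products of FSWAPs -/

/-- The permutation performed by a list of swaps, the head acting first. -/
def swapProd {Q : Type} [DecidableEq Q] : List (Q × Q) → Equiv.Perm Q
  | [] => 1
  | p :: W => swapProd W * Equiv.swap p.1 p.2

theorem implements_fswaps {w : Site L → ℕ} (hw : w.Injective) :
    ∀ W : List (Site L × Site L), (∀ p ∈ W, w p.2 = w p.1 + 1 ∨ w p.1 = w p.2 + 1) →
      Implements (W.flatMap fun p => fswap p.1 p.2) (fun s => s ∘ (swapProd W).symm)
        (disorder w (w ∘ swapProd W))
  | [], _ => by
      refine implements_nil.congr (fun s => ?_) (fun s => ?_)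
      · rfl
      · exact (disorder_self _ _).symm
  | p :: W, h => by
      have hp := h p (by simp)
      have hne : p.1 ≠ p.2 := by intro e; rw [e] at hp; omega
      have := (implements_fswap hne).append
        (implements_fswaps hw W fun x hx => h x (by simp [hx]))
      rw [List.flatMap_cons]
      refine this.congr (fun s => ?_) (fun s => ?_)
      · rfl
      -- The later swaps see the permuted state. Pulled back by `disorder_comp`, their phase starts
      -- at the order in which the phase of the first swap ends.
      · rw [← disorder_swap hw hp s]
        have e : s ∘ Equiv.swap p.1 p.2 = s ∘ (Equiv.swap p.1 p.2).symm := by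
          rw [Equiv.symm_swap]
        rw [e, disorder_comp, disorder_add hw]
        · rfl
        · exact hw.comp (Equiv.injective _)
        · exact (hw.comp (Equiv.injective _)).comp (Equiv.injective _)

/-! ### Fermionic permutations as monomial operators -/

/-- The position of a site in the snake order. -/
def snake (x : Site L) : ℕ := (jw L x).val

theorem snake_injective : (snake (L := L)).Injective :=
  Fin.val_injective.comp (jw L).injective

/-- The order of the sites by columns from right to left, each column from top to bottom. -/
def colOrder (x : Site L) : ℕ := (L - 1 - x.2.val) * L + x.1.val

theorem colOrder_lt_iff (x y : Site L) :
    colOrder x < colOrder y ↔ y.2 < x.2 ∨ x.2 = y.2 ∧ x.1 < y.1 := by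
  obtain ⟨⟨r, hr⟩, ⟨c, hc⟩⟩ := x
  obtain ⟨⟨r', hr'⟩, ⟨c', hc'⟩⟩ := y
  simp only [colOrder, Fin.mk_lt_mk, Fin.mk.injEq]
  rcases lt_trichotomy c c' with h | h | h
  · have : (L - 1 - c') * L + L ≤ (L - 1 - c) * L := by
      rw [← Nat.succ_mul]
      exact Nat.mul_le_mul_right _ (by omega)
    omega
  · subst h; omega
  · have : (L - 1 - c) * L + L ≤ (L - 1 - c') * L := by
      rw [← Nat.succ_mul]
      exact Nat.mul_le_mul_right _ (by omega)
    omega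

theorem colOrder_injective : (colOrder (L := L)).Injective := by
  intro x y h
  have h1 := colOrder_lt_iff x y
  have h2 := colOrder_lt_iff y x
  rw [h] at h1 h2
  simp only [lt_irrefl, false_iff, not_or, not_and, not_lt] at h1 h2
  have e2 : x.2 = y.2 := le_antisymm h1.1 h2.1
  exact Prod.ext (le_antisymm (h2.2 e2.symm) (h1.2 e2)) e2

/-- Read through `jw`, the inversions of π are the pairs arranged differently by snake and snake ∘
σ, so the product of the CZ signs is the sign of this disorder. -/
theorem modeOp_eq_fermionicPerm {C : Circuit L} {π : Equiv.Perm (Fin (L * L))}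
    {σ : Equiv.Perm (Site L)} (hσ : ∀ x, jw L (σ x) = π (jw L x))
    (h : Implements C (fun s => s ∘ σ.symm) (disorder snake (snake ∘ σ))) :
    modeOp C = fermionicPerm π := by
  ext t s
  unfold Implements at h
  simp only [modeOp, h, fermionicPerm, permOp, phaseOp, Matrix.mul_diagonal, Matrix.of_apply,
    Matrix.reindex_apply, Matrix.submatrix_apply, mono]
  have hσ' : ∀ i, (jw L).symm (π.symm i) = σ.symm ((jw L).symm i) := by
    intro i
    rw [Equiv.symm_apply_eq, Equiv.symm_apply_eq, ← hσ]
    simp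
  have hcond : ((Equiv.arrowCongr (jw L) (Equiv.refl (ZMod 2))).symm t =
      (Equiv.arrowCongr (jw L) (Equiv.refl (ZMod 2))).symm s ∘ σ.symm) ↔ t = s ∘ π.symm := by
    constructor
    · intro e
      ext i
      have := congrFun e ((jw L).symm i)
      simp only [Equiv.arrowCongr_symm, Equiv.arrowCongr_apply, Function.comp, Equiv.refl_symm,
        Equiv.coe_refl, id, Equiv.symm_symm, Equiv.apply_symm_apply] at this
      rw [this, ← hσ']
      simp
    · rintro rfl
      ext x
      have := hσ' (jw L x)
      simp only [Equiv.symm_apply_apply] at this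
      simp [← this]
  simp only [hcond]
  by_cases ht : t = s ∘ π.symm
  · rw [if_pos ht, if_pos ht, one_mul, Finset.prod_apply]
    simp only [czSign, sign_sum]
    congr 1
    unfold disorder inversions
    rw [Finset.sum_filter, Fintype.sum_prod_type (γ := ZMod 2) (α₁ := Fin (L * L)), ← Equiv.sum_comp (jw L)]
    refine Finset.sum_congr rfl fun x _ => ?_
    rw [← Equiv.sum_comp (jw L)]
    refine Finset.sum_congr rfl fun y _ => ?_
    simp [snake, hσ]
  · simp [ht]

/-- Pulled back to the input state, the five phases join consecutive members of the chain snake,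
snake ∘ ρA, colOrder ∘ ρA, colOrder ∘ κ ∘ ρA, snake ∘ κ ∘ ρA, snake ∘ ρB ∘ κ ∘ ρA. -/
theorem implements_row_col_row {A G K B : Circuit L} {ρA κ ρB : Equiv.Perm (Site L)}
    (hA : Implements A (fun s => s ∘ ρA.symm) (disorder snake (snake ∘ ρA)))
    (hG : Implements G id (disorder snake colOrder))
    (hK : Implements K (fun s => s ∘ κ.symm) (disorder colOrder (colOrder ∘ κ)))
    (hB : Implements B (fun s => s ∘ ρB.symm) (disorder snake (snake ∘ ρB))) :
    Implements (A ++ G ++ K ++ G ++ B) (fun s => s ∘ (ρB * κ * ρA).symm)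
      (disorder snake (snake ∘ (ρB * κ * ρA))) := by
  refine ((((hA.append hG).append hK).append hG).append hB).congr (fun s => ?_) (fun s => ?_)
  · rfl
  · have inj : ∀ σ : Equiv.Perm (Site L), (snake ∘ σ).Injective :=
      fun σ => snake_injective.comp σ.injective
    have inj' : ∀ σ : Equiv.Perm (Site L), (colOrder ∘ σ).Injective :=
      fun σ => colOrder_injective.comp σ.injective
    simp only [Function.comp_def, id]
    change disorder snake (snake ∘ ρA) s + disorder snake colOrder (s ∘ ρA.symm) +
      disorder colOrder (colOrder ∘ κ) (s ∘ ρA.symm) +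
      disorder snake colOrder ((s ∘ ρA.symm) ∘ κ.symm) +
      disorder snake (snake ∘ ρB) ((s ∘ ρA.symm) ∘ κ.symm) = _
    -- The second Γ is read backwards, from the column order to the snake order.
    rw [disorder_comm snake colOrder ((s ∘ ρA.symm) ∘ κ.symm)]
    simp only [disorder_comp]
    rw [disorder_add snake_injective (inj _) (inj' _),
      disorder_add snake_injective (inj' _) ((inj' κ).comp ρA.injective),
      disorder_add snake_injective ((inj' κ).comp ρA.injective) ((inj κ).comp ρA.injective),
      disorder_add snake_injective ((inj κ).comp ρA.injective)
        (((inj ρB).comp κ.injective).comp ρA.injective)]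
    rfl

/-! ### Odd-even transposition sort -/

theorem mem_oetRound {k : ℕ} {a : Fin L → Fin L} {p : Fin L × Fin L} :
    p ∈ oetRound k a ↔ p.2.val = p.1.val + 1 ∧ p.1.val % 2 = k % 2 ∧ a p.2 < a p.1 := by
  obtain ⟨i, j⟩ := p
  simp only [oetRound, List.mem_flatMap, List.mem_finRange, true_and]
  constructor
  · rintro ⟨i', h⟩
    split_ifs at h with h1 h2
    · simp only [List.mem_singleton, Prod.mk.injEq] at h
      obtain ⟨rfl, rfl⟩ := h
      exact ⟨rfl, h2⟩
    · simp at h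
    · simp at h
  · rintro ⟨h1, h2, h3⟩
    have hlt : i.val + 1 < L := h1 ▸ j.isLt
    obtain rfl : j = ⟨i.val + 1, hlt⟩ := Fin.ext h1
    refine ⟨i, ?_⟩
    rw [dif_pos hlt, if_pos ⟨h2, h3⟩]
    simp

/-- The swaps `p` and `q` act on different positions. -/
def DisjointSwaps {Q : Type} (p q : Q × Q) : Prop :=
  p.1 ≠ q.1 ∧ p.1 ≠ q.2 ∧ p.2 ≠ q.1 ∧ p.2 ≠ q.2

theorem pairwise_oetRound (k : ℕ) (a : Fin L → Fin L) :
    (oetRound k a).Pairwise DisjointSwaps := by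
  unfold oetRound
  rw [List.pairwise_flatMap]
  constructor
  · intro i _
    split_ifs <;> simp
  · refine (List.nodup_finRange L).imp ?_
    intro i j hij p hp q hq
    have hne : i.val ≠ j.val := fun h => hij (Fin.ext h)
    split_ifs at hp with h1 h2
    · split_ifs at hq with h3 h4
      · simp only [List.mem_singleton] at hp hq
        subst hp hq
        simp only [DisjointSwaps, ne_eq, Fin.ext_iff]
        omega
      · simp at hq
      · simp at hq
    · simp at hp
    · simp at hp

theorem applySwaps_cons (a : Fin L → Fin L) (p : Fin L × Fin L) (w : List (Fin L × Fin L)) :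
    applySwaps a (p :: w) = applySwaps (a ∘ Equiv.swap p.1 p.2) w := rfl

theorem applySwaps_append (a : Fin L → Fin L) (v w : List (Fin L × Fin L)) :
    applySwaps a (v ++ w) = applySwaps (applySwaps a v) w := by
  simp [applySwaps]

theorem applySwaps_eq_comp (w : List (Fin L × Fin L)) (a : Fin L → Fin L) :
    applySwaps a w = a ∘ (swapProd w).symm := by
  induction w generalizing a with
  | nil => rfl
  | cons p w ih =>
    rw [applySwaps_cons, ih]
    rfl

theorem applySwaps_of_untouched {w : List (Fin L × Fin L)} {x : Fin L} (a : Fin L → Fin L)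
    (h : ∀ p ∈ w, x ≠ p.1 ∧ x ≠ p.2) : applySwaps a w x = a x := by
  induction w generalizing a with
  | nil => rfl
  | cons p w ih =>
    rw [applySwaps_cons, ih _ fun q hq => h q (by simp [hq])]
    have := h p (by simp)
    simp [Equiv.swap_apply_of_ne_of_ne this.1 this.2]

theorem applySwaps_of_mem {w : List (Fin L × Fin L)} {p : Fin L × Fin L} (a : Fin L → Fin L)
    (hw : w.Pairwise DisjointSwaps) (hp : p ∈ w) :
    applySwaps a w p.1 = a p.2 ∧ applySwaps a w p.2 = a p.1 := by
  induction w generalizing a with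
  | nil => simp at hp
  | cons q w ih =>
    rw [List.pairwise_cons] at hw
    rw [applySwaps_cons]
    rcases List.mem_cons.1 hp with rfl | hp'
    · rw [applySwaps_of_untouched _ fun q hq => ⟨(hw.1 q hq).1, (hw.1 q hq).2.1⟩,
        applySwaps_of_untouched _ fun q hq => ⟨(hw.1 q hq).2.2.1, (hw.1 q hq).2.2.2⟩]
      simp
    · obtain ⟨h1, h2, h3, h4⟩ := hw.1 p hp'
      have := ih (a ∘ Equiv.swap q.1 q.2) hw.2 hp'
      rw [this.1, this.2]
      simp [Equiv.swap_apply_of_ne_of_ne h2.symm h4.symm,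
        Equiv.swap_apply_of_ne_of_ne h1.symm h3.symm]

/-- One round of odd-even transposition sort, applied to the destinations. -/
def oetStep (k : ℕ) (a : Fin L → Fin L) : Fin L → Fin L := applySwaps a (oetRound k a)

theorem oetStep_pair {k : ℕ} {a : Fin L → Fin L} {i j : Fin L} (hij : j.val = i.val + 1)
    (hk : i.val % 2 = k % 2) :
    oetStep k a i = min (a i) (a j) ∧ oetStep k a j = max (a i) (a j) := by
  by_cases h : a j < a i
  · have hm : (i, j) ∈ oetRound k a := mem_oetRound.2 ⟨hij, hk, h⟩
    have := applySwaps_of_mem a (pairwise_oetRound k a) hm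
    rw [min_eq_right h.le, max_eq_left h.le]
    exact this
  · have hu : ∀ x, x = i ∨ x = j → ∀ p ∈ oetRound k a, x ≠ p.1 ∧ x ≠ p.2 := by
      rintro x hx ⟨u, v⟩ hp
      obtain ⟨h1, h2, h3⟩ := mem_oetRound.1 hp
      simp only at h1 h2 h3
      have aux : ¬ (u = i) := by
        rintro rfl
        have : v = j := Fin.ext (by omega)
        subst this
        exact h h3
      have aux' : u.val ≠ i.val := fun e => aux (Fin.ext e)
      constructor
      · rintro rfl
        rcases hx with rfl | rfl
        · exact aux' rfl
        · omega
      · rintro rfl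
        rcases hx with rfl | rfl <;> omega
    rw [not_lt] at h
    rw [min_eq_left h, max_eq_right h]
    exact ⟨applySwaps_of_untouched a (hu i (Or.inl rfl)),
      applySwaps_of_untouched a (hu j (Or.inr rfl))⟩

theorem oetStep_single {k : ℕ} {a : Fin L → Fin L} {i : Fin L}
    (h : i.val % 2 = k % 2 ∧ i.val + 1 = L ∨ i.val = 0 ∧ k % 2 = 1) :
    oetStep k a i = a i := by
  refine applySwaps_of_untouched a ?_
  rintro ⟨u, v⟩ hp
  obtain ⟨h1, h2, h3⟩ := mem_oetRound.1 hp
  simp only at h1 h2 h3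
  have := v.isLt
  constructor
  · rintro rfl
    omega
  · rintro rfl
    omega

/-- The number of items at positions `≥ i` with destinations `≥ θ`. -/
def tailCount (θ : ℕ) (a : Fin L → Fin L) (i : ℕ) : ℕ :=
  (Finset.univ.filter fun x : Fin L => i ≤ x.val ∧ θ ≤ (a x).val).card

theorem tailCount_of_ge (θ : ℕ) (a : Fin L → Fin L) {i : ℕ} (hi : L ≤ i) :
    tailCount θ a i = 0 := by
  rw [tailCount, Finset.card_eq_zero, Finset.filter_eq_empty_iff]
  intro x _ h
  omega

theorem tailCount_succ (θ : ℕ) (a : Fin L → Fin L) (i : Fin L) :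
    tailCount θ a i = tailCount θ a (i + 1) + if θ ≤ (a i).val then 1 else 0 := by
  unfold tailCount
  split_ifs with h
  · have : (Finset.univ.filter fun x : Fin L => i.val ≤ x.val ∧ θ ≤ (a x).val) =
        insert i (Finset.univ.filter fun x : Fin L => i.val + 1 ≤ x.val ∧ θ ≤ (a x).val) := by
      ext x
      simp only [Finset.mem_filter, Finset.mem_univ, true_and, Finset.mem_insert]
      constructor
      · rintro ⟨h1, h2⟩
        by_cases hx : x = i
        · exact Or.inl hx
        · have : x.val ≠ i.val := fun e => hx (Fin.ext e)
          exact Or.inr ⟨by omega, h2⟩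
      · rintro (rfl | ⟨h1, h2⟩)
        · exact ⟨le_rfl, h⟩
        · exact ⟨by omega, h2⟩
    rw [this, Finset.card_insert_of_notMem]
    simp
  · rw [add_zero]
    congr 1
    ext x
    simp only [Finset.mem_filter, Finset.mem_univ, true_and]
    constructor
    · rintro ⟨h1, h2⟩
      have : x.val ≠ i.val := by
        intro e
        rw [Fin.ext e] at h2
        exact h h2
      exact ⟨by omega, h2⟩
    · rintro ⟨h1, h2⟩
      exact ⟨by omega, h2⟩

/-- A cut before a position i ≡ k separates no pair of round k. The induction, on a bound for the
distance to the right end, removes one pair at a time. -/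
theorem tailCount_oetStep_of_even (θ k : ℕ) (a : Fin L → Fin L) (n i : ℕ) (hn : L ≤ i + n)
    (hi : i % 2 = k % 2) : tailCount θ (oetStep k a) i = tailCount θ a i := by
  induction n using Nat.strong_induction_on generalizing i with
  | _ n ih =>
    by_cases h0 : L ≤ i
    · rw [tailCount_of_ge _ _ h0, tailCount_of_ge _ _ h0]
    · by_cases h1 : i + 1 = L
      · have e1 := tailCount_succ θ (oetStep k a) ⟨i, by omega⟩
        have e2 := tailCount_succ θ a ⟨i, by omega⟩
        rw [oetStep_single (Or.inl ⟨hi, h1⟩)] at e1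
        simp only at e1 e2
        rw [e1, e2, tailCount_of_ge _ _ h1.ge, tailCount_of_ge _ _ h1.ge]
      · have e1 := tailCount_succ θ (oetStep k a) ⟨i, by omega⟩
        have e2 := tailCount_succ θ a ⟨i, by omega⟩
        have e3 := tailCount_succ θ (oetStep k a) ⟨i + 1, by omega⟩
        have e4 := tailCount_succ θ a ⟨i + 1, by omega⟩
        have hp := oetStep_pair (a := a) (i := ⟨i, by omega⟩) (j := ⟨i + 1, by omega⟩) rfl hi
        rw [hp.1] at e1
        rw [hp.2] at e3
        have h2 := ih (n - 2) (by omega) (i + 1 + 1) (by omega) (by omega)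
        simp only at e1 e2 e3 e4
        rw [e1, e2, e3, e4, h2]
        rcases le_total (a ⟨i, by omega⟩) (a ⟨i + 1, by omega⟩) with h | h
        · rw [min_eq_left h, max_eq_right h]
        · rw [min_eq_right h, max_eq_left h]
          omega

theorem tailCount_oetStep_zero (θ k : ℕ) (a : Fin L → Fin L) :
    tailCount θ (oetStep k a) 0 = tailCount θ a 0 := by
  by_cases hk : k % 2 = 0
  · exact tailCount_oetStep_of_even θ k a L 0 (by omega) (by omega)
  · by_cases hL : L = 0
    · rw [tailCount_of_ge _ _ hL.le, tailCount_of_ge _ _ hL.le]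
    · have e1 := tailCount_succ θ (oetStep k a) ⟨0, by omega⟩
      have e2 := tailCount_succ θ a ⟨0, by omega⟩
      rw [oetStep_single (Or.inr ⟨rfl, by omega⟩)] at e1
      simp only at e1 e2
      rw [e1, e2, tailCount_oetStep_of_even θ k a L (0 + 1) (by omega) (by omega)]

/-- Here the cut runs through a pair. Its right place gets the larger item, so the tail gains one
over `tailCount θ a (i + 1 + 1)` as soon as either item of the pair is at least θ. -/
theorem tailCount_oetStep_of_odd (θ k : ℕ) (a : Fin L → Fin L) (i : ℕ) (hi : i + 1 < L)
    (hk : i % 2 = k % 2) :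
    tailCount θ (oetStep k a) (i + 1) = min (tailCount θ a i) (tailCount θ a (i + 1 + 1) + 1) := by
  have e2 := tailCount_succ θ a ⟨i, by omega⟩
  have e3 := tailCount_succ θ (oetStep k a) ⟨i + 1, by omega⟩
  have e4 := tailCount_succ θ a ⟨i + 1, by omega⟩
  have hp := oetStep_pair (a := a) (i := ⟨i, by omega⟩) (j := ⟨i + 1, by omega⟩) rfl hk
  have h2 := tailCount_oetStep_of_even θ k a L (i + 1 + 1) (by omega) (by omega)
  rw [hp.2] at e3
  simp only at e2 e3 e4
  rw [e3, e2, e4, h2]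
  rcases le_total (a ⟨i, by omega⟩) (a ⟨i + 1, by omega⟩) with h | h
  · rw [max_eq_right h]
    have h' : (a ⟨i, by omega⟩).val ≤ (a ⟨i + 1, by omega⟩).val := h
    split_ifs <;> omega
  · rw [max_eq_left h]
    have h' : (a ⟨i + 1, by omega⟩).val ≤ (a ⟨i, by omega⟩).val := h
    split_ifs <;> omega

/-- After `k` rounds the items with destinations `≥ θ` have advanced this far; `m` is their number
and `μ` is the even number in `{m - 2, m - 1}`. -/
def OetProgress (θ m μ k : ℕ) (a : Fin L → Fin L) : Prop :=
  tailCount θ a 0 = m ∧ ∀ i ≤ L, m ≤ tailCount θ a i ∨ L ≤ tailCount θ a i + i ∨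
    μ + k < 2 * tailCount θ a i + i

theorem tailCount_zero_le (θ : ℕ) (a : Fin L → Fin L) :
    ∀ i ≤ L, tailCount θ a 0 ≤ tailCount θ a i + i
  | 0, _ => by omega
  | i + 1, h => by
    have h1 := tailCount_zero_le θ a i (by omega)
    have h2 := tailCount_succ θ a ⟨i, by omega⟩
    simp only at h2
    split_ifs at h2 <;> omega

theorem OetProgress.init {θ m μ : ℕ} {a : Fin L → Fin L} (h : tailCount θ a 0 = m)
    (hμ : μ + 1 ≤ m) : OetProgress θ m μ 0 a := by
  refine ⟨h, fun i hi => ?_⟩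
  have := tailCount_zero_le θ a i hi
  omega

theorem OetProgress.step {θ m μ k : ℕ} {a : Fin L → Fin L} (h : OetProgress θ m μ k a)
    (h2 : μ % 2 = 0) : OetProgress θ m μ (k + 1) (oetStep k a) := by
  obtain ⟨h0, h⟩ := h
  have hz : tailCount θ (oetStep k a) 0 = m := by rw [tailCount_oetStep_zero, h0]
  refine ⟨hz, fun i hi => ?_⟩
  -- Where i ≡ k, both sides of μ + k < 2 * tailCount + i have the same parity because μ is even, so
  -- the inequality has slack 2 and survives the next round. At a cut through a pair, the left
  -- neighbour supplies this slack, and the right neighbour supplies the extra item.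
  by_cases hk : i % 2 = k % 2
  · rw [tailCount_oetStep_of_even θ k a L i (by omega) hk]
    have := h i hi
    omega
  · by_cases hi0 : i = 0
    · subst hi0
      left
      exact hz.ge
    · by_cases hiL : i = L
      · omega
      · obtain ⟨j, rfl⟩ : ∃ j, i = j + 1 := ⟨i - 1, by omega⟩
        rw [tailCount_oetStep_of_odd θ k a j (by omega) (by omega)]
        have u1 := h j (by omega)
        have u2 := h (j + 1 + 1) (by omega)
        omega

theorem OetProgress.rounds {θ m μ : ℕ} (h2 : μ % 2 = 0) (n : ℕ) :
    ∀ {k : ℕ} {a : Fin L → Fin L}, OetProgress θ m μ k a →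
      OetProgress θ m μ (k + n) (applySwaps a (oetRounds n k a)) := by
  induction n with
  | zero => intro k a h; exact h
  | succ n ih =>
    intro k a h
    rw [oetRounds, applySwaps_append, show k + (n + 1) = (k + 1) + n by omega]
    exact ih (h.step h2)

/-- Odd-even transposition sort sorts. -/
theorem applySwaps_oet {a : Fin L → Fin L} (ha : a.Injective) : applySwaps a (oet a) = id := by
  set b := applySwaps a (oet a) with hb
  have hbi : b.Injective := by
    rw [hb, applySwaps_eq_comp]
    exact ha.comp (Equiv.injective _)
  -- Zero-one principle at threshold x: once the L - x items with destination at least x occupy all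
  -- positions from x on, position x holds one of them.
  have hle : ∀ x, x ≤ b x := by
    intro x
    have hx := x.isLt
    have hm : tailCount x.val a 0 = L - x.val := by
      have e : tailCount x.val a 0 = (Finset.univ.filter fun y : Fin L => x ≤ y).card := by
        unfold tailCount
        refine Finset.card_bij (fun y _ => a y) ?_ ?_ ?_
        · intro y hy
          simpa using hy
        · intro y _ z _ h
          exact ha h
        · intro y hy
          obtain ⟨z, rfl⟩ := (Finite.injective_iff_surjective.1 ha) y
          exact ⟨z, by simpa using hy, rfl⟩
      rw [e, Finset.filter_le_eq_Ici, Fin.card_Ici]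
    -- Here μ ≥ L - x - 2, so after L rounds the last alternative at the cut x gives 2 (L - x) - 2 <
    -- 2 * tailCount; every alternative yields tailCount ≥ L - x.
    have hpr := (OetProgress.init (μ := 2 * ((L - x.val - 1) / 2)) hm (by omega)).rounds
      (by omega) L
    have h1 := hpr.2 x.val hx.le
    change _ ∨ L ≤ tailCount x.val b x.val + x.val ∨ _ at h1
    have h2 : L - x.val ≤ tailCount x.val b x.val := by
      change L - x.val ≤ tailCount x.val b x.val ∨ _ ∨
        2 * ((L - x.val - 1) / 2) + (0 + L) < 2 * tailCount x.val b x.val + x.val at h1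
      omega
    by_contra hlt
    have hsub : (Finset.univ.filter fun y : Fin L => x.val ≤ y.val ∧ x.val ≤ (b y).val) ⊆
        Finset.Ioi x := by
      intro y hy
      simp only [Finset.mem_filter, Finset.mem_univ, true_and] at hy
      rw [Finset.mem_Ioi]
      refine lt_of_le_of_ne hy.1 ?_
      rintro rfl
      exact hlt hy.2
    have := Finset.card_le_card hsub
    rw [Fin.card_Ioi] at this
    unfold tailCount at h2
    omega
  -- A permutation preserves the sum of all positions, so no inequality x ≤ b x can be strict.
  have hsum : ∑ x : Fin L, x.val = ∑ x, (b x).val :=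
    (Equiv.sum_comp (Equiv.ofBijective b (Finite.injective_iff_bijective.1 hbi))
      (fun x => x.val)).symm
  have := (Finset.sum_eq_sum_iff_of_le (f := fun x : Fin L => x.val)
    (g := fun x => (b x).val) (fun x _ => hle x)).1 hsum
  funext x
  exact (Fin.ext (this x (Finset.mem_univ x))).symm

theorem swapProd_oet {a : Fin L → Fin L} (ha : a.Injective) (i : Fin L) :
    swapProd (oet a) i = a i := by
  have h := congrFun (applySwaps_eq_comp (oet a) a) (swapProd (oet a) i)
  rw [applySwaps_oet ha] at h
  simpa using h

theorem mem_oetRounds {n k : ℕ} {a : Fin L → Fin L} {p : Fin L × Fin L}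
    (hp : p ∈ oetRounds n k a) : p.2.val = p.1.val + 1 := by
  induction n generalizing k a with
  | zero => simp [oetRounds] at hp
  | succ n ih =>
    rw [oetRounds, List.mem_append] at hp
    rcases hp with hp | hp
    · exact (mem_oetRound.1 hp).1
    · exact ih hp

/-! ### Sorting all lines of the grid in parallel -/

/-- Odd-even transposition sort by FSWAPs on each of the lines `e j`. -/
def lineStage (e : Fin L → Fin L → Site L) (a : Fin L → Fin L → Fin L) : Circuit L :=
  (List.finRange L).flatMap fun j => (oet (a j)).flatMap fun p => fswap (e j p.1) (e j p.2)

theorem rowStage_eq (ρ : Equiv.Perm (Site L)) :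
    rowStage ρ = lineStage (fun r c => (r, c)) fun r c => (ρ (r, c)).2 := rfl

theorem colStage_eq (κ : Equiv.Perm (Site L)) :
    colStage κ = lineStage (fun c r => (r, c)) fun c r => (κ (r, c)).1 := rfl

theorem swapProd_append {Q : Type} [DecidableEq Q] (V W : List (Q × Q)) :
    swapProd (V ++ W) = swapProd W * swapProd V := by
  induction V with
  | nil => simp [swapProd]
  | cons p V ih => simp [swapProd, ih, mul_assoc]

theorem swapProd_map {Q R : Type} [DecidableEq Q] [DecidableEq R] {f : Q → R} (hf : f.Injective)
    (W : List (Q × Q)) (i : Q) :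
    swapProd (W.map fun p => (f p.1, f p.2)) (f i) = f (swapProd W i) := by
  induction W generalizing i with
  | nil => simp [swapProd]
  | cons p W ih =>
    simp only [List.map_cons, swapProd, Equiv.Perm.mul_apply]
    rw [← ih, hf.swap_apply]

theorem swapProd_of_untouched {Q : Type} [DecidableEq Q] {W : List (Q × Q)} {x : Q}
    (h : ∀ p ∈ W, x ≠ p.1 ∧ x ≠ p.2) : swapProd W x = x := by
  induction W with
  | nil => simp [swapProd]
  | cons p W ih =>
    have hp := h p (by simp)
    simp only [swapProd, Equiv.Perm.mul_apply]
    rw [Equiv.swap_apply_of_ne_of_ne hp.1 hp.2, ih fun q hq => h q (by simp [hq])]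

/-- Swaps in different lines touch different sites, so the joint swap product sorts each line
separately. All swaps join neighbours of one fixed order w, which is what `implements_fswaps` needs;
w is `snake` for rows and `colOrder` for columns. -/
theorem implements_lineStage {e : Fin L → Fin L → Site L}
    (he : ∀ j i j' i', e j i = e j' i' → j = j' ∧ i = i') (hs : ∀ x, ∃ j i, e j i = x)
    {a : Fin L → Fin L → Fin L} {σ : Equiv.Perm (Site L)} (hσ : ∀ j i, σ (e j i) = e j (a j i))
    {w : Site L → ℕ} (hw : w.Injective)
    (hadj : ∀ j (i i' : Fin L), i'.val = i.val + 1 →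
      w (e j i') = w (e j i) + 1 ∨ w (e j i) = w (e j i') + 1) :
    Implements (lineStage e a) (fun s => s ∘ σ.symm) (disorder w (w ∘ σ)) := by
  have ha : ∀ j, (a j).Injective := by
    intro j i i' h
    have : σ (e j i) = σ (e j i') := by rw [hσ, hσ, h]
    exact (he _ _ _ _ (σ.injective this)).2
  set W : List (Site L × Site L) := (List.finRange L).flatMap fun j =>
    (oet (a j)).map fun p => (e j p.1, e j p.2) with hW
  have e1 : lineStage e a = W.flatMap fun p => fswap p.1 p.2 := by
    simp [lineStage, hW, List.flatMap_assoc, List.flatMap_map]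
  have e2 : swapProd W = σ := by
    have key : ∀ (J : List (Fin L)), J.Nodup → ∀ j i,
        swapProd (J.flatMap fun j => (oet (a j)).map fun p => (e j p.1, e j p.2)) (e j i) =
          if j ∈ J then e j (a j i) else e j i := by
      intro J
      induction J with
      | nil => intro _ j i; simp [swapProd]
      | cons j' J ih =>
        intro hJ j i
        rw [List.nodup_cons] at hJ
        rw [List.flatMap_cons, swapProd_append, Equiv.Perm.mul_apply]
        by_cases hj : j = j'
        · subst hj
          rw [swapProd_map (f := e j) (fun i i' h => (he _ _ _ _ h).2), swapProd_oet (ha j),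
            ih hJ.2, if_neg hJ.1, if_pos (by simp)]
        · rw [swapProd_of_untouched (W := (oet (a j')).map fun p => (e j' p.1, e j' p.2)),
            ih hJ.2]
          · simp [hj]
          · intro p hp
            simp only [List.mem_map] at hp
            obtain ⟨q, _, rfl⟩ := hp
            exact ⟨fun h => hj (he _ _ _ _ h).1, fun h => hj (he _ _ _ _ h).1⟩
    ext1 x
    obtain ⟨j, i, rfl⟩ := hs x
    rw [hW, key _ (List.nodup_finRange L), if_pos (List.mem_finRange j), hσ]
  rw [e1, ← e2]
  refine implements_fswaps hw W ?_
  intro p hp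
  simp only [hW, List.mem_flatMap, List.mem_map] at hp
  obtain ⟨j, _, q, hq, rfl⟩ := hp
  exact hadj j q.1 q.2 (mem_oetRounds hq)

theorem implements_rowStage {ρ : Equiv.Perm (Site L)} (hρ : ∀ x, (ρ x).1 = x.1) :
    Implements (rowStage ρ) (fun s => s ∘ ρ.symm) (disorder snake (snake ∘ ρ)) := by
  rw [rowStage_eq]
  refine implements_lineStage ?_ ?_ ?_ snake_injective ?_
  · intro j i j' i' h
    exact ⟨congrArg Prod.fst h, congrArg Prod.snd h⟩
  · rintro ⟨r, c⟩
    exact ⟨r, c, rfl⟩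
  · intro r c
    exact Prod.ext (hρ _) rfl
  · intro r c c' h
    have := c'.isLt
    simp only [snake, jw_val]
    split_ifs <;> omega

theorem implements_colStage {κ : Equiv.Perm (Site L)} (hκ : ∀ x, (κ x).2 = x.2) :
    Implements (colStage κ) (fun s => s ∘ κ.symm) (disorder colOrder (colOrder ∘ κ)) := by
  rw [colStage_eq]
  refine implements_lineStage ?_ ?_ ?_ colOrder_injective ?_
  · intro j i j' i' h
    exact ⟨congrArg Prod.snd h, congrArg Prod.fst h⟩
  · rintro ⟨r, c⟩
    exact ⟨c, r, rfl⟩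
  · intro r c
    exact Prod.ext rfl (hκ _)
  · intro r c c' h
    simp only [colOrder]
    omega

/-! ### Row-column-row plans -/

/-- A regular bipartite multigraph of positive degree, with edges `E` and endpoints given by `u`
and `v`, has a perfect matching. -/
theorem exists_perfect_matching {α ι : Type*} [DecidableEq ι] {E : Finset α}
    {u v : α → ι} {d : ℕ} (hd : 0 < d)
    (hu : ∀ i, (E.filter fun x => u x = i).card = d)
    (hv : ∀ i, (E.filter fun x => v x = i).card = d) :
    ∃ m : ι → α, (∀ i, m i ∈ E) ∧ (∀ i, u (m i) = i) ∧ (fun i => v (m i)).Injective := by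
  have hall := (Finset.all_card_le_biUnion_card_iff_exists_injective
    (fun i => (E.filter fun x => u x = i).image v)).1 ?_
  · obtain ⟨f, hf, hmem⟩ := hall
    simp only [Finset.mem_image, Finset.mem_filter] at hmem
    choose m hm using hmem
    refine ⟨m, fun i => (hm i).1.1, fun i => (hm i).1.2, ?_⟩
    have : (fun i => v (m i)) = f := funext fun i => (hm i).2
    rwa [this]
  -- Hall's condition by double counting: the |A| d edges that leave A all end in N, which receives
  -- only |N| d edges.
  · intro A
    set N := A.biUnion fun i => (E.filter fun x => u x = i).image v with hN
    have h1 : (E.filter fun x => u x ∈ A).card = A.card * d := by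
      rw [Finset.card_eq_sum_card_fiberwise (f := u) (t := A)]
      · rw [Finset.sum_const_nat]
        intro i hi
        rw [← hu i, Finset.filter_filter]
        congr 1
        ext x
        simp only [Finset.mem_filter]
        constructor
        · rintro ⟨h1, _, h2⟩; exact ⟨h1, h2⟩
        · rintro ⟨h1, h2⟩; exact ⟨h1, h2 ▸ hi, h2⟩
      · intro x hx
        have := Finset.mem_coe.1 hx
        exact (Finset.mem_filter.1 this).2
    have h2 : (E.filter fun x => v x ∈ N).card = N.card * d := by
      rw [Finset.card_eq_sum_card_fiberwise (f := v) (t := N)]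
      · rw [Finset.sum_const_nat]
        intro i hi
        rw [← hv i, Finset.filter_filter]
        congr 1
        ext x
        simp only [Finset.mem_filter]
        constructor
        · rintro ⟨h1, _, h2⟩; exact ⟨h1, h2⟩
        · rintro ⟨h1, h2⟩; exact ⟨h1, h2 ▸ hi, h2⟩
      · intro x hx
        have := Finset.mem_coe.1 hx
        exact (Finset.mem_filter.1 this).2
    have h3 : (E.filter fun x => u x ∈ A) ⊆ E.filter fun x => v x ∈ N := by
      intro x hx
      rw [Finset.mem_filter] at hx ⊢
      refine ⟨hx.1, ?_⟩
      rw [hN, Finset.mem_biUnion]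
      exact ⟨u x, hx.2, Finset.mem_image_of_mem v (Finset.mem_filter.2 ⟨hx.1, rfl⟩)⟩
    have := Finset.card_le_card h3
    rw [h1, h2] at this
    exact Nat.le_of_mul_le_mul_right this hd

/-- A `d`-regular bipartite multigraph has a proper edge colouring with `d` colours. -/
theorem exists_edge_coloring {α ι : Type*} [DecidableEq α] [Fintype ι] [DecidableEq ι] {u v : α → ι}
    (d : ℕ) : ∀ {E : Finset α}, (∀ i, (E.filter fun x => u x = i).card = d) →
      (∀ i, (E.filter fun x => v x = i).card = d) →
      ∃ c : α → ℕ, (∀ x ∈ E, c x < d) ∧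
        (∀ x ∈ E, ∀ y ∈ E, u x = u y → c x = c y → x = y) ∧
        (∀ x ∈ E, ∀ y ∈ E, v x = v y → c x = c y → x = y) := by
  induction d with
  | zero =>
    intro E hu _
    have : ∀ x, x ∉ E := by
      intro x hx
      have := Finset.card_eq_zero.1 (hu (u x))
      rw [Finset.filter_eq_empty_iff] at this
      exact this hx rfl
    exact ⟨fun _ => 0, fun x hx => absurd hx (this x), fun x hx => absurd hx (this x),
      fun x hx => absurd hx (this x)⟩
  | succ d ih =>
    intro E hu hv
    obtain ⟨m, hmE, hmu, hmv⟩ := exists_perfect_matching (Nat.succ_pos d) hu hv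
    set M := Finset.univ.image m with hM
    have hmem : ∀ x, x ∈ M ↔ ∃ i, m i = x := by simp [hM]
    have hvs : ∀ i, ∃ j, v (m j) = i := Finite.injective_iff_surjective.1 hmv
    have hu' : ∀ i, ((E \ M).filter fun x => u x = i).card = d := by
      intro i
      have : (E \ M).filter (fun x => u x = i) = (E.filter fun x => u x = i).erase (m i) := by
        ext x
        simp only [Finset.mem_filter, Finset.mem_sdiff, Finset.mem_erase, hmem]
        constructor
        · rintro ⟨⟨h1, h2⟩, h3⟩
          exact ⟨fun e => h2 ⟨i, e.symm⟩, h1, h3⟩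
        · rintro ⟨h1, h2, h3⟩
          refine ⟨⟨h2, ?_⟩, h3⟩
          rintro ⟨j, rfl⟩
          rw [hmu] at h3
          exact h1 (h3 ▸ rfl)
      rw [this, Finset.card_erase_of_mem, hu]
      · rfl
      · exact Finset.mem_filter.2 ⟨hmE i, hmu i⟩
    have hv' : ∀ i, ((E \ M).filter fun x => v x = i).card = d := by
      intro i
      obtain ⟨k, hk⟩ := hvs i
      have : (E \ M).filter (fun x => v x = i) = (E.filter fun x => v x = i).erase (m k) := by
        ext x
        simp only [Finset.mem_filter, Finset.mem_sdiff, Finset.mem_erase, hmem]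
        constructor
        · rintro ⟨⟨h1, h2⟩, h3⟩
          exact ⟨fun e => h2 ⟨k, e.symm⟩, h1, h3⟩
        · rintro ⟨h1, h2, h3⟩
          refine ⟨⟨h2, ?_⟩, h3⟩
          rintro ⟨j, rfl⟩
          have : j = k := hmv (h3.trans hk.symm)
          exact h1 (this ▸ rfl)
      rw [this, Finset.card_erase_of_mem, hv]
      · rfl
      · exact Finset.mem_filter.2 ⟨hmE k, hk⟩
    obtain ⟨c, hc, hcu, hcv⟩ := ih hu' hv'
    -- The matching M gets the new colour d, all other edges keep colours below d. The argument is
    -- the same at both endpoints.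
    have aux : ∀ w : α → ι, (∀ i j, w (m i) = w (m j) → m i = m j) →
        (∀ x ∈ E \ M, ∀ y ∈ E \ M, w x = w y → c x = c y → x = y) →
        ∀ x ∈ E, ∀ y ∈ E, w x = w y →
          (if x ∈ M then d else c x) = (if y ∈ M then d else c y) → x = y := by
      intro w hw hcw x hx y hy hxy h
      split_ifs at h with h1 h2 h2
      · obtain ⟨i, rfl⟩ := (hmem x).1 h1
        obtain ⟨j, rfl⟩ := (hmem y).1 h2
        exact hw i j hxy
      · have := hc y (Finset.mem_sdiff.2 ⟨hy, h2⟩)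
        omega
      · have := hc x (Finset.mem_sdiff.2 ⟨hx, h1⟩)
        omega
      · exact hcw x (Finset.mem_sdiff.2 ⟨hx, h1⟩) y (Finset.mem_sdiff.2 ⟨hy, h2⟩) hxy h
    refine ⟨fun x => if x ∈ M then d else c x, ?_, ?_, ?_⟩
    · intro x hx
      simp only
      split_ifs with h
      · omega
      · have := hc x (Finset.mem_sdiff.2 ⟨hx, h⟩)
        omega
    · refine aux u (fun i j h => ?_) hcu
      rw [hmu, hmu] at h
      rw [h]
    · exact aux v (fun i j h => by rw [hmv h]) hcv

/-- Each item is an edge from its present row to its destination row. This multigraph is L-regular,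
and the colour of an item in an L-edge-colouring is the column in which it changes rows: properness
at the two ends says that no two items collide before or after the column stage. -/
theorem exists_rowColRowPlan {L : ℕ} (π : Equiv.Perm (Fin (L * L))) :
    ∃ ρA κ ρB : Equiv.Perm (Site L), IsRowColRowPlan π ρA κ ρB := by
  set σ : Equiv.Perm (Site L) := ((jw L).trans π).trans (jw L).symm with hσ
  have hrow : ∀ i : Fin L, (Finset.univ.filter fun x : Site L => x.1 = i).card = L := by
    intro i
    have : (Finset.univ.filter fun x : Site L => x.1 = i) =
        Finset.univ.image fun c : Fin L => (i, c) := by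
      ext ⟨r, c⟩
      simp [eq_comm]
    rw [this, Finset.card_image_of_injective _ (fun c c' h => congrArg Prod.snd h)]
    simp
  have hdst : ∀ i : Fin L, (Finset.univ.filter fun x : Site L => (σ x).1 = i).card = L := by
    intro i
    refine Eq.trans ?_ (hrow i)
    refine Finset.card_bij (fun x _ => σ x) ?_ ?_ ?_
    · intro x hx
      simpa using hx
    · intro x _ y _ h
      exact σ.injective h
    · intro y hy
      exact ⟨σ.symm y, by simpa using hy, by simp⟩
  obtain ⟨c, hc, hcu, hcv⟩ := exists_edge_coloring (u := fun x : Site L => x.1)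
    (v := fun x : Site L => (σ x).1) L hrow hdst
  have bij : ∀ f : Site L → Site L, f.Injective → f.Bijective :=
    fun f hf => Finite.injective_iff_bijective.1 hf
  let col : Site L → Fin L := fun x => ⟨c x, hc x (Finset.mem_univ x)⟩
  have hA : (fun x : Site L => (x.1, col x)).Injective := by
    intro x y h
    simp only [Prod.mk.injEq, col, Fin.mk.injEq] at h
    exact hcu x (Finset.mem_univ x) y (Finset.mem_univ y) h.1 h.2
  have hM : (fun x : Site L => ((σ x).1, col x)).Injective := by
    intro x y h
    simp only [Prod.mk.injEq, col, Fin.mk.injEq] at h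
    exact hcv x (Finset.mem_univ x) y (Finset.mem_univ y) h.1 h.2
  set ρA := Equiv.ofBijective _ (bij _ hA) with hρA
  -- The place of each item after the column stage: already in its destination row, still in the
  -- column of its colour.
  set μ := Equiv.ofBijective _ (bij _ hM) with hμ
  have eA : ∀ x, ρA x = (x.1, col x) := fun x => rfl
  have eM : ∀ x, μ x = ((σ x).1, col x) := fun x => rfl
  refine ⟨ρA, ρA.symm.trans μ, μ.symm.trans σ, ?_, ?_, ?_, ?_⟩
  · intro x
    rw [eA]
  · intro x
    obtain ⟨y, rfl⟩ := ρA.surjective x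
    rw [Equiv.trans_apply, Equiv.symm_apply_apply, eA, eM]
  · intro x
    obtain ⟨y, rfl⟩ := μ.surjective x
    rw [Equiv.trans_apply, Equiv.symm_apply_apply, eM]
  · intro x
    simp [hσ]

/-! ### Gates at integer coordinates -/

theorem site?_eq_some {r c : ℤ} {x : Site L} :
    site? L r c = some x ↔ (x.1.val : ℤ) = r ∧ (x.2.val : ℤ) = c := by
  obtain ⟨⟨i, hi⟩, ⟨j, hj⟩⟩ := x
  unfold site?
  split_ifs with h
  · simp only [Option.some.injEq, Prod.mk.injEq, Fin.mk.injEq]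
    omega
  · simp only [false_iff]
    omega

theorem site?_cases (L : ℕ) (r c : ℤ) :
    (∃ x : Site L, site? L r c = some x ∧ (x.1.val : ℤ) = r ∧ (x.2.val : ℤ) = c) ∨
      (site? L r c = none ∧ ¬ ((0 ≤ r ∧ r < L) ∧ (0 ≤ c ∧ c < L))) := by
  rcases h : site? L r c with _ | x
  · right
    refine ⟨rfl, fun h' => ?_⟩
    simp [site?, h'] at h
  · exact Or.inl ⟨x, rfl, site?_eq_some.1 h⟩

/-- The content of the qubit with the given integer coordinates, zero off the grid. -/
def ev (s : Basis (Site L)) (r c : ℤ) : ZMod 2 := (site? L r c).elim 0 s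

theorem ev_site (s : Basis (Site L)) (x : Site L) : ev s x.1.val x.2.val = s x := by
  have : site? L x.1.val x.2.val = some x := site?_eq_some.2 ⟨rfl, rfl⟩
  simp [ev, this]

theorem ev_of_off (s : Basis (Site L)) {r c : ℤ}
    (h : ¬ ((0 ≤ r ∧ r < L) ∧ (0 ≤ c ∧ c < L))) : ev s r c = 0 := by
  simp [ev, site?, h]

theorem ev_mk (g : Site L → ZMod 2) (h : ℤ → ℤ → ZMod 2)
    (hg : ∀ x : Site L, g x = h x.1.val x.2.val)
    (h0 : ∀ r c : ℤ, ¬ ((0 ≤ r ∧ r < L) ∧ (0 ≤ c ∧ c < L)) → h r c = 0) (r c : ℤ) :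
    ev g r c = h r c := by
  rcases site?_cases L r c with ⟨x, _, rfl, rfl⟩ | ⟨_, h2⟩
  · rw [ev_site, hg]
  · rw [ev_of_off _ h2, h0 _ _ h2]

/-- The action of `cnotAt L a b c d` on basis states. -/
def cnotMap (a b c d : ℤ) (s : Basis (Site L)) : Basis (Site L) :=
  fun x => s x + if (x.1.val : ℤ) = c ∧ (x.2.val : ℤ) = d then ev s a b else 0

theorem ev_cnotMap_of_ne {a b c d i j : ℤ} (h : ¬ (i = c ∧ j = d)) (s : Basis (Site L)) :
    ev (cnotMap a b c d s) i j = ev s i j := by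
  -- Only the value at (i, j) carries content; elsewhere the comparison function repeats the left
  -- side.
  refine ev_mk _ (fun i' j' => if i' = i ∧ j' = j then ev s i j else ev (cnotMap a b c d s) i' j')
    (fun x => ?_) (fun r c hrc => ?_) i j |>.trans (by simp)
  · split_ifs with h'
    · obtain ⟨rfl, rfl⟩ := h'
      rw [ev_site, cnotMap, if_neg h, add_zero]
    · rw [ev_site]
  · split_ifs with h'
    · obtain ⟨rfl, rfl⟩ := h'
      exact ev_of_off _ hrc
    · exact ev_of_off _ hrc

/-- An omitted gate obeys the same formula because `ev` vanishes off the grid. -/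
theorem implements_czAt (a b c d : ℤ) :
    Implements (czAt L a b c d) id (fun s => ev s a b * ev s c d) := by
  unfold czAt ev
  rcases site?_cases L a b with ⟨p, hp, _⟩ | ⟨hp, _⟩
  · rcases site?_cases L c d with ⟨q, hq, _⟩ | ⟨hq, _⟩
    · simp only [hp, hq]
      exact implements_cz p q
    · simp only [hp, hq]
      exact implements_nil.congr (fun _ => rfl) (by simp)
  · simp only [hp]
    exact implements_nil.congr (fun _ => rfl) (by simp)

theorem implements_zAt (a b : ℤ) : Implements (zAt L a b) id (fun s => ev s a b) := by
  unfold zAt ev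
  rcases site?_cases L a b with ⟨p, hp, _⟩ | ⟨hp, _⟩
  · simp only [hp]
    exact implements_z p
  · simp only [hp]
    exact implements_nil.congr (fun _ => rfl) (by simp)

/-- The formula also covers omitted gates: an off-grid control reads 0, and an off-grid target is no
site. -/
theorem implements_cnotAt (a b c d : ℤ) :
    Implements (cnotAt L a b c d) (cnotMap a b c d) (fun _ => 0) := by
  unfold cnotAt
  rcases site?_cases L a b with ⟨p, hp, hpa, hpb⟩ | ⟨hp, hp'⟩
  · rcases site?_cases L c d with ⟨q, hq, hqc, hqd⟩ | ⟨hq, hq'⟩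
    · simp only [hp, hq]
      refine (implements_cnot p q).congr (fun s => ?_) (fun _ => rfl)
      subst hpa hpb hqc hqd
      ext x
      by_cases hx : x = q
      · subst hx
        simp [cnotMap, ev_site]
      · rw [Function.update_of_ne hx, cnotMap, if_neg, add_zero]
        rintro ⟨h1, h2⟩
        exact hx (Prod.ext (Fin.ext (by exact_mod_cast h1)) (Fin.ext (by exact_mod_cast h2)))
    · simp only [hp, hq]
      refine implements_nil.congr (fun s => ?_) (fun _ => rfl)
      ext x
      have h1 := x.1.isLt
      have h2 := x.2.isLt
      rw [cnotMap, if_neg (by omega), add_zero, id]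
  · simp only [hp]
    refine implements_nil.congr (fun s => ?_) (fun _ => rfl)
    ext x
    rw [cnotMap, ev_of_off _ hp']
    simp

/-! ### Commuting circuits -/

/-- Circuits whose operators commute. -/
def Commutes (C D : Circuit L) : Prop := Commute (circuitOp C) (circuitOp D)

theorem Commutes.symm {C D : Circuit L} (h : Commutes C D) : Commutes D C := Commute.symm h

theorem commutes_nil_left (C : Circuit L) : Commutes [] C := by
  simp [Commutes, circuitOp]

theorem Commutes.append_left {C C' D : Circuit L} (h : Commutes C D) (h' : Commutes C' D) :
    Commutes (C ++ C') D := by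
  unfold Commutes at *
  rw [circuitOp_append]
  exact h'.mul_left h

theorem Commutes.append_right {C D D' : Circuit L} (h : Commutes C D) (h' : Commutes C D') :
    Commutes C (D ++ D') :=
  (h.symm.append_left h'.symm).symm

theorem Implements.commutes {C D : Circuit L} {f f' q q'} (h : Implements C f q)
    (h' : Implements D f' q') (hf : ∀ s, f (f' s) = f' (f s))
    (hq : ∀ s, q s + q' (f s) = q' s + q (f' s)) : Commutes C D := by
  unfold Commutes Commute SemiconjBy
  unfold Implements at h h'
  rw [h, h', mono_mul, mono_mul]
  congr 1
  · exact funext hf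
  · exact funext fun s => (hq s).symm

theorem commutes_of_diagonal {C D : Circuit L} {q q'} (h : Implements C id q)
    (h' : Implements D id q') : Commutes C D :=
  h.commutes h' (fun _ => rfl) (fun _ => add_comm _ _)

theorem commutes_diagonal_cnotAt {C : Circuit L} {q : Basis (Site L) → ZMod 2} {a b c d : ℤ}
    (h : Implements C id q) (hq : ∀ s, q (cnotMap a b c d s) = q s) :
    Commutes C (cnotAt L a b c d) :=
  h.commutes (implements_cnotAt a b c d) (fun _ => rfl) (fun s => by simp [hq])

theorem commutes_czAt_cnotAt {a b c d a' b' c' d' : ℤ} (h1 : ¬ (a = c' ∧ b = d'))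
    (h2 : ¬ (c = c' ∧ d = d')) : Commutes (czAt L a b c d) (cnotAt L a' b' c' d') :=
  commutes_diagonal_cnotAt (implements_czAt a b c d) fun s => by
    rw [ev_cnotMap_of_ne h1, ev_cnotMap_of_ne h2]

theorem commutes_zAt_cnotAt {a b a' b' c' d' : ℤ} (h1 : ¬ (a = c' ∧ b = d')) :
    Commutes (zAt L a b) (cnotAt L a' b' c' d') :=
  commutes_diagonal_cnotAt (implements_zAt a b) fun s => by
    rw [ev_cnotMap_of_ne h1]

/-- CNOTs interfere only when the target of one is the control of the other; common controls or
common targets are harmless. -/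
theorem commutes_cnotAt_cnotAt {a b c d a' b' c' d' : ℤ} (h1 : ¬ (a = c' ∧ b = d'))
    (h2 : ¬ (a' = c ∧ b' = d)) : Commutes (cnotAt L a b c d) (cnotAt L a' b' c' d') := by
  refine (implements_cnotAt a b c d).commutes (implements_cnotAt a' b' c' d') (fun s => ?_)
    (fun s => by simp)
  ext x
  have e1 : ev (cnotMap a' b' c' d' s) a b = ev s a b := ev_cnotMap_of_ne h1 s
  have e2 : ev (cnotMap a b c d s) a' b' = ev s a' b' := ev_cnotMap_of_ne h2 s
  change cnotMap a' b' c' d' s x + _ = cnotMap a b c d s x + _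
  rw [e1, e2]
  simp only [cnotMap]
  ring

theorem flatMap_range_succ {α : Type*} (n : ℕ) (F : ℕ → List α) :
    (List.range (n + 1)).flatMap F = (List.range n).flatMap F ++ F n := by
  simp [List.range_succ]

theorem commutes_flatMap_left {n : ℕ} {G : ℕ → Circuit L} {D : Circuit L}
    (h : ∀ i < n, Commutes (G i) D) : Commutes ((List.range n).flatMap G) D := by
  induction n with
  | zero => exact commutes_nil_left D
  | succ n ih =>
    rw [flatMap_range_succ]
    exact (ih fun i hi => h i (by omega)).append_left (h n (by omega))

/-- Two interleaved sequences of circuits may be executed one after the other if each term of the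
second commutes with the later terms of the first. -/
theorem circuitOp_interleave {n : ℕ} {F G : ℕ → Circuit L}
    (h : ∀ i j, i < j → j < n → Commutes (G i) (F j)) :
    circuitOp ((List.range n).flatMap fun k => F k ++ G k) =
      circuitOp ((List.range n).flatMap F ++ (List.range n).flatMap G) := by
  induction n with
  | zero => rfl
  | succ n ih =>
    -- The last term of F is moved in front of all the earlier terms of G.
    have hc : Commutes ((List.range n).flatMap G) (F n) :=
      commutes_flatMap_left fun i hi => h i n hi (by omega)
    have ih' := ih fun i j hij hj => h i j hij (by omega)
    simp only [flatMap_range_succ, circuitOp_append] at ih' ⊢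
    rw [ih']
    unfold Commutes Commute SemiconjBy at hc
    simp only [Matrix.mul_assoc]
    rw [← Matrix.mul_assoc (circuitOp (F n)), ← hc]
    simp only [Matrix.mul_assoc]

theorem Implements.of_circuitOp_eq {C D : Circuit L} {f q} (h : circuitOp C = circuitOp D)
    (hD : Implements D f q) : Implements C f q := by
  unfold Implements at *
  rw [h, hD]

theorem implements_flatMap_diagonal {D : ℕ → Circuit L} {q : ℕ → Basis (Site L) → ZMod 2}
    (h : ∀ k, Implements (D k) id (q k)) (n : ℕ) :
    Implements ((List.range n).flatMap D) id (fun s => ∑ k ∈ Finset.range n, q k s) := by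
  induction n with
  | zero => exact implements_nil.congr (fun _ => rfl) (by simp)
  | succ n ih =>
    rw [flatMap_range_succ]
    exact (ih.append (h n)).congr (fun _ => rfl) (fun s => by rw [Finset.sum_range_succ]; rfl)

theorem implements_flatMap_filter_diagonal {p : ℕ → Bool} {D : ℕ → Circuit L}
    {q : ℕ → Basis (Site L) → ZMod 2} (n : ℕ)
    (h : ∀ k, k < n → p k = true → Implements (D k) id (q k)) :
    Implements (((List.range n).filter p).flatMap D) id
      (fun s => ∑ k ∈ Finset.range n, if p k then q k s else 0) := by
  induction n with
  | zero => exact implements_nil.congr (fun _ => rfl) (by simp)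
  | succ n ih =>
    rw [List.range_succ, List.filter_append, List.flatMap_append]
    have ih' := ih fun k hk => h k (by omega)
    by_cases hp : p n = true
    · have := ih'.append (h n (by omega) hp)
      simp only [List.filter_cons, hp, if_true, List.filter_nil, List.flatMap_cons,
        List.flatMap_nil, List.append_nil]
      refine this.congr (fun _ => rfl) (fun s => ?_)
      rw [Finset.sum_range_succ, if_pos hp]
      rfl
    · simp only [List.filter_cons, hp, List.filter_nil]
      refine (ih'.append implements_nil).congr (fun _ => rfl) (fun s => ?_)
      rw [Finset.sum_range_succ, if_neg hp]

/-! ### Sums along a line -/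

/-- A leg fires a gadget at the columns γ 0, γ 1, …, some of them off the grid. Those contribute
nothing, and each column of the grid is met exactly once. -/
theorem sum_range_comp {n : ℕ} {γ : ℕ → ℤ} {h : ℤ → ZMod 2} (hγ : γ.Injective)
    (hc : ∀ c : ℕ, c < L → ∃ k < n, γ k = c) (h0 : ∀ c : ℤ, ¬ (0 ≤ c ∧ c < L) → h c = 0) :
    ∑ k ∈ Finset.range n, h (γ k) = ∑ c ∈ Finset.range L, h c := by
  rw [← Finset.sum_image (s := Finset.range n) (g := γ) (f := h) (fun x _ y _ e => hγ e),
    ← Finset.sum_image (s := Finset.range L) (g := fun c : ℕ => (c : ℤ)) (f := h)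
      (fun x _ y _ e => Nat.cast_injective (R := ℤ) e)]
  symm
  apply Finset.sum_subset
  · intro c hc'
    simp only [Finset.mem_image, Finset.mem_range] at hc' ⊢
    obtain ⟨k, hk, rfl⟩ := hc'
    exact hc k hk
  · intro c _ hc'
    apply h0
    rintro ⟨h1, h2⟩
    apply hc'
    simp only [Finset.mem_image, Finset.mem_range]
    exact ⟨c.toNat, by omega, by omega⟩

/-- The sum of `f` over the columns to the left of `c`. -/
def prefixSum (f : ℤ → ZMod 2) (c : ℤ) : ZMod 2 := ∑ j ∈ Finset.range c.toNat, f j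

theorem prefixSum_succ (f : ℤ → ZMod 2) {c : ℤ} (hc : 0 ≤ c) :
    prefixSum f (c + 1) = prefixSum f c + f c := by
  unfold prefixSum
  rw [show (c + 1).toNat = c.toNat + 1 by omega, Finset.sum_range_succ]
  congr 2
  omega

theorem prefixSum_of_nonpos (f : ℤ → ZMod 2) {c : ℤ} (hc : c ≤ 0) : prefixSum f c = 0 := by
  unfold prefixSum
  rw [show c.toNat = 0 by omega, Finset.sum_range_zero]

/-- The value f c enters the prefix sums of the n - 1 - c later columns, so only the parity of this
number matters. This is the rule for the Z gates. -/
theorem sum_prefixSum (f : ℤ → ZMod 2) (n : ℕ) :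
    ∑ c ∈ Finset.range n, prefixSum f c =
      ∑ c ∈ Finset.range n, if ((n : ℤ) - 1 - c) % 2 = 1 then f c else 0 := by
  induction n with
  | zero => simp
  | succ n ih =>
    rw [Finset.sum_range_succ, ih, Finset.sum_range_succ, if_neg (by push_cast; omega), add_zero]
    have : prefixSum f n = ∑ c ∈ Finset.range n, f c := by simp [prefixSum]
    rw [this, ← Finset.sum_add_distrib]
    refine Finset.sum_congr rfl fun c _ => ?_
    have char2 : ∀ a : ZMod 2, a + a = 0 := by decide
    rcases Int.emod_two_eq ((n : ℤ) - 1 - c) with h | h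
    · rw [if_neg (by omega), if_pos (by push_cast; omega), zero_add]
    · rw [if_pos h, if_neg (by push_cast; omega), char2]

/-- The sum of `f a * g b` over the columns `a < b < n`. -/
def strictForm (n : ℕ) (f g : ℤ → ZMod 2) : ZMod 2 :=
  ∑ c ∈ Finset.range n, prefixSum f c * g c

theorem strictForm_add_left (n : ℕ) (f f' g : ℤ → ZMod 2) :
    strictForm n (f + f') g = strictForm n f g + strictForm n f' g := by
  simp [strictForm, prefixSum, Finset.sum_add_distrib, add_mul]

theorem strictForm_add_right (n : ℕ) (f g g' : ℤ → ZMod 2) :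
    strictForm n f (g + g') = strictForm n f g + strictForm n f g' := by
  simp [strictForm, Finset.sum_add_distrib, mul_add]

theorem strictForm_zero_left (n : ℕ) (g : ℤ → ZMod 2) : strictForm n 0 g = 0 := by
  simp [strictForm, prefixSum]

theorem strictForm_zero_right (n : ℕ) (f : ℤ → ZMod 2) : strictForm n f 0 = 0 := by
  simp [strictForm]

/-- With P the prefix sums, f c = P c + P (c + 1) and P² = P, so P c * f c = P c * P (c + 1) + P c.
The quadratic part is a CZ between neighbours of the cascaded row, the linear part is left to Z
gates. -/
theorem sum_mul_prefixSum_succ (f : ℤ → ZMod 2) (n : ℕ) :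
    (∑ c ∈ Finset.range n, prefixSum f c * prefixSum f (c + 1)) +
      (∑ c ∈ Finset.range n, if ((n : ℤ) - 1 - c) % 2 = 1 then f c else 0) =
      strictForm n f f := by
  rw [← sum_prefixSum, ← Finset.sum_add_distrib]
  refine Finset.sum_congr rfl fun c _ => ?_
  rw [prefixSum_succ f (by omega)]
  have : ∀ a b : ZMod 2, a * (a + b) + a = a * b := by decide
  exact this _ _

/-- A cascaded row holds inclusive prefix sums, so a CZ with g also picks up the diagonal terms f c
* g c. A second CZ after the cascade is undone removes them. -/
theorem sum_prefixSum_succ_mul (n : ℕ) (f g : ℤ → ZMod 2) :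
    (∑ c ∈ Finset.range n, prefixSum f (c + 1) * g c) + (∑ c ∈ Finset.range n, f c * g c) =
      strictForm n f g := by
  rw [← Finset.sum_add_distrib]
  refine Finset.sum_congr rfl fun c _ => ?_
  rw [prefixSum_succ f (by omega)]
  have : ∀ a b z : ZMod 2, (a + b) * z + b * z = a * z := by decide
  exact this _ _ _

/-! ### Gadgets along a whole row -/

theorem add_self_zmod (a : ZMod 2) : a + a = 0 := by
  revert a; decide

theorem implements_flatMap_czAt {n : ℕ} {γ : ℕ → ℤ} (r r' : ℤ) (hγ : γ.Injective)
    (hc : ∀ c : ℕ, c < L → ∃ k < n, γ k = c) :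
    Implements ((List.range n).flatMap fun k => czAt L r (γ k) r' (γ k)) id
      (fun s => ∑ c ∈ Finset.range L, ev s r c * ev s r' c) := by
  refine (implements_flatMap_diagonal (fun k => implements_czAt r (γ k) r' (γ k)) n).congr
    (fun _ => rfl) (fun s => ?_)
  exact sum_range_comp (h := fun c => ev s r c * ev s r' c) hγ hc fun c h => by
    rw [ev_of_off s (by tauto), zero_mul]

theorem implements_flatMap_gSame {n : ℕ} {γ : ℕ → ℤ} (r : ℤ) (hγ : γ.Injective)
    (hc : ∀ c : ℕ, c < L → ∃ k < n, γ k = c) :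
    Implements ((List.range n).flatMap fun k => gSame L r (γ k)) id
      (fun s => ∑ c ∈ Finset.range L, ev s r ((c : ℤ) - 1) * ev s r c) := by
  refine (implements_flatMap_diagonal (fun k => implements_czAt r (γ k - 1) r (γ k)) n).congr
    (fun _ => rfl) (fun s => ?_)
  exact sum_range_comp (h := fun c => ev s r (c - 1) * ev s r c) hγ hc fun c h => by
    rw [ev_of_off s (c := c) (by tauto), mul_zero]

theorem implements_gZ (r c : ℤ) : Implements (gZ L r c) id
    (fun s => if ((L : ℤ) - 1 - c) % 2 = 1 then ev s r c else 0) := by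
  unfold gZ
  split_ifs with h
  · exact implements_zAt r c
  · exact implements_nil

theorem implements_flatMap_gZ {n : ℕ} {γ : ℕ → ℤ} (r : ℤ) (hγ : γ.Injective)
    (hc : ∀ c : ℕ, c < L → ∃ k < n, γ k = c) :
    Implements ((List.range n).flatMap fun k => gZ L r (γ k)) id
      (fun s => ∑ c ∈ Finset.range L, if ((L : ℤ) - 1 - c) % 2 = 1 then ev s r c else 0) := by
  refine (implements_flatMap_diagonal (fun k => implements_gZ r (γ k)) n).congr
    (fun _ => rfl) (fun s => ?_)
  exact sum_range_comp (h := fun c => if ((L : ℤ) - 1 - c) % 2 = 1 then ev s r c else 0) hγ hc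
    fun c h => by rw [ev_of_off s (by tauto), ite_self]

/-- Add row `r` to row `r + 1`. -/
def rowAdd (r : ℤ) (s : Basis (Site L)) : Basis (Site L) :=
  fun x => s x + if (x.1.val : ℤ) = r + 1 then ev s r x.2.val else 0

theorem ev_rowAdd_of_ne {r i : ℤ} (h : i ≠ r + 1) (s : Basis (Site L)) (c : ℤ) :
    ev (rowAdd r s) i c = ev s i c := by
  refine ev_mk _ (fun i' j' => if i' = i then ev s i' j' else ev (rowAdd r s) i' j')
    (fun x => ?_) (fun r c hrc => ?_) i c |>.trans (by simp)
  · split_ifs with h'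
    · rw [ev_site, rowAdd, if_neg (by omega), add_zero]
    · rw [ev_site]
  · split_ifs <;> exact ev_of_off _ hrc

theorem ev_rowAdd_succ {r : ℤ} (hr : 0 ≤ r) (hr' : r + 1 < L) (s : Basis (Site L)) (c : ℤ) :
    ev (rowAdd r s) (r + 1) c = ev s (r + 1) c + ev s r c := by
  refine ev_mk _ (fun i' j' => if i' = r + 1 then ev s i' j' + ev s r j' else
    ev (rowAdd r s) i' j') (fun x => ?_) (fun i c hrc => ?_) (r + 1) c |>.trans (by simp)
  · split_ifs with h'
    · rw [ev_site, rowAdd, if_pos h']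
    · rw [ev_site]
  · split_ifs with h'
    · rw [ev_of_off _ hrc, ev_of_off, add_zero]
      omega
    · exact ev_of_off _ hrc

theorem rowAdd_rowAdd (r : ℤ) (s : Basis (Site L)) : rowAdd r (rowAdd r s) = s := by
  ext x
  rw [rowAdd, ev_rowAdd_of_ne (by omega), rowAdd, add_assoc, add_self_zmod, add_zero]

theorem implements_flatMap_cnotAt {γ : ℕ → ℤ} (r : ℤ) (hγ : γ.Injective) (n : ℕ) :
    Implements ((List.range n).flatMap fun k => cnotAt L r (γ k) (r + 1) (γ k))
      (fun s x => s x + if (x.1.val : ℤ) = r + 1 ∧ ∃ k < n, γ k = x.2.val then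
        ev s r x.2.val else 0) (fun _ => 0) := by
  induction n with
  | zero => exact implements_nil.congr (fun s => by ext x; simp) (fun _ => rfl)
  | succ n ih =>
    rw [flatMap_range_succ]
    refine (ih.append (implements_cnotAt r (γ n) (r + 1) (γ n))).congr (fun s => ?_) (by simp)
    ext x
    have key : ev (fun x : Site L => s x + if (x.1.val : ℤ) = r + 1 ∧ ∃ k < n, γ k = x.2.val then
        ev s r x.2.val else 0) r (γ n) = ev s r (γ n) := by
      obtain ⟨y, _, h1, h2⟩ | ⟨_, h⟩ := site?_cases L r (γ n)
      · rw [← h1, ← h2, ev_site, ev_site, if_neg (fun h => by omega), add_zero]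
      · rw [ev_of_off _ h, ev_of_off _ h]
    simp only [Function.comp, cnotMap]
    rw [key, add_assoc]
    congr 1
    by_cases hx : (x.1.val : ℤ) = r + 1
    · by_cases hn : (x.2.val : ℤ) = γ n
      · have h1 : ¬ ∃ k < n, γ k = x.2.val := by
          rintro ⟨k, hk, e⟩
          have := hγ (e.trans hn)
          omega
        have h2 : ∃ k < n + 1, γ k = x.2.val := ⟨n, by omega, hn.symm⟩
        rw [if_neg (fun h => h1 h.2), if_pos ⟨hx, hn⟩, if_pos ⟨hx, h2⟩, zero_add, hn]
      · have h3 : (∃ k < n + 1, γ k = x.2.val) ↔ ∃ k < n, γ k = x.2.val := by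
          constructor
          · rintro ⟨k, hk, e⟩
            refine ⟨k, ?_, e⟩
            rcases Nat.lt_succ_iff_lt_or_eq.1 hk with h | rfl
            · exact h
            · exact absurd e.symm hn
          · rintro ⟨k, hk, e⟩
            exact ⟨k, by omega, e⟩
        simp only [h3, hn, and_false, if_false, add_zero]
    · simp [hx]

theorem implements_rowAdd {n : ℕ} {γ : ℕ → ℤ} (r : ℤ) (hγ : γ.Injective)
    (hc : ∀ c : ℕ, c < L → ∃ k < n, γ k = c) :
    Implements ((List.range n).flatMap fun k => cnotAt L r (γ k) (r + 1) (γ k))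
      (rowAdd r) (fun _ => 0) := by
  refine (implements_flatMap_cnotAt r hγ n).congr (fun s => ?_) (fun _ => rfl)
  ext x
  have := hc x.2.val x.2.isLt
  simp [rowAdd, this]

/-- In every column the four gates of the gadget fire at four successive steps. Untangled, they are
full-row layers: CZ between rows r + 1 and r + 2, addition of row r to row r + 1, the same CZ, and
removal of row r. The phases y z + (y + x) z leave x z, a CZ across the skipped row. -/
theorem implements_flatMap_gSkip {n : ℕ} {b e : ℤ} (he : e = 1 ∨ e = -1) {r : ℤ} (hr : 0 ≤ r)
    (hr' : r + 2 < L)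
    (hc : ∀ d : ℤ, 0 ≤ d → d ≤ 3 → ∀ c : ℕ, c < L → ∃ k < n, b - e * (k : ℤ) + d * e = c) :
    Implements ((List.range n).flatMap fun k : ℕ => gSkip L r e (b - e * (k : ℤ))) id
      (fun s => ∑ c ∈ Finset.range L, ev s r c * ev s (r + 2) c) := by
  have hγ : ∀ d : ℤ, (fun k : ℕ => b - e * (k : ℤ) + d * e).Injective := by
    intro d i j h
    simp only at h
    rcases he with rfl | rfl <;> omega
  have s₁ := implements_flatMap_czAt (r + 1) (r + 2) (hγ 0) (hc 0 (by omega) (by omega))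
  have s₂ := implements_rowAdd r (hγ 1) (hc 1 (by omega) (by omega))
  have s₃ := implements_flatMap_czAt (r + 1) (r + 2) (hγ 2) (hc 2 (by omega) (by omega))
  have s₄ := implements_rowAdd r (hγ 3) (hc 3 (by omega) (by omega))
  have e₀ : (fun k : ℕ => gSkip L r e (b - e * (k : ℤ))) = fun k : ℕ =>
      czAt L (r + 1) (b - e * (k : ℤ) + 0 * e) (r + 2) (b - e * (k : ℤ) + 0 * e) ++
      (cnotAt L r (b - e * (k : ℤ) + 1 * e) (r + 1) (b - e * (k : ℤ) + 1 * e) ++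
      (czAt L (r + 1) (b - e * (k : ℤ) + 2 * e) (r + 2) (b - e * (k : ℤ) + 2 * e) ++
      cnotAt L r (b - e * (k : ℤ) + 3 * e) (r + 1) (b - e * (k : ℤ) + 3 * e))) := by
    funext k
    simp [gSkip]
  rw [e₀]
  -- The layers are separated one at a time. A later layer's gate of an earlier step and an earlier
  -- layer's gate of a later step lie in different columns, so no CZ meets the target of a CNOT.
  refine Implements.of_circuitOp_eq (circuitOp_interleave ?_) ?_
  · intro i j hij _
    refine Commutes.append_left ?_ (Commutes.append_left ?_ ?_)
    · refine (commutes_czAt_cnotAt ?_ ?_).symm <;> rcases he with rfl | rfl <;> omega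
    · exact commutes_of_diagonal (implements_czAt _ _ _ _) (implements_czAt _ _ _ _)
    · refine (commutes_czAt_cnotAt ?_ ?_).symm <;> rcases he with rfl | rfl <;> omega
  have t₃ := s₃.append s₄
  have t₂ : Implements _ _ _ := s₂.append (Implements.of_circuitOp_eq
    (circuitOp_interleave (n := n)
      (F := fun k => czAt L (r + 1) (b - e * (k : ℤ) + 2 * e) (r + 2) (b - e * (k : ℤ) + 2 * e))
      (G := fun k => cnotAt L r (b - e * (k : ℤ) + 3 * e) (r + 1) (b - e * (k : ℤ) + 3 * e))
      (by
        intro i j hij _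
        refine (commutes_czAt_cnotAt ?_ ?_).symm <;> rcases he with rfl | rfl <;> omega)) t₃)
  have t₁ := s₁.append (Implements.of_circuitOp_eq
    (circuitOp_interleave (n := n)
      (F := fun k => cnotAt L r (b - e * (k : ℤ) + 1 * e) (r + 1) (b - e * (k : ℤ) + 1 * e))
      (G := fun k =>
        czAt L (r + 1) (b - e * (k : ℤ) + 2 * e) (r + 2) (b - e * (k : ℤ) + 2 * e) ++
        cnotAt L r (b - e * (k : ℤ) + 3 * e) (r + 1) (b - e * (k : ℤ) + 3 * e))
      (by
        intro i j hij _
        refine Commutes.append_left ?_ ?_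
        · refine commutes_czAt_cnotAt ?_ ?_ <;> rcases he with rfl | rfl <;> omega
        · refine commutes_cnotAt_cnotAt ?_ ?_ <;> rcases he with rfl | rfl <;> omega)) t₂)
  refine t₁.congr (fun s => ?_) (fun s => ?_)
  · exact rowAdd_rowAdd r s
  · simp only [id, zero_add, add_zero]
    rw [← Finset.sum_add_distrib]
    refine Finset.sum_congr rfl fun c _ => ?_
    rw [ev_rowAdd_succ hr (by omega), ev_rowAdd_of_ne (by omega), add_mul, ← add_assoc,
      add_self_zmod, zero_add]

/-! ### Cascades along a row -/

/-- Replace row `r` by its prefix sums. -/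
def prefixMap (r : ℤ) (s : Basis (Site L)) : Basis (Site L) :=
  fun x => if (x.1.val : ℤ) = r then prefixSum (ev s r) (x.2.val + 1) else s x

theorem ev_prefixMap_of_ne {r i : ℤ} (h : i ≠ r) (s : Basis (Site L)) (c : ℤ) :
    ev (prefixMap r s) i c = ev s i c := by
  refine ev_mk _ (fun i' j' => if i' = i then ev s i' j' else ev (prefixMap r s) i' j')
    (fun x => ?_) (fun r c hrc => ?_) i c |>.trans (by simp)
  · split_ifs with h'
    · rw [ev_site, prefixMap, if_neg (by omega)]
    · rw [ev_site]
  · split_ifs <;> exact ev_of_off _ hrc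

/-- Negative columns are allowed because both sides vanish there; `sum_gSame_prefixMap` uses column
-1. -/
theorem ev_prefixMap {r c : ℤ} (hr : 0 ≤ r) (hr' : r < L) (hc : c < L)
    (s : Basis (Site L)) :
    ev (prefixMap r s) r c = prefixSum (ev s r) (c + 1) := by
  by_cases h0 : 0 ≤ c
  · obtain ⟨x, _, rfl, rfl⟩ | ⟨_, h⟩ := site?_cases L r c
    · rw [ev_site, prefixMap, if_pos rfl]
    · omega
  · rw [ev_of_off _ (by omega), prefixSum_of_nonpos _ (by omega)]

/-- Each CNOT reads a site that already holds its own prefix sum. -/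
theorem implements_cascade (r : ℤ) (n : ℕ) :
    Implements ((List.range n).flatMap fun k : ℕ => cnotAt L r k r (k + 1))
      (fun s x => if (x.1.val : ℤ) = r ∧ x.2.val ≤ n then prefixSum (ev s r) (x.2.val + 1)
        else s x) (fun _ => 0) := by
  induction n with
  | zero =>
    refine implements_nil.congr (fun s => ?_) (fun _ => rfl)
    ext x
    simp only [id]
    split_ifs with h
    · obtain ⟨rfl, h⟩ := h
      rw [prefixSum_succ _ (by omega), prefixSum_of_nonpos _ (by omega), ev_site, zero_add]
    · rfl
  | succ n ih =>
    rw [flatMap_range_succ]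
    refine (ih.append (implements_cnotAt r n r (n + 1))).congr (fun s => ?_) (by simp)
    ext x
    simp only [Function.comp, cnotMap]
    by_cases hx : (x.1.val : ℤ) = r ∧ (x.2.val : ℤ) = n + 1
    · obtain ⟨rfl, hx⟩ := hx
      rw [if_neg (by omega), if_pos ⟨rfl, hx⟩, if_pos (by omega)]
      have hn : n < L := by have := x.2.isLt; omega
      have : ev (fun x_1 : Site L => if (x_1.1.val : ℤ) = x.1.val ∧ x_1.2.val ≤ n then
          prefixSum (ev s x.1.val) (x_1.2.val + 1) else s x_1) x.1.val n =
          prefixSum (ev s x.1.val) (n + 1) := by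
        have := ev_site (fun x_1 : Site L => if (x_1.1.val : ℤ) = x.1.val ∧ x_1.2.val ≤ n then
          prefixSum (ev s x.1.val) (x_1.2.val + 1) else s x_1) (x.1, ⟨n, hn⟩)
        simpa using this
      rw [this, prefixSum_succ _ (show (0 : ℤ) ≤ x.2.val by omega), hx, ← hx, ev_site, add_comm,
        hx]
    · rw [if_neg hx, add_zero]
      have : ((x.1.val : ℤ) = r ∧ x.2.val ≤ n + 1) ↔ ((x.1.val : ℤ) = r ∧ x.2.val ≤ n) := by
        omega
      simp only [this]

theorem implements_prefixMap {n : ℕ} (hn : L ≤ n) (r : ℤ) :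
    Implements ((List.range n).flatMap fun k : ℕ => cnotAt L r k r (k + 1)) (prefixMap r)
      (fun _ => 0) := by
  refine (implements_cascade r n).congr (fun s => ?_) (fun _ => rfl)
  ext x
  have := x.2.isLt
  simp only [prefixMap]
  simp only [show ((x.1.val : ℤ) = r ∧ x.2.val ≤ n) ↔ (x.1.val : ℤ) = r by omega]

/-- Replace row `r` by its differences. -/
def diffMap (r : ℤ) (s : Basis (Site L)) : Basis (Site L) :=
  fun x => s x + if (x.1.val : ℤ) = r then ev s r ((x.2.val : ℤ) - 1) else 0

theorem diffMap_prefixMap (r : ℤ) (s : Basis (Site L)) : diffMap r (prefixMap r s) = s := by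
  ext x
  have h1 := x.1.isLt
  have h2 := x.2.isLt
  unfold diffMap
  split_ifs with h
  · subst h
    rw [ev_prefixMap (by omega) (by omega) (by omega), prefixMap, if_pos rfl,
      prefixSum_succ _ (by omega), ev_site, sub_add_cancel, add_right_comm, add_self_zmod,
      zero_add]
  · rw [prefixMap, if_neg h, add_zero]

/-- From right to left, each CNOT reads its left neighbour before that neighbour is changed, so the
outcome is differences rather than sums. -/
theorem implements_uncascade (r : ℤ) (n : ℕ) :
    Implements ((List.range n).flatMap fun k : ℕ =>
        cnotAt L r ((L : ℤ) - 2 - k) r ((L : ℤ) - 2 - k + 1))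
      (fun s x => s x + if (x.1.val : ℤ) = r ∧ (L : ℤ) - n ≤ x.2.val then
        ev s r ((x.2.val : ℤ) - 1) else 0) (fun _ => 0) := by
  induction n with
  | zero =>
    refine implements_nil.congr (fun s => ?_) (fun _ => rfl)
    ext x
    have := x.2.isLt
    rw [if_neg (by push_cast; omega), add_zero, id]
  | succ n ih =>
    rw [flatMap_range_succ]
    refine (ih.append (implements_cnotAt r _ r _)).congr (fun s => ?_) (by simp)
    ext x
    simp only [Function.comp, cnotMap]
    have key : ev (fun x : Site L => s x + if (x.1.val : ℤ) = r ∧ (L : ℤ) - n ≤ x.2.val then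
        ev s r ((x.2.val : ℤ) - 1) else 0) r ((L : ℤ) - 2 - n) = ev s r ((L : ℤ) - 2 - n) := by
      obtain ⟨y, _, h1, h2⟩ | ⟨_, h⟩ := site?_cases L r ((L : ℤ) - 2 - n)
      · rw [← h1, ← h2, ev_site, ev_site, if_neg (by omega), add_zero]
      · rw [ev_of_off _ h, ev_of_off _ h]
    rw [key, add_assoc]
    congr 1
    by_cases hx : (x.1.val : ℤ) = r ∧ (x.2.val : ℤ) = (L : ℤ) - 2 - n + 1
    · rw [if_neg (by omega), if_pos hx, if_pos (by push_cast; omega), zero_add]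
      congr 1
      omega
    · rw [if_neg hx, add_zero]
      have : ((x.1.val : ℤ) = r ∧ (L : ℤ) - (n + 1 : ℕ) ≤ x.2.val) ↔
          ((x.1.val : ℤ) = r ∧ (L : ℤ) - n ≤ x.2.val) := by
        push_cast; omega
      simp only [this]

theorem implements_diffMap {n : ℕ} (hn : L ≤ n) (r : ℤ) :
    Implements ((List.range n).flatMap fun k : ℕ =>
      cnotAt L r ((L : ℤ) - 2 - k) r ((L : ℤ) - 2 - k + 1)) (diffMap r) (fun _ => 0) := by
  refine (implements_uncascade r n).congr (fun s => ?_) (fun _ => rfl)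
  ext x
  simp only [diffMap]
  simp only [show ((x.1.val : ℤ) = r ∧ (L : ℤ) - n ≤ x.2.val) ↔ (x.1.val : ℤ) = r by omega]

/-! ### Sweeps -/

theorem pipeSweep_eq (r : ℤ) (F U : List (ℤ × Gadget L)) : pipeSweep L r F U =
    ((List.range (L + 8)).flatMap fun k : ℕ => sweepStep L r F k) ++
      (List.range (L + 8)).flatMap fun k : ℕ => sweepStep L r U ((L : ℤ) - 2 - k) := by
  simp only [pipeSweep, List.bind_eq_flatMap, List.pure_def, List.flatMap_assoc, List.flatMap_cons,
    List.flatMap_nil, List.append_nil]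

theorem phase1_eq : phase1 L = (List.range L).flatMap fun c : ℕ =>
    (List.range (L - 1)).reverse.flatMap fun r : ℕ => cnotAt L ((r : ℤ) + 1) c r c := by
  simp only [phase1, List.bind_eq_flatMap, List.pure_def, List.flatMap_assoc, List.flatMap_cons,
    List.flatMap_nil, List.append_nil]

theorem phase3_eq : phase3 L = (List.range L).flatMap fun c : ℕ =>
    (List.range (L - 1)).flatMap fun r : ℕ => cnotAt L ((r : ℤ) + 1) c r c := by
  simp only [phase3, List.bind_eq_flatMap, List.pure_def, List.flatMap_assoc, List.flatMap_cons,
    List.flatMap_nil, List.append_nil]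

theorem phase4_eq : phase4 L =
    ((List.range L).filter fun r => decide (r % 2 = 0 ∧ r + 1 < L)).flatMap fun r : ℕ =>
      pipeSweep L r [(-2, gCross L r), (-3, gSame L r)] [(2, gCross L r), (3, gZ L r)] := by
  simp only [phase4, List.bind_eq_flatMap, List.pure_def, List.flatMap_assoc, List.flatMap_cons,
    List.flatMap_nil, List.append_nil]

/-- The gates fired at step `t` by the trailing gadgets `G`. -/
def trail (G : List (ℤ × Gadget L)) (t : ℤ) : Circuit L := G.flatMap fun g => g.2 (t + g.1)

theorem trail_ite (c : Prop) [Decidable c] (δ : ℤ) (g : Gadget L) (t : ℤ) :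
    trail (if c then [(δ, g)] else []) t = if c then g (t + δ) else [] := by
  split_ifs <;> simp [trail]

theorem cnotAt_of_neg {r t r' c' : ℤ} (ht : t < 0) : cnotAt L r t r' c' = [] := by
  unfold cnotAt
  rcases site?_cases L r t with ⟨x, _, _, h⟩ | ⟨h, _⟩
  · omega
  · simp [h]

theorem sweepStep_eq (r : ℤ) (G G' : List (ℤ × Gadget L)) (t : ℤ) :
    sweepStep L r (G ++ G') t = cnotAt L r t r (t + 1) ++ (trail G t ++ trail G' t) := by
  unfold sweepStep
  rw [List.flatMap_append]
  by_cases h : 0 ≤ t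
  · rw [if_pos h]; rfl
  · rw [if_neg h, cnotAt_of_neg (by omega)]; rfl

/-- Trailing gates commute with the later cascade gates, so the leg equals the whole cascade
followed by whole rows of trailing gates. Their phases are therefore evaluated at the cascaded
state. -/
theorem implements_leg {n : ℕ} {K A B : ℕ → Circuit L} {f qA qB}
    (hK : Implements ((List.range n).flatMap K) f (fun _ => 0))
    (hA : Implements ((List.range n).flatMap A) id qA)
    (hB : Implements ((List.range n).flatMap B) id qB)
    (hAK : ∀ i j, i < j → Commutes (A i) (K j)) (hBK : ∀ i j, i < j → Commutes (B i) (K j))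
    (hBA : ∀ i j, i < j → Commutes (B i) (A j)) :
    Implements ((List.range n).flatMap fun k => K k ++ (A k ++ B k)) f
      (fun s => qA (f s) + qB (f s)) := by
  refine Implements.of_circuitOp_eq (circuitOp_interleave fun i j hij _ =>
    (hAK i j hij).append_left (hBK i j hij)) ?_
  have hAB : Implements ((List.range n).flatMap fun k => A k ++ B k) id (fun s => qA s + qB s) :=
    Implements.of_circuitOp_eq (circuitOp_interleave fun i j hij _ => hBA i j hij)
      (hA.append hB)
  exact (hK.append hAB).congr (fun _ => rfl) (fun s => by simp)

/-- The forward gadgets see the prefix sums. In the undo leg the untangled cascade comes first and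
restores the row, so the undo gadgets see the original state. -/
theorem implements_pipeSweep {r : ℤ} {F F' U U' : List (ℤ × Gadget L)} {qF qF' qU qU'}
    (hF : Implements ((List.range (L + 8)).flatMap fun k : ℕ => trail F k) id qF)
    (hF' : Implements ((List.range (L + 8)).flatMap fun k : ℕ => trail F' k) id qF')
    (hU : Implements ((List.range (L + 8)).flatMap fun k : ℕ => trail U ((L : ℤ) - 2 - k)) id qU)
    (hU' : Implements ((List.range (L + 8)).flatMap fun k : ℕ => trail U' ((L : ℤ) - 2 - k)) id
      qU')
    (cF : ∀ t t', t < t' → Commutes (trail F t) (cnotAt L r t' r (t' + 1)))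
    (cF' : ∀ t t', t < t' → Commutes (trail F' t) (cnotAt L r t' r (t' + 1)))
    (cFF : ∀ t t', t < t' → Commutes (trail F' t) (trail F t'))
    (cU : ∀ t t', t' < t → Commutes (trail U t) (cnotAt L r t' r (t' + 1)))
    (cU' : ∀ t t', t' < t → Commutes (trail U' t) (cnotAt L r t' r (t' + 1)))
    (cUU : ∀ t t', t' < t → Commutes (trail U' t) (trail U t')) :
    Implements (pipeSweep L r (F ++ F') (U ++ U')) id
      (fun s => qF (prefixMap r s) + qF' (prefixMap r s) + (qU s + qU' s)) := by
  rw [pipeSweep_eq]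
  simp only [sweepStep_eq]
  have h1 := implements_leg (implements_prefixMap (L := L) (n := L + 8) (by omega) r) hF hF'
    (fun i j hij => cF _ _ (by omega)) (fun i j hij => cF' _ _ (by omega))
    (fun i j hij => cFF _ _ (by omega))
  have h2 := implements_leg (implements_diffMap (L := L) (n := L + 8) (by omega) r) hU hU'
    (fun i j hij => cU _ _ (by omega)) (fun i j hij => cU' _ _ (by omega))
    (fun i j hij => cUU _ _ (by omega))
  refine (h1.append h2).congr (fun s => ?_) (fun s => ?_)
  · exact diffMap_prefixMap r s
  · simp only [diffMap_prefixMap]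

/-- The one possible clash is that the cascade target (r, t + 1) controls one of the two CNOTs of
the gadget. -/
theorem commutes_gSkip_cnotAt {r e c t : ℤ} (h1 : c + e ≠ t + 1) (h3 : c + 3 * e ≠ t + 1) :
    Commutes (gSkip L r e c) (cnotAt L r t r (t + 1)) := by
  unfold gSkip
  refine Commutes.append_left (Commutes.append_left (Commutes.append_left ?_ ?_) ?_) ?_
  · exact commutes_czAt_cnotAt (by omega) (by omega)
  · exact commutes_cnotAt_cnotAt (by omega) (by omega)
  · exact commutes_czAt_cnotAt (by omega) (by omega)
  · exact commutes_cnotAt_cnotAt (by omega) (by omega)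

theorem commutes_gSame_cnotAt {r c t : ℤ} (h : c < t + 1) :
    Commutes (gSame L r c) (cnotAt L r t r (t + 1)) :=
  commutes_czAt_cnotAt (by omega) (by omega)

theorem commutes_gCross_cnotAt {r c t : ℤ} (h : c ≠ t + 1) :
    Commutes (gCross L r c) (cnotAt L r t r (t + 1)) :=
  commutes_czAt_cnotAt (by omega) (by omega)

theorem commutes_gZ_cnotAt {r c a b a' b' : ℤ} (h : ¬ (r = a' ∧ c = b')) :
    Commutes (gZ L r c) (cnotAt L a b a' b') := by
  unfold gZ
  split_ifs
  · exact commutes_zAt_cnotAt h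
  · exact commutes_nil_left _

theorem commutes_gSame_gSkip (r e c c' : ℤ) : Commutes (gSame L r c) (gSkip L r e c') := by
  unfold gSkip gSame
  refine Commutes.append_right (Commutes.append_right (Commutes.append_right ?_ ?_) ?_) ?_
  · exact commutes_of_diagonal (implements_czAt _ _ _ _) (implements_czAt _ _ _ _)
  · exact commutes_czAt_cnotAt (by omega) (by omega)
  · exact commutes_of_diagonal (implements_czAt _ _ _ _) (implements_czAt _ _ _ _)
  · exact commutes_czAt_cnotAt (by omega) (by omega)

theorem commutes_gZ_gSkip (r e c c' : ℤ) : Commutes (gZ L r c) (gSkip L r e c') := by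
  unfold gSkip
  refine Commutes.append_right (Commutes.append_right (Commutes.append_right ?_ ?_) ?_) ?_
  · exact commutes_of_diagonal (implements_gZ _ _) (implements_czAt _ _ _ _)
  · exact commutes_gZ_cnotAt (by omega)
  · exact commutes_of_diagonal (implements_gZ _ _) (implements_czAt _ _ _ _)
  · exact commutes_gZ_cnotAt (by omega)

theorem implements_flatMap_ite {c : Prop} [Decidable c] {n : ℕ} {D : ℕ → Circuit L} {q}
    (h : c → Implements ((List.range n).flatMap D) id q) :
    Implements ((List.range n).flatMap fun k => if c then D k else []) id
      (fun s => if c then q s else 0) := by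
  split_ifs with hc
  · exact h hc
  · rw [show ((List.range n).flatMap fun _ : ℕ => ([] : Circuit L)) = [] by simp]
    exact implements_nil

theorem commutes_ite_left {c : Prop} [Decidable c] {C D : Circuit L} (h : Commutes C D) :
    Commutes (if c then C else []) D := by
  split_ifs
  · exact h
  · exact commutes_nil_left D

theorem commutes_ite_right {c : Prop} [Decidable c] {C D : Circuit L} (h : Commutes C D) :
    Commutes C (if c then D else []) :=
  (commutes_ite_left h.symm).symm

theorem sum_gSame_prefixMap {r : ℤ} (hr : 0 ≤ r) (hr' : r < L) (s : Basis (Site L)) :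
    (∑ c ∈ Finset.range L, ev (prefixMap r s) r ((c : ℤ) - 1) * ev (prefixMap r s) r c) +
      (∑ c ∈ Finset.range L, if ((L : ℤ) - 1 - c) % 2 = 1 then ev s r c else 0) =
      strictForm L (ev s r) (ev s r) := by
  rw [← sum_mul_prefixSum_succ]
  congr 1
  refine Finset.sum_congr rfl fun c hc => ?_
  rw [Finset.mem_range] at hc
  rw [ev_prefixMap hr hr' (by omega), ev_prefixMap hr hr' (by omega), sub_add_cancel]

theorem sum_cross_prefixMap {r r' : ℤ} (hr : 0 ≤ r) (hr' : r < L) (h : r' ≠ r)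
    (s : Basis (Site L)) :
    (∑ c ∈ Finset.range L, ev (prefixMap r s) r c * ev (prefixMap r s) r' c) +
      (∑ c ∈ Finset.range L, ev s r c * ev s r' c) = strictForm L (ev s r) (ev s r') := by
  rw [← sum_prefixSum_succ_mul]
  congr 1
  refine Finset.sum_congr rfl fun c hc => ?_
  rw [Finset.mem_range] at hc
  rw [ev_prefixMap hr hr' (by omega), ev_prefixMap_of_ne h]

theorem cast_add_injective (a : ℤ) : (fun k : ℕ => (k : ℤ) + a).Injective := by
  intro i j h
  simp only at h
  omega

theorem sub_cast_add_injective (a b : ℤ) : (fun k : ℕ => a - (k : ℤ) + b).Injective := by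
  intro i j h
  simp only at h
  omega

theorem implements_sweepA {r : ℕ} (hr : r < L) :
    Implements (sweepA L r) id (fun s =>
      (if r + 2 < L then strictForm L (ev s r) (ev s (r + 2)) else 0) +
      (if 2 ≤ r then strictForm L (ev s r) (ev s r) else 0)) := by
  unfold sweepA
  have hF : Implements ((List.range (L + 8)).flatMap fun k : ℕ =>
      trail (if r + 2 < L then [(-1, gSkip L r (-1))] else []) k) id (fun s =>
        if r + 2 < L then ∑ c ∈ Finset.range L, ev s r c * ev s (r + 2) c else 0) := by
    simp only [trail_ite]
    refine implements_flatMap_ite fun h => ?_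
    have := implements_flatMap_gSkip (L := L) (n := L + 8) (b := -1) (e := -1) (r := r)
      (Or.inr rfl) (by omega) (by omega)
      -- The d-th gate of the forward gadget reaches column c at step c + 1 + d.
      (fun d h0 h3 c hc => ⟨(c + 1 + d).toNat, by omega, by omega⟩)
    convert this using 4
    ring
  have hU : Implements ((List.range (L + 8)).flatMap fun k : ℕ =>
      trail (if r + 2 < L then [(1, gSkip L r 1)] else []) ((L : ℤ) - 2 - k)) id (fun s =>
        if r + 2 < L then ∑ c ∈ Finset.range L, ev s r c * ev s (r + 2) c else 0) := by
    simp only [trail_ite]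
    refine implements_flatMap_ite fun h => ?_
    have := implements_flatMap_gSkip (L := L) (n := L + 8) (b := L - 1) (e := 1) (r := r)
      (Or.inl rfl) (by omega) (by omega)
      (fun d h0 h3 c hc => ⟨(L - 1 - c + d).toNat, by omega, by omega⟩)
    convert this using 4
    ring
  have hF' : Implements ((List.range (L + 8)).flatMap fun k : ℕ =>
      trail (if 2 ≤ r then [(-5, gSame L r)] else []) k) id (fun s =>
        if 2 ≤ r then ∑ c ∈ Finset.range L, ev s r ((c : ℤ) - 1) * ev s r c else 0) := by
    simp only [trail_ite]
    exact implements_flatMap_ite fun h => implements_flatMap_gSame (L := L) (n := L + 8) r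
      (cast_add_injective (-5)) (fun c hc => ⟨c + 5, by omega, by push_cast; omega⟩)
  have hU' : Implements ((List.range (L + 8)).flatMap fun k : ℕ =>
      trail (if 2 ≤ r then [(5, gZ L r)] else []) ((L : ℤ) - 2 - k)) id (fun s => if 2 ≤ r then
        ∑ c ∈ Finset.range L, if ((L : ℤ) - 1 - c) % 2 = 1 then ev s r c else 0 else 0) := by
    simp only [trail_ite]
    exact implements_flatMap_ite fun h => implements_flatMap_gZ (L := L) (n := L + 8) r
      (sub_cast_add_injective (L - 2) 5) (fun c hc => ⟨L + 3 - c, by omega, by omega⟩)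
  have := implements_pipeSweep (r := r) hF hF' hU hU' ?_ ?_ ?_ ?_ ?_ ?_
  · refine this.congr (fun _ => rfl) (fun s => ?_)
    -- Each forward phase is paired with its partner in the undo leg: skip with skip, neighbour CZs
    -- with Z gates.
    have char2 : ∀ a b a' b' : ZMod 2, a + b + (a' + b') = (a + a') + (b + b') := by decide
    rw [char2]
    congr 1
    · split_ifs
      · exact sum_cross_prefixMap (by omega) (by omega) (by omega) s
      · rfl
    · split_ifs
      · exact sum_gSame_prefixMap (by omega) (by omega) s
      · rfl
  · intro t t' h
    rw [trail_ite]
    exact commutes_ite_left (commutes_gSkip_cnotAt (by omega) (by omega))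
  · intro t t' h
    rw [trail_ite]
    exact commutes_ite_left (commutes_gSame_cnotAt (by omega))
  · intro t t' h
    rw [trail_ite, trail_ite]
    exact commutes_ite_left (commutes_ite_right (commutes_gSame_gSkip _ _ _ _))
  · intro t t' h
    rw [trail_ite]
    exact commutes_ite_left (commutes_gSkip_cnotAt (by omega) (by omega))
  · intro t t' h
    rw [trail_ite]
    exact commutes_ite_left (commutes_gZ_cnotAt (by omega))
  · intro t t' h
    rw [trail_ite, trail_ite]
    exact commutes_ite_left (commutes_ite_right (commutes_gZ_gSkip _ _ _ _))

theorem trail_singleton (δ : ℤ) (g : Gadget L) (t : ℤ) : trail [(δ, g)] t = g (t + δ) := by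
  simp [trail]

theorem trail_nil (t : ℤ) : trail ([] : List (ℤ × Gadget L)) t = [] := by
  simp [trail]

theorem implements_pairSweep {r : ℕ} (hr : r < L) :
    Implements (pipeSweep L r [(-2, gCross L r), (-3, gSame L r)] [(2, gCross L r), (3, gZ L r)])
      id (fun s => strictForm L (ev s r) (ev s (r + 1)) + strictForm L (ev s r) (ev s r)) := by
  have hF : Implements ((List.range (L + 8)).flatMap fun k : ℕ =>
      trail [(-2, gCross L r)] k) id (fun s =>
        ∑ c ∈ Finset.range L, ev s r c * ev s (r + 1) c) := by
    simp only [trail_singleton]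
    exact implements_flatMap_czAt (L := L) (n := L + 8) r (r + 1)
      (cast_add_injective (-2)) (fun c hc => ⟨c + 2, by omega, by push_cast; omega⟩)
  have hU : Implements ((List.range (L + 8)).flatMap fun k : ℕ =>
      trail [(2, gCross L r)] ((L : ℤ) - 2 - k)) id (fun s =>
        ∑ c ∈ Finset.range L, ev s r c * ev s (r + 1) c) := by
    simp only [trail_singleton]
    exact implements_flatMap_czAt (L := L) (n := L + 8) r (r + 1)
      (sub_cast_add_injective (L - 2) 2) (fun c hc => ⟨L - c, by omega, by omega⟩)
  have hF' : Implements ((List.range (L + 8)).flatMap fun k : ℕ =>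
      trail [(-3, gSame L r)] k) id (fun s =>
        ∑ c ∈ Finset.range L, ev s r ((c : ℤ) - 1) * ev s r c) := by
    simp only [trail_singleton]
    exact implements_flatMap_gSame (L := L) (n := L + 8) r
      (cast_add_injective (-3)) (fun c hc => ⟨c + 3, by omega, by push_cast; omega⟩)
  have hU' : Implements ((List.range (L + 8)).flatMap fun k : ℕ =>
      trail [(3, gZ L r)] ((L : ℤ) - 2 - k)) id (fun s =>
        ∑ c ∈ Finset.range L, if ((L : ℤ) - 1 - c) % 2 = 1 then ev s r c else 0) := by
    simp only [trail_singleton]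
    exact implements_flatMap_gZ (L := L) (n := L + 8) r
      (sub_cast_add_injective (L - 2) 3) (fun c hc => ⟨L + 1 - c, by omega, by omega⟩)
  have := implements_pipeSweep (r := r) hF hF' hU hU' ?_ ?_ ?_ ?_ ?_ ?_
  · refine this.congr (fun _ => rfl) (fun s => ?_)
    have char2 : ∀ a b a' b' : ZMod 2, a + b + (a' + b') = (a + a') + (b + b') := by decide
    rw [char2]
    congr 1
    · exact sum_cross_prefixMap (by omega) (by omega) (by omega) s
    · exact sum_gSame_prefixMap (by omega) (by omega) s
  · intro t t' h
    rw [trail_singleton]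
    exact commutes_gCross_cnotAt (by omega)
  · intro t t' h
    rw [trail_singleton]
    exact commutes_gSame_cnotAt (by omega)
  · intro t t' h
    rw [trail_singleton, trail_singleton]
    exact commutes_of_diagonal (implements_czAt _ _ _ _) (implements_czAt _ _ _ _)
  · intro t t' h
    rw [trail_singleton]
    exact commutes_gCross_cnotAt (by omega)
  · intro t t' h
    rw [trail_singleton]
    exact commutes_gZ_cnotAt (by omega)
  · intro t t' h
    rw [trail_singleton, trail_singleton]
    exact commutes_of_diagonal (implements_gZ _ _) (implements_czAt _ _ _ _)

theorem implements_lastSweep {r : ℤ} (h0 : 0 ≤ r) (hr : r < L) :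
    Implements (pipeSweep L r [(-3, gSame L r)] [(3, gZ L r)]) id
      (fun s => strictForm L (ev s r) (ev s r)) := by
  have hN : ∀ t : ℕ → ℤ, Implements ((List.range (L + 8)).flatMap fun k : ℕ =>
      trail ([] : List (ℤ × Gadget L)) (t k)) id (fun _ => 0) := by
    intro t
    simp only [trail_nil]
    rw [show ((List.range (L + 8)).flatMap fun _ : ℕ => ([] : Circuit L)) = [] by simp]
    exact implements_nil
  have hF' : Implements ((List.range (L + 8)).flatMap fun k : ℕ =>
      trail [(-3, gSame L r)] k) id (fun s =>
        ∑ c ∈ Finset.range L, ev s r ((c : ℤ) - 1) * ev s r c) := by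
    simp only [trail_singleton]
    exact implements_flatMap_gSame (L := L) (n := L + 8) r
      (cast_add_injective (-3)) (fun c hc => ⟨c + 3, by omega, by push_cast; omega⟩)
  have hU' : Implements ((List.range (L + 8)).flatMap fun k : ℕ =>
      trail [(3, gZ L r)] ((L : ℤ) - 2 - k)) id (fun s =>
        ∑ c ∈ Finset.range L, if ((L : ℤ) - 1 - c) % 2 = 1 then ev s r c else 0) := by
    simp only [trail_singleton]
    exact implements_flatMap_gZ (L := L) (n := L + 8) r
      (sub_cast_add_injective (L - 2) 3) (fun c hc => ⟨L + 1 - c, by omega, by omega⟩)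
  have := implements_pipeSweep (r := r) (hN fun k => k) hF' (hN fun k => (L : ℤ) - 2 - k) hU'
    ?_ ?_ ?_ ?_ ?_ ?_
  · refine this.congr (fun _ => rfl) (fun s => ?_)
    rw [zero_add, zero_add]
    exact sum_gSame_prefixMap h0 hr s
  · intro t t' h
    exact commutes_nil_left _
  · intro t t' h
    rw [trail_singleton]
    exact commutes_gSame_cnotAt (by omega)
  · intro t t' h
    exact (commutes_nil_left _).symm
  · intro t t' h
    exact commutes_nil_left _
  · intro t t' h
    rw [trail_singleton]
    exact commutes_gZ_cnotAt (by omega)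
  · intro t t' h
    exact (commutes_nil_left _).symm

/-! ### The column-parity basis -/

/-- Running upwards, each CNOT reads a site that already holds its suffix sum. The list is reversed,
so the induction puts the new bottom gate first. -/
theorem implements_colCascade (c : ℤ) (n : ℕ) :
    Implements ((List.range n).reverse.flatMap fun r : ℕ => cnotAt L ((r : ℤ) + 1) c r c)
      (fun s x => if (x.2.val : ℤ) = c ∧ x.1.val < n then
        ∑ i ∈ Finset.Ico x.1.val (n + 1), ev s i c else s x) (fun _ => 0) := by
  induction n with
  | zero => exact implements_nil.congr (fun s => by ext x; simp) (fun _ => rfl)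
  | succ n ih =>
    rw [List.range_succ, List.reverse_append, List.reverse_singleton, List.singleton_append,
      List.flatMap_cons]
    refine ((implements_cnotAt ((n : ℤ) + 1) c n c).append ih).congr (fun s => ?_) (by simp)
    have key : ∀ i : ℕ, ev (cnotMap ((n : ℤ) + 1) c n c s) i c =
        ev s i c + if i = n then ev s ((n : ℤ) + 1) c else 0 := by
      intro i
      split_ifs with h
      · subst h
        obtain ⟨y, _, h1, h2⟩ | ⟨_, h⟩ := site?_cases L (i : ℤ) c
        · rw [← h1, ← h2, ev_site, ev_site, cnotMap, if_pos ⟨rfl, rfl⟩]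
        · rw [ev_of_off _ h, ev_of_off, ev_of_off, add_zero] <;> omega
      · rw [ev_cnotMap_of_ne (by omega), add_zero]
    ext x
    simp only [Function.comp]
    by_cases hc : (x.2.val : ℤ) = c
    · by_cases hx : x.1.val < n
      · rw [if_pos ⟨hc, hx⟩, if_pos ⟨hc, by omega⟩]
        simp only [key]
        rw [Finset.sum_add_distrib, Finset.sum_ite_eq',
          if_pos (Finset.mem_Ico.2 ⟨by omega, by omega⟩),
          Finset.sum_Ico_succ_top (by omega : x.1.val ≤ n + 1)]
        push_cast
        rfl
      · rw [if_neg (by omega)]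
        by_cases hxn : x.1.val = n
        · rw [if_pos ⟨hc, by omega⟩, hxn, cnotMap, if_pos ⟨by omega, hc⟩,
            Finset.sum_Ico_succ_top (by omega), Finset.sum_Ico_succ_top (by omega),
            Finset.Ico_self, Finset.sum_empty, zero_add, ← hxn, ← hc, ev_site]
          push_cast
          rfl
        · rw [if_neg (by omega), cnotMap, if_neg (by omega), add_zero]
    · rw [if_neg (by tauto), if_neg (by tauto), cnotMap, if_neg (by tauto), add_zero]

/-- The column-parity basis: every qubit gets the sum of the qubits below it, and itself. -/
def suffixMap (s : Basis (Site L)) : Basis (Site L) :=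
  fun x => ∑ i ∈ Finset.Ico x.1.val L, ev s i x.2.val

theorem ev_suffixMap (s : Basis (Site L)) (r : ℕ) (c : ℤ) :
    ev (suffixMap s) r c = ∑ i ∈ Finset.Ico r L, ev s i c := by
  obtain ⟨y, _, h1, rfl⟩ | ⟨_, h⟩ := site?_cases L (r : ℤ) c
  · obtain rfl : y.1.val = r := by exact_mod_cast h1
    rw [ev_site]
    rfl
  · rw [ev_of_off _ h]
    symm
    apply Finset.sum_eq_zero
    intro i hi
    rw [Finset.mem_Ico] at hi
    apply ev_of_off
    omega

theorem implements_phase1 : Implements (phase1 L) suffixMap (fun _ => 0) := by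
  have key : ∀ m : ℕ, Implements ((List.range m).flatMap fun c : ℕ =>
      (List.range (L - 1)).reverse.flatMap fun r : ℕ => cnotAt L ((r : ℤ) + 1) c r c)
      (fun s x => if x.2.val < m then suffixMap s x else s x) (fun _ => 0) := by
    intro m
    induction m with
    | zero => exact implements_nil.congr (fun s => by ext x; simp) (fun _ => rfl)
    | succ m ih =>
      rw [flatMap_range_succ]
      refine (ih.append (implements_colCascade m (L - 1))).congr (fun s => ?_) (by simp)
      have hev : ∀ i : ℕ, ev (fun x : Site L => if x.2.val < m then suffixMap s x else s x) i m =
          ev s i m := by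
        intro i
        obtain ⟨y, _, h1, h2⟩ | ⟨_, h⟩ := site?_cases L (i : ℤ) m
        · rw [← h1, ← h2, ev_site, ev_site, if_neg (by omega)]
        · rw [ev_of_off _ h, ev_of_off _ h]
      ext x
      have hx := x.1.isLt
      simp only [Function.comp, hev]
      by_cases hm : x.2.val = m
      · rw [if_pos (show x.2.val < m + 1 by omega), suffixMap, ← hm]
        split_ifs with h1 h2
        · rw [Nat.sub_add_cancel (by omega)]
        · omega
        · have : x.1.val = L - 1 := by omega
          have e : Finset.Ico x.1.val L = {x.1.val} := by
            ext i; simp only [Finset.mem_Ico, Finset.mem_singleton]; omega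
          rw [e, Finset.sum_singleton, ev_site]
      · rw [if_neg (by omega)]
        simp only [show x.2.val < m + 1 ↔ x.2.val < m by omega]
  rw [phase1_eq]
  refine (key L).congr (fun s => ?_) (fun _ => rfl)
  ext x
  rw [if_pos x.2.isLt]

theorem implements_colUncascade (c : ℤ) (n : ℕ) :
    Implements ((List.range n).flatMap fun r : ℕ => cnotAt L ((r : ℤ) + 1) c r c)
      (fun s x => s x + if (x.2.val : ℤ) = c ∧ x.1.val < n then
        ev s ((x.1.val : ℤ) + 1) c else 0) (fun _ => 0) := by
  induction n with
  | zero => exact implements_nil.congr (fun s => by ext x; simp) (fun _ => rfl)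
  | succ n ih =>
    rw [flatMap_range_succ]
    refine (ih.append (implements_cnotAt _ c _ c)).congr (fun s => ?_) (by simp)
    have key : ev (fun x : Site L => s x + if (x.2.val : ℤ) = c ∧ x.1.val < n then
        ev s ((x.1.val : ℤ) + 1) c else 0) ((n : ℤ) + 1) c = ev s ((n : ℤ) + 1) c := by
      obtain ⟨y, _, h1, h2⟩ | ⟨_, h⟩ := site?_cases L ((n : ℤ) + 1) c
      · rw [← h1, ← h2, ev_site, ev_site, if_neg (by omega), add_zero]
      · rw [ev_of_off _ h, ev_of_off _ h]
    ext x
    simp only [Function.comp, cnotMap]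
    rw [key, add_assoc]
    congr 1
    by_cases hx : (x.1.val : ℤ) = n ∧ (x.2.val : ℤ) = c
    · rw [if_neg (by omega), if_pos hx, if_pos (by omega), zero_add, hx.1]
    · rw [if_neg hx, add_zero]
      simp only [show ((x.2.val : ℤ) = c ∧ x.1.val < n + 1) ↔
        ((x.2.val : ℤ) = c ∧ x.1.val < n) by omega]

/-- Leave the column-parity basis. -/
def unsuffixMap (s : Basis (Site L)) : Basis (Site L) :=
  fun x => s x + ev s ((x.1.val : ℤ) + 1) x.2.val

theorem unsuffixMap_suffixMap (s : Basis (Site L)) : unsuffixMap (suffixMap s) = s := by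
  ext x
  have hx := x.1.isLt
  have e := ev_suffixMap s (x.1.val + 1) x.2.val
  push_cast at e
  rw [unsuffixMap, e, suffixMap, Finset.sum_eq_sum_Ico_succ_bot hx, ev_site, add_assoc,
    add_self_zmod, add_zero]

theorem implements_phase3 : Implements (phase3 L) unsuffixMap (fun _ => 0) := by
  have key : ∀ m : ℕ, Implements ((List.range m).flatMap fun c : ℕ =>
      (List.range (L - 1)).flatMap fun r : ℕ => cnotAt L ((r : ℤ) + 1) c r c)
      (fun s x => if x.2.val < m then unsuffixMap s x else s x) (fun _ => 0) := by
    intro m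
    induction m with
    | zero => exact implements_nil.congr (fun s => by ext x; simp) (fun _ => rfl)
    | succ m ih =>
      rw [flatMap_range_succ]
      refine (ih.append (implements_colUncascade m (L - 1))).congr (fun s => ?_) (by simp)
      have hev : ∀ i : ℤ, ev (fun x : Site L => if x.2.val < m then unsuffixMap s x else s x)
          i m = ev s i m := by
        intro i
        obtain ⟨y, _, h1, h2⟩ | ⟨_, h⟩ := site?_cases L i m
        · rw [← h1, ← h2, ev_site, ev_site, if_neg (by omega)]
        · rw [ev_of_off _ h, ev_of_off _ h]
      ext x
      have hx := x.1.isLt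
      simp only [Function.comp, hev]
      by_cases hm : x.2.val = m
      · rw [if_pos (show x.2.val < m + 1 by omega), if_neg (by omega), unsuffixMap, ← hm]
        split_ifs with h1
        · rfl
        · rw [ev_of_off]
          omega
      · rw [if_neg (show ¬ ((x.2.val : ℤ) = m ∧ x.1.val < L - 1) by omega), add_zero]
        simp only [show x.2.val < m + 1 ↔ x.2.val < m by omega]
  rw [phase3_eq]
  refine (key L).congr (fun s => ?_) (fun _ => rfl)
  ext x
  rw [if_pos x.2.isLt]

/-! ### The quadratic form of `Γ` -/

theorem sum_range_two_mul (f : ℕ → ZMod 2) (n : ℕ) :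
    ∑ r ∈ Finset.range (2 * n), f r = ∑ m ∈ Finset.range n, (f (2 * m) + f (2 * m + 1)) := by
  induction n with
  | zero => simp
  | succ n ih =>
    rw [show 2 * (n + 1) = 2 * n + 1 + 1 by ring, Finset.sum_range_succ, Finset.sum_range_succ, ih,
      Finset.sum_range_succ, add_assoc]

/-- Letting m run up to L overshoots the grid, where the summands vanish; this avoids a case split
on the parity of L. -/
theorem sum_range_pairs {f : ℕ → ZMod 2} (hf : ∀ r, L ≤ r → f r = 0) :
    ∑ r ∈ Finset.range L, f r = ∑ m ∈ Finset.range L, (f (2 * m) + f (2 * m + 1)) := by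
  rw [← sum_range_two_mul]
  apply Finset.sum_subset
  · intro r hr
    rw [Finset.mem_range] at *
    omega
  · intro r _ hr
    rw [Finset.mem_range] at hr
    exact hf r (by omega)

theorem sum_range_even {f : ℕ → ZMod 2} (hf : ∀ r, L ≤ r → f r = 0) :
    ∑ r ∈ Finset.range L, (if r % 2 = 0 then f r else 0) =
      ∑ m ∈ Finset.range L, f (2 * m) := by
  rw [sum_range_pairs (f := fun r => if r % 2 = 0 then f r else 0)]
  · refine Finset.sum_congr rfl fun m _ => ?_
    rw [if_pos (by omega), if_neg (by omega), add_zero]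
  · intro r hr
    rw [hf r hr, ite_self]

theorem ev_row_eq_zero (s : Basis (Site L)) {r : ℤ} (hr : (L : ℤ) ≤ r) : ev s r = 0 := by
  funext c
  exact ev_of_off s (by omega)

theorem ev_suffixMap_succ (s : Basis (Site L)) (r : ℕ) :
    ev (suffixMap s) r = ev s r + ev (suffixMap s) (r + 1 : ℕ) := by
  funext c
  rw [Pi.add_apply, ev_suffixMap, ev_suffixMap]
  by_cases h : r < L
  · rw [Finset.sum_eq_sum_Ico_succ_bot h]
  · rw [Finset.Ico_eq_empty (by omega), Finset.Ico_eq_empty (by omega), ev_of_off s (by omega)]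
    simp

/-- The sums over blocks of two rows. -/
theorem sum_blocks (s : Basis (Site L)) :
    (∑ m ∈ Finset.range L,
      (strictForm L (ev (suffixMap s) (2 * m : ℕ)) (ev (suffixMap s) (2 * m + 2 : ℕ)) +
        if 2 ≤ 2 * m then strictForm L (ev (suffixMap s) (2 * m : ℕ)) (ev (suffixMap s) (2 * m : ℕ))
        else 0)) +
    (∑ m ∈ Finset.range L, (strictForm L (ev s (2 * m : ℕ)) (ev s (2 * m + 1 : ℕ)) +
      strictForm L (ev s (2 * m : ℕ)) (ev s (2 * m : ℕ)))) =
    ∑ m ∈ Finset.range L, (strictForm L (ev s (2 * m : ℕ)) (ev (suffixMap s) (2 * m : ℕ)) +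
      strictForm L (ev s (2 * m + 1 : ℕ)) (ev (suffixMap s) (2 * m + 2 : ℕ))) := by
  -- The sweep over row 2m, m ≥ 1, supplies the same-row term of the block m - 1 above it.
  have shift : ∀ g : ℕ → ZMod 2, g L = 0 →
      ∑ m ∈ Finset.range L, (if 2 ≤ 2 * m then g m else 0) =
        ∑ m ∈ Finset.range L, g (m + 1) := by
    intro g hg
    have h1 := Finset.sum_range_succ (fun m => if 2 ≤ 2 * m then g m else 0) L
    have h2 := Finset.sum_range_succ' (fun m => if 2 ≤ 2 * m then g m else 0) L
    rw [h1] at h2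
    simp only [hg, ite_self, add_zero] at h2
    rw [h2, if_neg (by omega), add_zero]
    exact Finset.sum_congr rfl fun m _ => if_pos (by omega)
  rw [Finset.sum_add_distrib, shift fun m =>
    strictForm L (ev (suffixMap s) (2 * m : ℕ)) (ev (suffixMap s) (2 * m : ℕ))]
  · rw [← Finset.sum_add_distrib, ← Finset.sum_add_distrib]
    refine Finset.sum_congr rfl fun m _ => ?_
    -- Everything is expanded through u_{2m} = s_{2m} + s_{2m+1} + u_{2m+2}. On the left the term
    -- ⟨u_{2m+2}, u_{2m+2}⟩ occurs twice and cancels.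
    have e1 := ev_suffixMap_succ s (2 * m)
    have e2 := ev_suffixMap_succ s (2 * m + 1)
    rw [show 2 * (m + 1) = 2 * m + 2 by ring]
    rw [show 2 * m + 1 + 1 = 2 * m + 2 by ring] at e2
    rw [e1, e2]
    simp only [strictForm_add_left, strictForm_add_right]
    generalize strictForm L (ev s (2 * m : ℕ)) (ev (suffixMap s) (2 * m + 2 : ℕ)) = a
    generalize strictForm L (ev s (2 * m + 1 : ℕ)) (ev (suffixMap s) (2 * m + 2 : ℕ)) = b
    generalize strictForm L (ev (suffixMap s) (2 * m + 2 : ℕ)) _ = c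
    generalize strictForm L (ev s (2 * m : ℕ)) (ev s (2 * m + 1 : ℕ)) = d
    generalize strictForm L (ev s (2 * m : ℕ)) (ev s (2 * m : ℕ)) = e
    revert a b c d e
    decide
  · rw [ev_row_eq_zero _ (by push_cast; omega), strictForm_zero_left]

/-! ### The disorder between snake order and column order -/

theorem prefixSum_fin (f : ℤ → ZMod 2) (c : Fin L) :
    prefixSum f c.val = ∑ a : Fin L, if a < c then f a.val else 0 := by
  have h : ∑ j ∈ Finset.range c.val, f j =
      ∑ j ∈ Finset.range L, if j < c.val then f j else 0 := by
    rw [← Finset.sum_filter]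
    refine Finset.sum_congr ?_ fun _ _ => rfl
    ext j
    have := c.isLt
    simp only [Finset.mem_range, Finset.mem_filter]
    omega
  unfold prefixSum
  rw [Int.toNat_natCast, h, Finset.sum_range]
  rfl

theorem ev_suffixMap_fin (s : Basis (Site L)) (r : ℕ) (c : Fin L) :
    ev (suffixMap s) r c.val = ∑ i : Fin L, if r ≤ i.val then s (i, c) else 0 := by
  rw [ev_suffixMap]
  have h : ∑ i ∈ Finset.Ico r L, ev s i c.val =
      ∑ i ∈ Finset.range L, if r ≤ i then ev s i c.val else 0 := by
    rw [← Finset.sum_filter]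
    refine Finset.sum_congr ?_ fun _ _ => rfl
    ext j
    simp only [Finset.mem_range, Finset.mem_filter, Finset.mem_Ico]
    omega
  rw [h, Finset.sum_range]
  refine Finset.sum_congr rfl fun i _ => ?_
  rw [← ev_site s (i, c)]

/-- Between different rows the snake compares rows, and the column order, which runs right to left,
disagrees when the lower site is further right. Within a row the two orders disagree on even rows
and agree on odd ones. -/
theorem snake_lt_colOrder_gt_iff (x y : Site L) : (snake x < snake y ∧ colOrder y < colOrder x) ↔
    x.2 < y.2 ∧ (if x.1.val % 2 = 0 then x.1.val else x.1.val + 1) ≤ y.1.val := by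
  rw [colOrder_lt_iff]
  obtain ⟨⟨r, hr⟩, ⟨c, hc⟩⟩ := x
  obtain ⟨⟨r', hr'⟩, ⟨c', hc'⟩⟩ := y
  simp only [snake, jw_val, Fin.mk_lt_mk, Fin.mk.injEq]
  rcases lt_trichotomy r r' with h | h | h
  · have : r * L + L ≤ r' * L := by
      rw [← Nat.succ_mul]
      exact Nat.mul_le_mul_right _ h
    split_ifs <;> omega
  · subst h
    split_ifs <;> omega
  · have : r' * L + L ≤ r * L := by
      rw [← Nat.succ_mul]
      exact Nat.mul_le_mul_right _ h
    split_ifs <;> omega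

/-- The partners of a site (r, c) fill whole lower parts of the columns to its right, from row r or
r + 1 on. Their sums are entries of `suffixMap`. -/
theorem disorder_snake_colOrder (s : Basis (Site L)) : disorder snake colOrder s =
    ∑ r ∈ Finset.range L, strictForm L (ev s r)
      (ev (suffixMap s) ((if r % 2 = 0 then r else r + 1 : ℕ) : ℤ)) := by
  rw [Finset.sum_range]
  unfold disorder
  rw [Fintype.sum_prod_type]
  refine Finset.sum_congr rfl fun r _ => ?_
  unfold strictForm
  rw [Finset.sum_range]
  simp only [prefixSum_fin, ev_suffixMap_fin, Finset.sum_mul_sum, Fintype.sum_prod_type,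
    snake_lt_colOrder_gt_iff]
  rw [Finset.sum_comm (s := (Finset.univ : Finset (Fin L))) (t := (Finset.univ : Finset (Fin L)))]
  conv_rhs => rw [Finset.sum_comm]
  conv_lhs => rw [Finset.sum_comm]
  refine Finset.sum_congr rfl fun c _ => ?_
  rw [Finset.sum_comm]
  refine Finset.sum_congr rfl fun c' _ => ?_
  refine Finset.sum_congr rfl fun r' _ => ?_
  have e := ev_site s (r, c)
  simp only at e
  by_cases h1 : c < c'
  · simp only [h1, true_and, if_true, mul_ite, mul_zero, e]
  · simp only [h1, false_and, if_false, zero_mul]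

theorem implements_phase2 : Implements (phase2 L) id (fun s => ∑ m ∈ Finset.range L,
      (strictForm L (ev s (2 * m : ℕ)) (ev s (2 * m + 2 : ℕ)) +
        if 2 ≤ 2 * m then strictForm L (ev s (2 * m : ℕ)) (ev s (2 * m : ℕ)) else 0)) := by
  have h0 := implements_flatMap_filter_diagonal (p := fun r => decide (r % 4 = 0)) L
    fun k hk _ => implements_sweepA (L := L) (r := k) hk
  have h2 := implements_flatMap_filter_diagonal (p := fun r => decide (r % 4 = 2)) L
    fun k hk _ => implements_sweepA (L := L) (r := k) hk
  refine (h0.append h2).congr (fun _ => rfl) (fun s => ?_)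
  have hz : ∀ r : ℕ, L ≤ r → ev s (r : ℤ) = 0 := fun r hr => ev_row_eq_zero s (by omega)
  rw [← sum_range_even (f := fun r => strictForm L (ev s r) (ev s (r + 2 : ℕ)) +
    if 2 ≤ r then strictForm L (ev s r) (ev s r) else 0)]
  · rw [← Finset.sum_add_distrib]
    refine Finset.sum_congr rfl fun r _ => ?_
    -- The guard may be dropped, since a row off the grid is zero.
    have e : (if r + 2 < L then strictForm L (ev s r) (ev s ((r : ℤ) + 2)) else 0) =
        strictForm L (ev s r) (ev s (r + 2 : ℕ)) := by
      split_ifs with h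
      · push_cast; rfl
      · rw [hz (r + 2) (by omega), strictForm_zero_right]
    simp only [id, e, decide_eq_true_eq]
    generalize strictForm L (ev s r) (ev s (r + 2 : ℕ)) + (if 2 ≤ r then _ else _) = v
    rcases (by omega : r % 4 = 0 ∨ r % 4 = 1 ∨ r % 4 = 2 ∨ r % 4 = 3) with h | h | h | h
    · rw [if_pos h, if_neg (by omega), if_pos (by omega), add_zero]
    · rw [if_neg (by omega), if_neg (by omega), if_neg (by omega), add_zero]
    · rw [if_neg (by omega), if_pos (by omega), if_pos (by omega), zero_add]
    · rw [if_neg (by omega), if_neg (by omega), if_neg (by omega), add_zero]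
  · intro r hr
    simp [hz r hr, strictForm_zero_left]

theorem implements_phase45 : Implements (phase4 L ++ phase5 L) id (fun s => ∑ m ∈ Finset.range L,
      (strictForm L (ev s (2 * m : ℕ)) (ev s (2 * m + 1 : ℕ)) +
        strictForm L (ev s (2 * m : ℕ)) (ev s (2 * m : ℕ)))) := by
  have h4 := implements_flatMap_filter_diagonal (p := fun r => decide (r % 2 = 0 ∧ r + 1 < L)) L
    fun k hk _ => implements_pairSweep (L := L) (r := k) hk
  rw [← phase4_eq] at h4
  have h5 : Implements (phase5 L) id (fun s =>
      if L % 2 = 1 then strictForm L (ev s ((L : ℤ) - 1)) (ev s ((L : ℤ) - 1)) else 0) := by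
    unfold phase5
    split_ifs with h
    · exact implements_lastSweep (by omega) (by omega)
    · exact implements_nil
  refine (h4.append h5).congr (fun _ => rfl) (fun s => ?_)
  have hz : ∀ r : ℕ, L ≤ r → ev s (r : ℤ) = 0 := fun r hr => ev_row_eq_zero s (by omega)
  rw [← sum_range_even (f := fun r => strictForm L (ev s r) (ev s (r + 1 : ℕ)) +
    strictForm L (ev s r) (ev s r))]
  · simp only [id, decide_eq_true_eq]
    rcases Nat.eq_zero_or_pos L with rfl | hL
    · simp
    obtain ⟨n, rfl⟩ : ∃ n, L = n + 1 := ⟨L - 1, by omega⟩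
    rw [Finset.sum_range_succ, Finset.sum_range_succ, if_neg (by omega), add_zero]
    congr 1
    · refine Finset.sum_congr rfl fun r hr => ?_
      rw [Finset.mem_range] at hr
      simp only [show (r % 2 = 0 ∧ r + 1 < n + 1) ↔ r % 2 = 0 by omega]
      push_cast
      rfl
    -- The last row n: if L is odd it is an even row without a row below, and only its same-row term
    -- remains.
    · simp only [show (n + 1) % 2 = 1 ↔ n % 2 = 0 by omega]
      rw [hz (n + 1) (by omega), strictForm_zero_right, zero_add]
      push_cast
      rw [add_sub_cancel_right]
  · intro r hr
    simp [hz r hr, strictForm_zero_left]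

/-- `Γ` is the diagonal unitary that changes the snake order into the column order. -/
theorem implements_gammaCircuit : Implements (gammaCircuit L) id (disorder snake colOrder) := by
  have h := ((implements_phase1 (L := L)).append implements_phase2).append implements_phase3
    |>.append implements_phase45
  rw [gammaCircuit, List.append_assoc]
  refine h.congr (fun s => ?_) (fun s => ?_)
  · exact unsuffixMap_suffixMap s
  -- Phase 2 is evaluated at the suffix sums, phases 4 and 5 at the original state.
  · simp only [Function.comp, id, zero_add, add_zero, unsuffixMap_suffixMap]
    rw [sum_blocks, disorder_snake_colOrder, sum_range_pairs (f := fun r => strictForm L (ev s r)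
      (ev (suffixMap s) ((if r % 2 = 0 then r else r + 1 : ℕ) : ℤ)))]
    · refine Finset.sum_congr rfl fun m _ => ?_
      rw [if_pos (by omega), if_neg (by omega)]
    · intro r hr
      rw [ev_row_eq_zero s (by omega), strictForm_zero_left]

theorem modeOp_fiveStage {π : Equiv.Perm (Fin (L * L))} {ρA κ ρB : Equiv.Perm (Site L)}
    (h : IsRowColRowPlan π ρA κ ρB) : modeOp (fiveStage ρA κ ρB) = fermionicPerm π :=
  modeOp_eq_fermionicPerm (σ := ρB * κ * ρA) h.2.2.2
    (implements_row_col_row (implements_rowStage h.1) implements_gammaCircuit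
      (implements_colStage h.2.1) (implements_rowStage h.2.2.1))

/-! ### Schedules and depth -/

/-- The qubits on which a two-qubit gate acts. -/
def Gate.Touches : Gate L → Site L → Prop
  | .had _, _ => False
  | .z _, _ => False
  | .cnot p q, x => x = p ∨ x = q
  | .cz p q, x => x = p ∨ x = q

/-- The layers of the last two-qubit gates after executing `C`. -/
def layers (τ : Site L → ℕ) (C : Circuit L) : Site L → ℕ := C.foldl Gate.advance τ

theorem layers_cons (τ : Site L → ℕ) (g : Gate L) (C : Circuit L) :
    layers τ (g :: C) = layers (g.advance τ) C := rfl

theorem layers_append (τ : Site L → ℕ) (C D : Circuit L) :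
    layers τ (C ++ D) = layers (layers τ C) D := by
  simp [layers]

theorem advance_of_not_touches {g : Gate L} {x : Site L} (h : ¬ g.Touches x) (τ : Site L → ℕ) :
    g.advance τ x = τ x := by
  cases g <;> simp_all [Gate.advance, Gate.Touches]

theorem advance_le {g : Gate L} {x : Site L} {τ : Site L → ℕ} {t : ℕ} (hx : g.Touches x)
    (h : ∀ y, g.Touches y → τ y < t) : g.advance τ x ≤ t := by
  cases g with
  | had q => exact hx.elim
  | z q => exact hx.elim
  | cnot p q =>
    have hx' : x = p ∨ x = q := hx
    simp only [Gate.advance]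
    rw [if_pos hx']
    have h1 := h p (Or.inl rfl)
    have h2 := h q (Or.inr rfl)
    omega
  | cz p q =>
    have hx' : x = p ∨ x = q := hx
    simp only [Gate.advance]
    rw [if_pos hx']
    have h1 := h p (Or.inl rfl)
    have h2 := h q (Or.inr rfl)
    omega

theorem layers_of_not_touches {C : Circuit L} {x : Site L} (h : ∀ g ∈ C, ¬ g.Touches x)
    (τ : Site L → ℕ) : layers τ C x = τ x := by
  induction C generalizing τ with
  | nil => rfl
  | cons g C ih =>
    rw [layers_cons, ih fun g' hg' => h g' (by simp [hg']),
      advance_of_not_touches (h g (by simp))]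

/-- A valid schedule bounds the layers. -/
theorem layers_le_of_schedule {A : List (ℕ × Gate L)} {τ σ : Site L → ℕ}
    (hA : A.Pairwise fun y z => ∀ x, y.2.Touches x → z.2.Touches x → y.1 < z.1)
    (hτ : ∀ y ∈ A, ∀ x, y.2.Touches x → τ x < y.1 ∧ y.1 ≤ σ x) (h0 : ∀ x, τ x ≤ σ x) (x : Site L) :
    layers τ (A.map Prod.snd) x ≤ σ x := by
  induction A generalizing τ with
  | nil => exact h0 x
  | cons y A ih =>
    rw [List.pairwise_cons] at hA
    rw [List.map_cons, layers_cons]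
    have hy := hτ y (by simp)
    refine ih hA.2 ?_ ?_
    · intro z hz x hx
      refine ⟨?_, (hτ z (by simp [hz]) x hx).2⟩
      by_cases hyx : y.2.Touches x
      · exact lt_of_le_of_lt (advance_le hyx fun u hu => (hy u hu).1) (hA.1 z hz x hyx hx)
      · rw [advance_of_not_touches hyx]
        exact (hτ z (by simp [hz]) x hx).1
    · intro x
      by_cases hyx : y.2.Touches x
      · exact (advance_le hyx fun u hu => (hy u hu).1).trans (hy x hyx).2
      · rw [advance_of_not_touches hyx]
        exact h0 x

/-- Two gates with no qubit in common. -/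
def Gate.Apart (g g' : Gate L) : Prop := ∀ x, g.Touches x → ¬ g'.Touches x

/-- Circuits on disjoint regions run in parallel. -/
theorem layers_flatMap_le {ι : Type*} {f : ι → Circuit L} {S : ι → Site L → Prop}
    {α β : Site L → ℕ} {l : List ι} (hl : l.Pairwise fun a b => ∀ x, S a x → ¬ S b x)
    (hS : ∀ a ∈ l, ∀ g ∈ f a, ∀ x, g.Touches x → S a x)
    (hf : ∀ a ∈ l, ∀ τ : Site L → ℕ, (∀ x, S a x → τ x ≤ α x) →
      ∀ x, S a x → layers τ (f a) x ≤ β x)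
    {τ : Site L → ℕ} (hα : ∀ a ∈ l, ∀ x, S a x → τ x ≤ α x) (hβ : ∀ x, τ x ≤ β x) (x : Site L) :
    layers τ (l.flatMap f) x ≤ β x := by
  induction l generalizing τ with
  | nil => exact hβ x
  | cons a l ih =>
    rw [List.pairwise_cons] at hl
    rw [List.flatMap_cons, layers_append]
    have hout : ∀ x, ¬ S a x → layers τ (f a) x = τ x := fun x hx =>
      layers_of_not_touches (fun g hg h => hx (hS a (by simp) g hg x h)) τ
    refine ih hl.2 (fun b hb => hS b (by simp [hb])) (fun b hb => hf b (by simp [hb])) ?_ ?_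
    · intro b hb x hx
      rw [hout x fun h => hl.1 b hb x h hx]
      exact hα b (by simp [hb]) x hx
    · intro x
      by_cases hx : S a x
      · exact hf a (by simp) τ (hα a (by simp)) x hx
      · rw [hout x hx]
        exact hβ x

/-- The recursion uses only maxima and increments, so a delay of at most D at the start is a delay
of at most D at the end. -/
theorem layers_le_add {C : Circuit L} {τ τ' : Site L → ℕ} {D : ℕ} (h : ∀ x, τ x ≤ D + τ' x)
    (x : Site L) : layers τ C x ≤ D + layers τ' C x := by
  induction C generalizing τ τ' with
  | nil => exact h x
  | cons g C ih =>
    rw [layers_cons, layers_cons]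
    refine ih fun y => ?_
    cases g with
    | had q => exact h y
    | z q => exact h y
    | cnot p q =>
      have h1 := h p
      have h2 := h q
      have h3 := h y
      simp only [Gate.advance]
      split_ifs <;> omega
    | cz p q =>
      have h1 := h p
      have h2 := h q
      have h3 := h y
      simp only [Gate.advance]
      split_ifs <;> omega

theorem cnotDepth_le_iff {C : Circuit L} {D : ℕ} :
    cnotDepth C ≤ D ↔ ∀ x, layers (fun _ => 0) C x ≤ D := by
  simp only [cnotDepth, Finset.sup_le_iff, Finset.mem_univ, true_imp_iff]
  rfl

theorem cnotDepth_append_le (C D : Circuit L) :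
    cnotDepth (C ++ D) ≤ cnotDepth C + cnotDepth D := by
  rw [cnotDepth_le_iff]
  intro x
  rw [layers_append]
  refine (layers_le_add (τ' := fun _ => 0) (D := cnotDepth C) ?_ x).trans ?_
  · intro y
    exact cnotDepth_le_iff.1 le_rfl y
  · exact Nat.add_le_add_left (cnotDepth_le_iff.1 le_rfl x) _

/-! ### Gate counts -/

theorem gateCount_append (C D : Circuit L) : gateCount (C ++ D) = gateCount C + gateCount D := by
  simp [gateCount]

theorem gateCount_flatMap_le {ι : Type*} {f : ι → Circuit L} {l : List ι} {b : ℕ}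
    (h : ∀ a ∈ l, gateCount (f a) ≤ b) : gateCount (l.flatMap f) ≤ l.length * b := by
  induction l with
  | nil => simp [gateCount]
  | cons a l ih =>
    rw [List.flatMap_cons, gateCount_append, List.length_cons, Nat.succ_mul]
    have h1 := h a (by simp)
    have h2 := ih fun a' ha' => h a' (by simp [ha'])
    omega

/-- Each two-qubit gate raises the counters of two distinct qubits by at least one. This turns depth
bounds into gate counts. -/
theorem two_mul_gateCount_le {C : Circuit L} (hC : ∀ g ∈ C, g.NearestNeighbor)
    (τ : Site L → ℕ) : ∑ x, τ x + 2 * gateCount C ≤ ∑ x, layers τ C x := by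
  have two : ∀ (p q : Site L) (τ : Site L → ℕ), Adjacent p q →
      ∑ x, τ x + 2 ≤ ∑ x, if x = p ∨ x = q then max (τ p) (τ q) + 1 else τ x := by
    intro p q τ hpq
    have hne : p ≠ q := by
      rintro rfl
      simp [Adjacent] at hpq
    have : ∑ x, τ x + 2 = ∑ x, (τ x + if x = p ∨ x = q then 1 else 0) := by
      rw [Finset.sum_add_distrib, ← Finset.sum_filter, Finset.sum_const, smul_eq_mul, mul_one]
      congr 1
      have e : (Finset.univ.filter fun x => x = p ∨ x = q) = {p, q} := by
        ext x; simp
      rw [e, Finset.card_pair hne]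
    rw [this]
    refine Finset.sum_le_sum fun x _ => ?_
    split_ifs with h
    · rcases h with rfl | rfl <;> omega
    · omega
  induction C generalizing τ with
  | nil => simp [gateCount, layers]
  | cons g C ih =>
    have ih' := ih (fun g' hg' => hC g' (by simp [hg'])) (g.advance τ)
    have hg := hC g (by simp)
    rw [layers_cons]
    cases g with
    | had q => simpa [gateCount, Gate.isEntangling, Gate.advance] using ih'
    | z q => simpa [gateCount, Gate.isEntangling, Gate.advance] using ih'
    | cnot p q =>
      have := two p q τ hg
      have e : gateCount (Gate.cnot p q :: C) = gateCount C + 1 := by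
        rw [gateCount, List.countP_cons_of_pos rfl]
        rfl
      rw [e]
      simp only [Gate.advance] at ih' ⊢
      omega
    | cz p q =>
      have := two p q τ hg
      have e : gateCount (Gate.cz p q :: C) = gateCount C + 1 := by
        rw [gateCount, List.countP_cons_of_pos rfl]
        rfl
      rw [e]
      simp only [Gate.advance] at ih' ⊢
      omega

theorem two_mul_gateCount_le_depth {C : Circuit L} (hC : ∀ g ∈ C, g.NearestNeighbor) {D : ℕ}
    (hD : cnotDepth C ≤ D) : 2 * gateCount C ≤ L * L * D := by
  have h := two_mul_gateCount_le hC fun _ => 0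
  have h2 : ∑ x, layers (fun _ => 0) C x ≤ ∑ _x : Site L, D :=
    Finset.sum_le_sum fun x _ => cnotDepth_le_iff.1 hD x
  simp only [Finset.sum_const_zero, zero_add, Finset.sum_const, Finset.card_univ,
    Fintype.card_prod, Fintype.card_fin, smul_eq_mul] at h h2
  omega

/-! ### The sorting stages -/

theorem touches_fswap {p q x : Site L} {g : Gate L} (hg : g ∈ fswap p q) (hx : g.Touches x) :
    x = p ∨ x = q := by
  simp only [fswap, List.mem_cons, List.not_mem_nil, or_false] at hg
  rcases hg with rfl | rfl | rfl | rfl <;> simp only [Gate.Touches] at hx <;> tauto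

theorem layers_fswap (τ : Site L → ℕ) (p q x : Site L) :
    layers τ (fswap p q) x = if x = p ∨ x = q then max (τ p) (τ q) + 2 else τ x := by
  simp only [fswap, layers, List.foldl_cons, List.foldl_nil, Gate.advance]
  by_cases h1 : x = p
  · simp [h1, max_comm]
  · by_cases h2 : x = q
    · simp [h2, max_comm]
    · simp [h1, h2]

/-- The swaps of a round are disjoint, so each starts by layer T and adds its two CNOTs. -/
theorem layers_swaps_le {e : Fin L → Site L} (he : e.Injective) {T : ℕ} :
    ∀ {w : List (Fin L × Fin L)} (_ : w.Pairwise DisjointSwaps) {τ : Site L → ℕ}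
      (_ : ∀ p ∈ w, τ (e p.1) ≤ T ∧ τ (e p.2) ≤ T) (_ : ∀ i, τ (e i) ≤ T + 2) (i : Fin L),
      layers τ (w.flatMap fun p => fswap (e p.1) (e p.2)) (e i) ≤ T + 2
  | [], _, _, _, h, i => h i
  | p :: w, hw, τ, h1, h2, i => by
    rw [List.pairwise_cons] at hw
    rw [List.flatMap_cons, layers_append]
    have hp := h1 p (by simp)
    refine layers_swaps_le he hw.2 ?_ ?_ i
    · intro q hq
      obtain ⟨d1, d2, d3, d4⟩ := hw.1 q hq
      have hq' := h1 q (by simp [hq])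
      rw [layers_fswap, layers_fswap, if_neg, if_neg]
      · exact hq'
      · simp only [he.eq_iff, not_or]
        exact ⟨d2.symm, d4.symm⟩
      · simp only [he.eq_iff, not_or]
        exact ⟨d1.symm, d3.symm⟩
    · intro j
      rw [layers_fswap]
      have := h2 j
      split_ifs <;> omega

theorem layers_oetRounds_le {e : Fin L → Site L} (he : e.Injective) (n : ℕ) :
    ∀ {k T : ℕ} {a : Fin L → Fin L} {τ : Site L → ℕ}, (∀ i, τ (e i) ≤ T) → ∀ i,
      layers τ ((oetRounds n k a).flatMap fun p => fswap (e p.1) (e p.2)) (e i) ≤ T + 2 * n := by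
  induction n with
  | zero => intro k T a τ h i; exact h i
  | succ n ih =>
    intro k T a τ h i
    rw [oetRounds, List.flatMap_append, layers_append]
    have := ih (k := k + 1) (T := T + 2) (a := applySwaps a (oetRound k a))
      (layers_swaps_le he (pairwise_oetRound k a) (fun p _ => ⟨h _, h _⟩)
        fun i => (h i).trans (by omega)) i
    omega

theorem cnotDepth_lineStage_le {e : Fin L → Fin L → Site L}
    (he : ∀ j i j' i', e j i = e j' i' → j = j' ∧ i = i') (a : Fin L → Fin L → Fin L) :
    cnotDepth (lineStage e a) ≤ 2 * L := by
  rw [cnotDepth_le_iff]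
  refine layers_flatMap_le (S := fun j x => ∃ i, x = e j i) (α := fun _ => 0)
    (β := fun _ => 2 * L) ?_ ?_ ?_ (fun _ _ _ _ => le_rfl) (fun _ => Nat.zero_le _)
  · refine (List.nodup_finRange L).imp ?_
    rintro j j' hj x ⟨i, rfl⟩ ⟨i', h⟩
    exact hj (he _ _ _ _ h).1
  · intro j _ g hg x hx
    rw [List.mem_flatMap] at hg
    obtain ⟨p, _, hp⟩ := hg
    rcases touches_fswap hp hx with h | h
    · exact ⟨_, h⟩
    · exact ⟨_, h⟩
  · rintro j _ τ hτ x ⟨i, rfl⟩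
    have := layers_oetRounds_le (e := e j) (fun i i' h => (he _ _ _ _ h).2) L (k := 0) (T := 0)
      (a := a j) (fun i => hτ _ ⟨i, rfl⟩) i
    rwa [zero_add] at this

theorem cnotDepth_rowStage_le (ρ : Equiv.Perm (Site L)) : cnotDepth (rowStage ρ) ≤ 2 * L := by
  rw [rowStage_eq]
  exact cnotDepth_lineStage_le (fun j i j' i' h => ⟨congrArg Prod.fst h, congrArg Prod.snd h⟩) _

theorem cnotDepth_colStage_le (κ : Equiv.Perm (Site L)) : cnotDepth (colStage κ) ≤ 2 * L := by
  rw [colStage_eq]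
  exact cnotDepth_lineStage_le (fun j i j' i' h => ⟨congrArg Prod.snd h, congrArg Prod.fst h⟩) _

theorem nearestNeighbor_lineStage {e : Fin L → Fin L → Site L} {a : Fin L → Fin L → Fin L}
    (he : ∀ j (i i' : Fin L), i'.val = i.val + 1 →
      Adjacent (e j i) (e j i') ∧ Adjacent (e j i') (e j i))
    {g : Gate L} (hg : g ∈ lineStage e a) : g.NearestNeighbor := by
  simp only [lineStage, List.mem_flatMap] at hg
  obtain ⟨j, _, p, hp, hg⟩ := hg
  have h := he j p.1 p.2 (mem_oetRounds hp)
  simp only [fswap, List.mem_cons, List.not_mem_nil, or_false] at hg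
  rcases hg with rfl | rfl | rfl | rfl
  · trivial
  · exact h.2
  · exact h.1
  · trivial

theorem nearestNeighbor_rowStage {ρ : Equiv.Perm (Site L)} {g : Gate L} (hg : g ∈ rowStage ρ) :
    g.NearestNeighbor := by
  rw [rowStage_eq] at hg
  refine nearestNeighbor_lineStage (fun j i i' h => ?_) hg
  simp only [Adjacent]
  omega

theorem nearestNeighbor_colStage {κ : Equiv.Perm (Site L)} {g : Gate L} (hg : g ∈ colStage κ) :
    g.NearestNeighbor := by
  rw [colStage_eq] at hg
  refine nearestNeighbor_lineStage (fun j i i' h => ?_) hg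
  simp only [Adjacent]
  omega

/-! ### The depth of sweeps -/

/-- The two-qubit gate `g` acts on the sites `(a, b)` and `(c, d)` of the grid. -/
def Gate.On (g : Gate L) (a b c d : ℤ) : Prop :=
  (0 ≤ a ∧ a < L ∧ 0 ≤ b ∧ b < L ∧ 0 ≤ c ∧ c < L ∧ 0 ≤ d ∧ d < L) ∧
    ∀ x, g.Touches x → (x.1.val : ℤ) = a ∧ (x.2.val : ℤ) = b ∨ (x.1.val : ℤ) = c ∧ (x.2.val : ℤ) = d

theorem mem_cnotAt {g : Gate L} {a b c d : ℤ} (hg : g ∈ cnotAt L a b c d) :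
    ∃ p q : Site L, g = .cnot p q ∧ ((p.1.val : ℤ) = a ∧ (p.2.val : ℤ) = b) ∧
      ((q.1.val : ℤ) = c ∧ (q.2.val : ℤ) = d) := by
  unfold cnotAt at hg
  rcases site?_cases L a b with ⟨p, hp, hp'⟩ | ⟨hp, _⟩
  · rcases site?_cases L c d with ⟨q, hq, hq'⟩ | ⟨hq, _⟩
    · simp only [hp, hq, List.mem_singleton] at hg
      exact ⟨p, q, hg, hp', hq'⟩
    · simp [hp, hq] at hg
  · simp [hp] at hg

theorem mem_czAt {g : Gate L} {a b c d : ℤ} (hg : g ∈ czAt L a b c d) :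
    ∃ p q : Site L, g = .cz p q ∧ ((p.1.val : ℤ) = a ∧ (p.2.val : ℤ) = b) ∧
      ((q.1.val : ℤ) = c ∧ (q.2.val : ℤ) = d) := by
  unfold czAt at hg
  rcases site?_cases L a b with ⟨p, hp, hp'⟩ | ⟨hp, _⟩
  · rcases site?_cases L c d with ⟨q, hq, hq'⟩ | ⟨hq, _⟩
    · simp only [hp, hq, List.mem_singleton] at hg
      exact ⟨p, q, hg, hp', hq'⟩
    · simp [hp, hq] at hg
  · simp [hp] at hg

theorem on_cnotAt {g : Gate L} {a b c d : ℤ} (hg : g ∈ cnotAt L a b c d) : g.On a b c d := by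
  obtain ⟨p, q, rfl, ⟨rfl, rfl⟩, rfl, rfl⟩ := mem_cnotAt hg
  refine ⟨by omega, ?_⟩
  rintro x (rfl | rfl)
  · exact Or.inl ⟨rfl, rfl⟩
  · exact Or.inr ⟨rfl, rfl⟩

theorem on_czAt {g : Gate L} {a b c d : ℤ} (hg : g ∈ czAt L a b c d) : g.On a b c d := by
  obtain ⟨p, q, rfl, ⟨rfl, rfl⟩, rfl, rfl⟩ := mem_czAt hg
  refine ⟨by omega, ?_⟩
  rintro x (rfl | rfl)
  · exact Or.inl ⟨rfl, rfl⟩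
  · exact Or.inr ⟨rfl, rfl⟩

theorem pairwise_cnotAt (R : Gate L → Gate L → Prop) (a b c d : ℤ) :
    (cnotAt L a b c d).Pairwise R := by
  unfold cnotAt
  split <;> simp

theorem pairwise_czAt (R : Gate L → Gate L → Prop) (a b c d : ℤ) :
    (czAt L a b c d).Pairwise R := by
  unfold czAt
  split <;> simp

theorem not_touches_gZ {r c : ℤ} {g : Gate L} (hg : g ∈ gZ L r c) (x : Site L) :
    ¬ g.Touches x := by
  unfold gZ at hg
  split_ifs at hg
  · unfold zAt at hg
    split at hg
    · rw [List.mem_singleton] at hg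
      subst hg
      exact id
    · simp at hg
  · simp at hg

/-- A circuit of successive steps, each with gates on disjoint qubits, is bounded by a schedule
that assigns to each gate of step `k` the time `T k g`. -/
theorem layers_steps_le {n : ℕ} {K R : ℕ → Circuit L} {S T : ℕ → Gate L → ℕ} {τ σ : Site L → ℕ}
    (hK : ∀ k < n, (K k).Pairwise Gate.Apart) (hR : ∀ k < n, (R k).Pairwise Gate.Apart)
    (hKR : ∀ k < n, ∀ g ∈ K k, ∀ g' ∈ R k, g.Apart g')
    (hlt : ∀ i j, i < j → j < n → ∀ x,
      (∀ g ∈ K i, g.Touches x → (∀ g' ∈ K j, g'.Touches x → S i g < S j g') ∧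
        (∀ g' ∈ R j, g'.Touches x → S i g < T j g')) ∧
      (∀ g ∈ R i, g.Touches x → (∀ g' ∈ K j, g'.Touches x → T i g < S j g') ∧
        (∀ g' ∈ R j, g'.Touches x → T i g < T j g')))
    (hKτ : ∀ k < n, ∀ g ∈ K k, ∀ x, g.Touches x → τ x < S k g ∧ S k g ≤ σ x)
    (hRτ : ∀ k < n, ∀ g ∈ R k, ∀ x, g.Touches x → τ x < T k g ∧ T k g ≤ σ x)
    (h0 : ∀ x, τ x ≤ σ x) (x : Site L) :
    layers τ ((List.range n).flatMap fun k => K k ++ R k) x ≤ σ x := by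
  have e : ((List.range n).flatMap fun k => K k ++ R k) = ((List.range n).flatMap fun k =>
      ((K k).map fun g => (S k g, g)) ++ ((R k).map fun g => (T k g, g))).map Prod.snd := by
    simp [List.map_flatMap, List.map_map, Function.comp_def]
  rw [e]
  refine layers_le_of_schedule ?_ ?_ h0 x
  · rw [List.pairwise_flatMap]
    constructor
    · intro k hk
      rw [List.mem_range] at hk
      rw [List.pairwise_append]
      refine ⟨?_, ?_, ?_⟩
      · rw [List.pairwise_map]
        exact (hK k hk).imp fun h x h1 h2 => absurd h2 (h x h1)
      · rw [List.pairwise_map]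
        exact (hR k hk).imp fun h x h1 h2 => absurd h2 (h x h1)
      · simp only [List.mem_map]
        rintro _ ⟨g, hg, rfl⟩ _ ⟨g', hg', rfl⟩ x h1 h2
        exact absurd h2 (hKR k hk g hg g' hg' x h1)
    · have hpw : (List.range n).Pairwise fun i j => i < j ∧ j < n := by
        refine List.Pairwise.imp_of_mem ?_ (List.pairwise_lt_range (n := n))
        intro i j _ hj hij
        exact ⟨hij, List.mem_range.1 hj⟩
      refine hpw.imp ?_
      rintro i j ⟨hij, hj⟩ y hy z hz x hyx hzx
      have h := hlt i j hij hj x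
      simp only [List.mem_append, List.mem_map] at hy hz
      rcases hy with ⟨g, hg, rfl⟩ | ⟨g, hg, rfl⟩ <;> rcases hz with ⟨g', hg', rfl⟩ | ⟨g', hg', rfl⟩
      · exact (h.1 g hg hyx).1 g' hg' hzx
      · exact (h.1 g hg hyx).2 g' hg' hzx
      · exact (h.2 g hg hyx).1 g' hg' hzx
      · exact (h.2 g hg hyx).2 g' hg' hzx
  · intro y hy x hx
    simp only [List.mem_flatMap, List.mem_append, List.mem_map, List.mem_range] at hy
    rcases hy with ⟨k, hk, ⟨g, hg, rfl⟩ | ⟨g, hg, rfl⟩⟩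
    · exact hKτ k hk g hg x hx
    · exact hRτ k hk g hg x hx

/-- The cascade gate of step k is scheduled in layer A + 1 + k, the trailing gates of step k one
layer earlier. This is admissible because in row r they stay at least two columns behind: a cascade
gate i on such a column has i ≤ k - 2. -/
theorem layers_forward_le {r w : ℤ} (hw : 0 ≤ w) {A B n : ℕ} {R : ℕ → Circuit L}
    (hB : L ≤ B + 1) (hR : ∀ k, (R k).Pairwise Gate.Apart)
    (hx : ∀ k, ∀ g ∈ R k, ∀ x, g.Touches x → r ≤ x.1.val ∧ (x.1.val : ℤ) ≤ r + w ∧ 1 ≤ k ∧ k ≤ B ∧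
      ((x.1.val : ℤ) = r → x.2.val + 2 ≤ k))
    {τ : Site L → ℕ} (hτ : ∀ x : Site L, r ≤ x.1.val ∧ (x.1.val : ℤ) ≤ r + w → τ x ≤ A)
    (x : Site L) (hrow : r ≤ x.1.val ∧ (x.1.val : ℤ) ≤ r + w) :
    layers τ ((List.range n).flatMap fun k : ℕ => cnotAt L r k r (k + 1) ++ R k) x ≤ A + B := by
  have key := layers_steps_le (n := n) (K := fun k : ℕ => cnotAt L r k r (k + 1)) (R := R)
    (S := fun k _ => A + 1 + k) (T := fun k _ => A + k) (τ := τ)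
    (σ := fun x => if r ≤ x.1.val ∧ (x.1.val : ℤ) ≤ r + w then A + B else τ x)
    (fun k _ => pairwise_cnotAt _ _ _ _ _) (fun k _ => hR k) ?_ ?_ ?_ ?_ ?_ x
  · rwa [if_pos hrow] at key
  · intro k _ g hg g' hg' y hy hy'
    have h1 := (on_cnotAt hg).2 y hy
    have h2 := hx k g' hg' y hy'
    omega
  · intro i j hij _ y
    refine ⟨fun g hg hy => ⟨fun g' _ _ => by omega, fun g' hg' hy' => ?_⟩,
      fun g _ _ => ⟨fun g' _ _ => by omega, fun g' _ _ => by omega⟩⟩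
    have h1 := (on_cnotAt hg).2 y hy
    have h2 := hx j g' hg' y hy'
    omega
  · intro k _ g hg y hy
    have h0 := (on_cnotAt hg).1
    have h1 := (on_cnotAt hg).2 y hy
    have hr : r ≤ y.1.val ∧ (y.1.val : ℤ) ≤ r + w := by omega
    have h2 := hτ y hr
    rw [if_pos hr]
    omega
  · intro k _ g hg y hy
    have h1 := hx k g hg y hy
    have hr : r ≤ y.1.val ∧ (y.1.val : ℤ) ≤ r + w := ⟨h1.1, h1.2.1⟩
    have h2 := hτ y hr
    rw [if_pos hr]
    omega
  · intro y
    split_ifs with h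
    · exact (hτ y h).trans (by omega)
    · exact le_rfl

open Classical in
-- A column x > 0 is last used by cascade step L - 1 - x, and trailing gates may follow at the very
-- next step, so they need layer A + 1 + k. Column 0 is used only by step L - 2, while its row-r
-- gates come at step L or later; scheduling column 0 in layer A + k saves the final layer of the
-- sweep.
theorem layers_undo_le {r w : ℤ} (hw : 0 ≤ w) {A B n : ℕ} {R : ℕ → Circuit L}
    (hB : L ≤ B + 1) (hR : ∀ k, (R k).Pairwise Gate.Apart)
    (hx : ∀ k, ∀ g ∈ R k, ∀ x, g.Touches x → (r ≤ x.1.val ∧ (x.1.val : ℤ) ≤ r + w) ∧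
      ((x.1.val : ℤ) = r → L ≤ x.2.val + k) ∧ (∀ y, g.Touches y → y.2 = x.2) ∧
      (x.2.val = 0 → 1 ≤ k ∧ k ≤ B) ∧ (x.2.val ≠ 0 → k + 1 ≤ B))
    {τ : Site L → ℕ} (hτ : ∀ x : Site L, r ≤ x.1.val ∧ (x.1.val : ℤ) ≤ r + w → τ x ≤ A)
    (x : Site L) (hrow : r ≤ x.1.val ∧ (x.1.val : ℤ) ≤ r + w) :
    layers τ ((List.range n).flatMap fun k : ℕ =>
      cnotAt L r ((L : ℤ) - 2 - k) r ((L : ℤ) - 2 - k + 1) ++ R k) x ≤ A + B := by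
  have hT : ∀ k, ∀ g ∈ R k, ∀ x, g.Touches x →
      (if ∃ y, g.Touches y ∧ y.2.val = 0 then A + k else A + 1 + k) =
        if x.2.val = 0 then A + k else A + 1 + k := by
    intro k g hg x hgx
    have e : (∃ y, g.Touches y ∧ y.2.val = 0) ↔ x.2.val = 0 := by
      constructor
      · rintro ⟨y, hy, h0⟩
        rw [← (hx k g hg x hgx).2.2.1 y hy]
        exact h0
      · exact fun h => ⟨x, hgx, h⟩
    simp only [e]
  have key := layers_steps_le (n := n)
    (K := fun k : ℕ => cnotAt L r ((L : ℤ) - 2 - k) r ((L : ℤ) - 2 - k + 1)) (R := R)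
    (S := fun k _ => A + 1 + k)
    (T := fun k g => if ∃ y, g.Touches y ∧ y.2.val = 0 then A + k else A + 1 + k) (τ := τ)
    (σ := fun x => if r ≤ x.1.val ∧ (x.1.val : ℤ) ≤ r + w then A + B else τ x)
    (fun k _ => pairwise_cnotAt _ _ _ _ _) (fun k _ => hR k) ?_ ?_ ?_ ?_ ?_ x
  · rwa [if_pos hrow] at key
  · intro k _ g hg g' hg' y hy hy'
    have h1 := (on_cnotAt hg).2 y hy
    have h2 := (hx k g' hg' y hy').2.1
    omega
  · intro i j hij _ y
    refine ⟨fun g hg hy => ⟨fun g' _ _ => by omega, fun g' hg' hy' => ?_⟩,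
      fun g hg hy => ⟨fun g' _ _ => ?_, fun g' hg' hy' => ?_⟩⟩
    · rw [hT j g' hg' y hy']
      have h0 := (on_cnotAt hg).1
      have h1 := (on_cnotAt hg).2 y hy
      have h2 := (hx j g' hg' y hy').2.1
      split_ifs <;> omega
    · rw [hT i g hg y hy]
      split_ifs <;> omega
    · rw [hT i g hg y hy, hT j g' hg' y hy']
      split_ifs <;> omega
  · intro k _ g hg y hy
    have h0 := (on_cnotAt hg).1
    have h1 := (on_cnotAt hg).2 y hy
    have hr : r ≤ y.1.val ∧ (y.1.val : ℤ) ≤ r + w := by omega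
    have h2 := hτ y hr
    rw [if_pos hr]
    omega
  · intro k _ g hg y hy
    have h1 := hx k g hg y hy
    have h2 := hτ y h1.1
    rw [if_pos h1.1, hT k g hg y hy]
    have h3 := h1.2.2.2
    split_ifs with h
    · have := h3.1 h
      omega
    · have := h3.2 h
      omega
  · intro y
    split_ifs with h
    · exact (hτ y h).trans (by omega)
    · exact le_rfl

theorem layers_pipeSweep_le {r w : ℤ} (hw : 0 ≤ w) {A B B' : ℕ}
    {F F' U U' : List (ℤ × Gadget L)} (hB : L ≤ B + 1) (hB' : L ≤ B' + 1)
    (hF : ∀ t, (trail F t ++ trail F' t).Pairwise Gate.Apart)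
    (hU : ∀ t, (trail U t ++ trail U' t).Pairwise Gate.Apart)
    (hFx : ∀ k : ℕ, ∀ g ∈ trail F k ++ trail F' k, ∀ x, g.Touches x →
      r ≤ x.1.val ∧ (x.1.val : ℤ) ≤ r + w ∧ 1 ≤ k ∧ k ≤ B ∧
      ((x.1.val : ℤ) = r → x.2.val + 2 ≤ k))
    (hUx : ∀ k : ℕ, ∀ g ∈ trail U ((L : ℤ) - 2 - k) ++ trail U' ((L : ℤ) - 2 - k), ∀ x,
      g.Touches x → (r ≤ x.1.val ∧ (x.1.val : ℤ) ≤ r + w) ∧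
      ((x.1.val : ℤ) = r → L ≤ x.2.val + k) ∧ (∀ y, g.Touches y → y.2 = x.2) ∧
      (x.2.val = 0 → 1 ≤ k ∧ k ≤ B') ∧ (x.2.val ≠ 0 → k + 1 ≤ B'))
    {τ : Site L → ℕ} (hτ : ∀ x : Site L, r ≤ x.1.val ∧ (x.1.val : ℤ) ≤ r + w → τ x ≤ A)
    (x : Site L) (hrow : r ≤ x.1.val ∧ (x.1.val : ℤ) ≤ r + w) :
    layers τ (pipeSweep L r (F ++ F') (U ++ U')) x ≤ A + B + B' := by
  rw [pipeSweep_eq, layers_append]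
  simp only [sweepStep_eq]
  exact layers_undo_le hw hB' (fun k => hU _) hUx
    (layers_forward_le hw hB (fun k => hF _) hFx hτ) x hrow

theorem mem_gSkip {r e c : ℤ} {g : Gate L} (hg : g ∈ gSkip L r e c) :
    g.On (r + 1) c (r + 2) c ∨ g.On r (c + e) (r + 1) (c + e) ∨
      g.On (r + 1) (c + 2 * e) (r + 2) (c + 2 * e) ∨ g.On r (c + 3 * e) (r + 1) (c + 3 * e) := by
  simp only [gSkip, List.mem_append] at hg
  rcases hg with ((hg | hg) | hg) | hg
  · exact Or.inl (on_czAt hg)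
  · exact Or.inr (Or.inl (on_cnotAt hg))
  · exact Or.inr (Or.inr (Or.inl (on_czAt hg)))
  · exact Or.inr (Or.inr (Or.inr (on_cnotAt hg)))

theorem Gate.On.apart {g g' : Gate L} {a b c d a' b' c' d' : ℤ} (h : g.On a b c d)
    (h' : g'.On a' b' c' d') (h1 : ¬ (a = a' ∧ b = b')) (h2 : ¬ (a = c' ∧ b = d'))
    (h3 : ¬ (c = a' ∧ d = b')) (h4 : ¬ (c = c' ∧ d = d')) : g.Apart g' := by
  intro x hx hx'
  have u := h.2 x hx
  have v := h'.2 x hx'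
  omega

theorem pairwise_gSkip {r e c : ℤ} (he : e ≠ 0) :
    (gSkip L r e c).Pairwise Gate.Apart := by
  unfold gSkip
  rw [List.pairwise_append, List.pairwise_append, List.pairwise_append]
  refine ⟨⟨⟨pairwise_czAt _ _ _ _ _, pairwise_cnotAt _ _ _ _ _, ?_⟩, pairwise_czAt _ _ _ _ _, ?_⟩,
    pairwise_cnotAt _ _ _ _ _, ?_⟩
  · intro g hg g' hg'
    exact (on_czAt hg).apart (on_cnotAt hg') (by omega) (by omega) (by omega) (by omega)
  · intro g hg g' hg'
    rcases List.mem_append.1 hg with hg | hg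
    · exact (on_czAt hg).apart (on_czAt hg') (by omega) (by omega) (by omega) (by omega)
    · exact (on_cnotAt hg).apart (on_czAt hg') (by omega) (by omega) (by omega) (by omega)
  · intro g hg g' hg'
    rcases List.mem_append.1 hg with hg | hg
    · rcases List.mem_append.1 hg with hg | hg
      · exact (on_czAt hg).apart (on_cnotAt hg') (by omega) (by omega) (by omega) (by omega)
      · exact (on_cnotAt hg).apart (on_cnotAt hg') (by omega) (by omega) (by omega) (by omega)
    · exact (on_czAt hg).apart (on_cnotAt hg') (by omega) (by omega) (by omega) (by omega)

theorem pairwise_gZ (r c : ℤ) : (gZ L r c).Pairwise Gate.Apart := by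
  unfold gZ zAt
  split_ifs
  · split <;> simp
  · simp

theorem pairwise_ite {c : Prop} [Decidable c] {C : Circuit L} (h : C.Pairwise Gate.Apart) :
    (if c then C else []).Pairwise Gate.Apart := by
  split_ifs
  · exact h
  · exact List.Pairwise.nil

theorem mem_ite_nil {c : Prop} [Decidable c] {C : Circuit L} {g : Gate L}
    (h : g ∈ if c then C else []) : c ∧ g ∈ C := by
  split_ifs at h with hc
  · exact ⟨hc, h⟩
  · simp at h

theorem snd_eq_of_on {g : Gate L} {a b c : ℤ} (h : g.On a b c b) {x y : Site L}
    (hx : g.Touches x) (hy : g.Touches y) : y.2 = x.2 := by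
  have u := h.2 x hx
  have v := h.2 y hy
  exact Fin.ext (by omega)

/-- The constants are the steps at which the last trailing gate leaves the grid: L + 3 for the last
skip gate and L + 4 for the neighbour CZ of the forward leg, L + 2 for the last skip gate of the
undo leg in column 0. -/
theorem layers_sweepA_le {r A : ℕ} {τ : Site L → ℕ}
    (hτ : ∀ x : Site L, (r : ℤ) ≤ x.1.val ∧ (x.1.val : ℤ) ≤ (r : ℤ) + 2 → τ x ≤ A)
    (x : Site L) (hrow : (r : ℤ) ≤ x.1.val ∧ (x.1.val : ℤ) ≤ (r : ℤ) + 2) :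
    layers τ (sweepA L r) x ≤ A + (L + if 2 ≤ r then 4 else 3) + (L + 2) := by
  refine layers_pipeSweep_le (by omega) (by omega) (by omega) ?_ ?_ ?_ ?_ hτ x hrow
  · intro t
    rw [trail_ite, trail_ite, List.pairwise_append]
    refine ⟨pairwise_ite (pairwise_gSkip (by omega)), pairwise_ite (pairwise_czAt _ _ _ _ _), ?_⟩
    intro g hg g' hg' y hy hy'
    have h' := (on_czAt (mem_ite_nil hg').2).2 y hy'
    rcases mem_gSkip (mem_ite_nil hg).2 with h | h | h | h <;>
      have h'' := h.2 y hy <;> omega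
  · intro t
    rw [trail_ite, trail_ite, List.pairwise_append]
    refine ⟨pairwise_ite (pairwise_gSkip (by omega)), pairwise_ite (pairwise_gZ _ _), ?_⟩
    intro g _ g' hg' y _
    exact not_touches_gZ (mem_ite_nil hg').2 y
  · intro k g hg y hy
    rw [trail_ite, trail_ite] at hg
    rcases List.mem_append.1 hg with hg | hg
    · rcases mem_gSkip (mem_ite_nil hg).2 with h | h | h | h <;>
      · have h0 := h.1
        have h1 := h.2 y hy
        split_ifs <;> omega
    · obtain ⟨h2, hg⟩ := mem_ite_nil hg
      have h0 := (on_czAt hg).1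
      have h1 := (on_czAt hg).2 y hy
      rw [if_pos h2]
      omega
  · intro k g hg y hy
    rw [trail_ite, trail_ite] at hg
    rcases List.mem_append.1 hg with hg | hg
    · rcases mem_gSkip (mem_ite_nil hg).2 with h | h | h | h <;>
      · have h0 := h.1
        have h1 := h.2 y hy
        refine ⟨by omega, by omega, fun z hz => snd_eq_of_on h hy hz, by omega, by omega⟩
    · exact absurd hy (not_touches_gZ (mem_ite_nil hg).2 y)

/-- The neighbour CZ reaches column L - 1 at step L + 2, and the undo cross CZ reaches column 0 at
step L. -/
theorem layers_pairSweep_le {r A : ℕ} {τ : Site L → ℕ}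
    (hτ : ∀ x : Site L, (r : ℤ) ≤ x.1.val ∧ (x.1.val : ℤ) ≤ (r : ℤ) + 1 → τ x ≤ A)
    (x : Site L) (hrow : (r : ℤ) ≤ x.1.val ∧ (x.1.val : ℤ) ≤ (r : ℤ) + 1) :
    layers τ (pipeSweep L r [(-2, gCross L r), (-3, gSame L r)] [(2, gCross L r), (3, gZ L r)]) x ≤
      A + (L + 2) + L := by
  refine layers_pipeSweep_le (F := [(-2, gCross L r)]) (F' := [(-3, gSame L r)])
    (U := [(2, gCross L r)]) (U' := [(3, gZ L r)]) (by omega) (by omega) (by omega)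
    ?_ ?_ ?_ ?_ hτ x hrow
  · intro t
    rw [trail_singleton, trail_singleton, List.pairwise_append]
    refine ⟨pairwise_czAt _ _ _ _ _, pairwise_czAt _ _ _ _ _, ?_⟩
    intro g hg g' hg'
    exact (on_czAt hg).apart (on_czAt hg') (by omega) (by omega) (by omega) (by omega)
  · intro t
    rw [trail_singleton, trail_singleton, List.pairwise_append]
    refine ⟨pairwise_czAt _ _ _ _ _, pairwise_gZ _ _, ?_⟩
    intro g _ g' hg' y _
    exact not_touches_gZ hg' y
  · intro k g hg y hy
    rw [trail_singleton, trail_singleton] at hg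
    rcases List.mem_append.1 hg with hg | hg
    · have h0 := (on_czAt hg).1
      have h1 := (on_czAt hg).2 y hy
      omega
    · have h0 := (on_czAt hg).1
      have h1 := (on_czAt hg).2 y hy
      omega
  · intro k g hg y hy
    rw [trail_singleton, trail_singleton] at hg
    rcases List.mem_append.1 hg with hg | hg
    · have h0 := (on_czAt hg).1
      have h1 := (on_czAt hg).2 y hy
      exact ⟨by omega, by omega, fun z hz => snd_eq_of_on (on_czAt hg) hy hz, by omega, by omega⟩
    · exact absurd hy (not_touches_gZ hg y)

theorem layers_lastSweep_le {r : ℤ} {A : ℕ} {τ : Site L → ℕ}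
    (hτ : ∀ x : Site L, r ≤ x.1.val ∧ (x.1.val : ℤ) ≤ r + 0 → τ x ≤ A)
    (x : Site L) (hrow : r ≤ x.1.val ∧ (x.1.val : ℤ) ≤ r + 0) :
    layers τ (pipeSweep L r [(-3, gSame L r)] [(3, gZ L r)]) x ≤ A + (L + 2) + L := by
  refine layers_pipeSweep_le (F := []) (F' := [(-3, gSame L r)])
    (U := []) (U' := [(3, gZ L r)]) (by omega) (by omega) (by omega) ?_ ?_ ?_ ?_ hτ x hrow
  · intro t
    rw [trail_singleton, trail_nil, List.nil_append]
    exact pairwise_czAt _ _ _ _ _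
  · intro t
    rw [trail_singleton, trail_nil, List.nil_append]
    exact pairwise_gZ _ _
  · intro k g hg y hy
    rw [trail_singleton, trail_nil, List.nil_append] at hg
    have h0 := (on_czAt hg).1
    have h1 := (on_czAt hg).2 y hy
    omega
  · intro k g hg y hy
    rw [trail_singleton, trail_nil, List.nil_append] at hg
    exact absurd hy (not_touches_gZ hg y)

/-! ### The gates of `Γ` -/

theorem forall_mem_pipeSweep {P : Gate L → Prop} {r : ℤ} {F U : List (ℤ × Gadget L)}
    (hr : ∀ t, ∀ g ∈ cnotAt L r t r (t + 1), P g) (hF : ∀ p ∈ F, ∀ c, ∀ g ∈ p.2 c, P g)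
    (hU : ∀ p ∈ U, ∀ c, ∀ g ∈ p.2 c, P g) : ∀ g ∈ pipeSweep L r F U, P g := by
  have step : ∀ G : List (ℤ × Gadget L), (∀ p ∈ G, ∀ c, ∀ g ∈ p.2 c, P g) →
      ∀ t, ∀ g ∈ sweepStep L r G t, P g := by
    intro G hG t g hg
    rw [sweepStep, List.mem_append, List.mem_flatMap] at hg
    rcases hg with hg | ⟨p, hp, hg⟩
    · exact hr t g (mem_ite_nil hg).2
    · exact hG p hp _ g hg
  intro g hg
  rw [pipeSweep_eq, List.mem_append, List.mem_flatMap, List.mem_flatMap] at hg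
  rcases hg with ⟨k, _, hg⟩ | ⟨k, _, hg⟩
  · exact step F hF _ g hg
  · exact step U hU _ g hg

/-- A gate on neighbouring sites in the rows `a, …, b`. -/
def Gate.WithinRows (a b : ℤ) (g : Gate L) : Prop :=
  g.NearestNeighbor ∧ ∀ x, g.Touches x → a ≤ x.1.val ∧ (x.1.val : ℤ) ≤ b

theorem adjacent_of_coords {p q : Site L} {r c r' c' : ℤ}
    (hp : (p.1.val : ℤ) = r ∧ (p.2.val : ℤ) = c) (hq : (q.1.val : ℤ) = r' ∧ (q.2.val : ℤ) = c')
    (h : (r - r').natAbs + (c - c').natAbs = 1) : Adjacent p q := by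
  unfold Adjacent
  rwa [hp.1, hp.2, hq.1, hq.2]

theorem withinRows_cnotAt {a b r c r' c' : ℤ} (h : (r - r').natAbs + (c - c').natAbs = 1)
    (hr : a ≤ r ∧ r ≤ b) (hr' : a ≤ r' ∧ r' ≤ b) :
    ∀ g ∈ cnotAt L r c r' c', g.WithinRows a b := by
  intro g hg
  refine ⟨?_, fun x hx => ?_⟩
  · obtain ⟨p, q, rfl, hp, hq⟩ := mem_cnotAt hg
    exact adjacent_of_coords hp hq h
  · have := (on_cnotAt hg).2 x hx
    omega

theorem withinRows_czAt {a b r c r' c' : ℤ} (h : (r - r').natAbs + (c - c').natAbs = 1)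
    (hr : a ≤ r ∧ r ≤ b) (hr' : a ≤ r' ∧ r' ≤ b) :
    ∀ g ∈ czAt L r c r' c', g.WithinRows a b := by
  intro g hg
  refine ⟨?_, fun x hx => ?_⟩
  · obtain ⟨p, q, rfl, hp, hq⟩ := mem_czAt hg
    exact adjacent_of_coords hp hq h
  · have := (on_czAt hg).2 x hx
    omega

theorem withinRows_gZ (a b r c : ℤ) : ∀ g ∈ gZ L r c, g.WithinRows a b := by
  intro g hg
  refine ⟨?_, fun x hx => absurd hx (not_touches_gZ hg x)⟩
  have hg' := (mem_ite_nil hg).2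
  unfold zAt at hg'
  split at hg'
  · rw [List.mem_singleton] at hg'
    subst hg'
    trivial
  · simp at hg'

theorem withinRows_gSkip (r e c : ℤ) : ∀ g ∈ gSkip L r e c, g.WithinRows r (r + 2) := by
  intro g hg
  simp only [gSkip, List.mem_append] at hg
  rcases hg with ((hg | hg) | hg) | hg
  · exact withinRows_czAt (by omega) (by omega) (by omega) g hg
  · exact withinRows_cnotAt (by omega) (by omega) (by omega) g hg
  · exact withinRows_czAt (by omega) (by omega) (by omega) g hg
  · exact withinRows_cnotAt (by omega) (by omega) (by omega) g hg

theorem withinRows_gSame {r b : ℤ} (hb : r ≤ b) (c : ℤ) :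
    ∀ g ∈ gSame L r c, g.WithinRows r b :=
  withinRows_czAt (by omega) (by omega) (by omega)

theorem withinRows_gCross (r c : ℤ) : ∀ g ∈ gCross L r c, g.WithinRows r (r + 1) :=
  withinRows_czAt (by omega) (by omega) (by omega)

theorem withinRows_sweepA (r : ℕ) : ∀ g ∈ sweepA L r, g.WithinRows r (r + 2) := by
  refine forall_mem_pipeSweep (fun t => withinRows_cnotAt (by omega) (by omega) (by omega)) ?_ ?_
  · intro p hp c
    rcases List.mem_append.1 hp with hp | hp
    · split_ifs at hp
      · rw [List.mem_singleton] at hp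
        subst hp
        exact withinRows_gSkip _ _ _
      · simp at hp
    · split_ifs at hp
      · rw [List.mem_singleton] at hp
        subst hp
        exact withinRows_gSame (by omega) _
      · simp at hp
  · intro p hp c
    rcases List.mem_append.1 hp with hp | hp
    · split_ifs at hp
      · rw [List.mem_singleton] at hp
        subst hp
        exact withinRows_gSkip _ _ _
      · simp at hp
    · split_ifs at hp
      · rw [List.mem_singleton] at hp
        subst hp
        exact withinRows_gZ _ _ _ _
      · simp at hp

theorem withinRows_pairSweep (r : ℤ) :
    ∀ g ∈ pipeSweep L r [(-2, gCross L r), (-3, gSame L r)] [(2, gCross L r), (3, gZ L r)],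
      g.WithinRows r (r + 1) := by
  refine forall_mem_pipeSweep (fun t => withinRows_cnotAt (by omega) (by omega) (by omega)) ?_ ?_
  · simp only [List.forall_mem_cons, List.not_mem_nil, false_imp_iff, implies_true, and_true]
    exact ⟨withinRows_gCross r, withinRows_gSame (by omega)⟩
  · simp only [List.forall_mem_cons, List.not_mem_nil, false_imp_iff, implies_true, and_true]
    exact ⟨withinRows_gCross r, withinRows_gZ _ _ r⟩

theorem withinRows_lastSweep (r : ℤ) :
    ∀ g ∈ pipeSweep L r [(-3, gSame L r)] [(3, gZ L r)], g.WithinRows r (r + 0) := by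
  refine forall_mem_pipeSweep (fun t => withinRows_cnotAt (by omega) (by omega) (by omega)) ?_ ?_
  · simp only [List.forall_mem_cons, List.not_mem_nil, false_imp_iff, implies_true, and_true]
    exact withinRows_gSame (by omega)
  · simp only [List.forall_mem_cons, List.not_mem_nil, false_imp_iff, implies_true, and_true]
    exact withinRows_gZ _ _ r

theorem nearestNeighbor_gammaCircuit {g : Gate L} (hg : g ∈ gammaCircuit L) :
    g.NearestNeighbor := by
  have vertical : ∀ r c : ℕ, g ∈ cnotAt L ((r : ℤ) + 1) c r c → g.NearestNeighbor := fun r c h =>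
    (withinRows_cnotAt (a := r) (b := r + 1) (by omega) (by omega) (by omega) g h).1
  simp only [gammaCircuit, List.mem_append] at hg
  rcases hg with (((hg | hg) | hg) | hg) | hg
  · rw [phase1_eq] at hg
    simp only [List.mem_flatMap] at hg
    obtain ⟨c, _, r, _, hg⟩ := hg
    exact vertical r c hg
  · simp only [phase2, List.mem_append, List.mem_flatMap] at hg
    rcases hg with ⟨r, _, hg⟩ | ⟨r, _, hg⟩
    · exact (withinRows_sweepA r g hg).1
    · exact (withinRows_sweepA r g hg).1
  · rw [phase3_eq] at hg
    simp only [List.mem_flatMap] at hg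
    obtain ⟨c, _, r, _, hg⟩ := hg
    exact vertical r c hg
  · rw [phase4_eq, List.mem_flatMap] at hg
    obtain ⟨r, _, hg⟩ := hg
    exact (withinRows_pairSweep r g hg).1
  · exact (withinRows_lastSweep _ g (mem_ite_nil hg).2).1

/-! ### The gate count of `Γ` -/

theorem gateCount_cnotAt_le (r c r' c' : ℤ) : gateCount (cnotAt L r c r' c') ≤ 1 := by
  unfold cnotAt
  split <;> simp [gateCount, Gate.isEntangling]

theorem gateCount_czAt_le (r c r' c' : ℤ) : gateCount (czAt L r c r' c') ≤ 1 := by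
  unfold czAt
  split <;> simp [gateCount, Gate.isEntangling]

theorem gateCount_gZ_le (r c : ℤ) : gateCount (gZ L r c) ≤ 4 := by
  unfold gZ zAt
  split_ifs
  · split <;> simp [gateCount, Gate.isEntangling]
  · simp [gateCount]

theorem gateCount_gSkip_le (r e c : ℤ) : gateCount (gSkip L r e c) ≤ 4 := by
  simp only [gSkip, gateCount_append]
  have h1 := gateCount_czAt_le (L := L) (r + 1) c (r + 2) c
  have h2 := gateCount_cnotAt_le (L := L) r (c + e) (r + 1) (c + e)
  have h3 := gateCount_czAt_le (L := L) (r + 1) (c + 2 * e) (r + 2) (c + 2 * e)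
  have h4 := gateCount_cnotAt_le (L := L) r (c + 3 * e) (r + 1) (c + 3 * e)
  omega

theorem gateCount_gSame_le (r c : ℤ) : gateCount (gSame L r c) ≤ 4 :=
  (gateCount_czAt_le _ _ _ _).trans (by omega)

theorem gateCount_gCross_le (r c : ℤ) : gateCount (gCross L r c) ≤ 4 :=
  (gateCount_czAt_le _ _ _ _).trans (by omega)

/-- A step fires at most 1 + 2 · 4 = 9 two-qubit gates, and the two legs have L + 8 ≤ 9 L steps
each. -/
theorem gateCount_pipeSweep_le {r : ℤ} {F U : List (ℤ × Gadget L)} (hF : F.length ≤ 2)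
    (hU : U.length ≤ 2) (hF' : ∀ p ∈ F, ∀ c, gateCount (p.2 c) ≤ 4)
    (hU' : ∀ p ∈ U, ∀ c, gateCount (p.2 c) ≤ 4) (hL : 0 < L) :
    gateCount (pipeSweep L r F U) ≤ 162 * L := by
  have step : ∀ G : List (ℤ × Gadget L), G.length ≤ 2 → (∀ p ∈ G, ∀ c, gateCount (p.2 c) ≤ 4) →
      ∀ t, gateCount (sweepStep L r G t) ≤ 9 := by
    intro G hG hG' t
    rw [sweepStep, gateCount_append]
    have h1 : gateCount (if 0 ≤ t then cnotAt L r t r (t + 1) else []) ≤ 1 := by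
      split_ifs
      · exact gateCount_cnotAt_le _ _ _ _
      · simp [gateCount]
    have h2 := gateCount_flatMap_le (l := G) (f := fun g => g.2 (t + g.1)) (b := 4)
      fun p hp => hG' p hp _
    omega
  rw [pipeSweep_eq, gateCount_append]
  have h1 := gateCount_flatMap_le (l := List.range (L + 8)) (b := 9)
    (f := fun k : ℕ => sweepStep L r F k) fun k _ => step F hF hF' _
  have h2 := gateCount_flatMap_le (l := List.range (L + 8)) (b := 9)
    (f := fun k : ℕ => sweepStep L r U ((L : ℤ) - 2 - k)) fun k _ => step U hU hU' _
  rw [List.length_range] at h1 h2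
  omega

theorem gateCount_sweepA_le (r : ℕ) (hL : 0 < L) : gateCount (sweepA L r) ≤ 162 * L := by
  refine gateCount_pipeSweep_le ?_ ?_ ?_ ?_ hL
  · split_ifs <;> simp
  · split_ifs <;> simp
  · split_ifs <;> simp [gateCount_gSkip_le, gateCount_gSame_le]
  · split_ifs <;> simp [gateCount_gSkip_le, gateCount_gZ_le]

theorem gateCount_gammaCircuit_le : gateCount (gammaCircuit L) ≤ 650 * (L * L) := by
  rcases Nat.eq_zero_or_pos L with rfl | hL
  · decide
  have h1 : gateCount (phase1 L) ≤ L * (L * 1) := by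
    rw [phase1_eq]
    have := gateCount_flatMap_le (l := List.range L) (b := L * 1)
      (f := fun c : ℕ => (List.range (L - 1)).reverse.flatMap fun r : ℕ =>
        cnotAt L ((r : ℤ) + 1) c r c) fun c _ =>
      (gateCount_flatMap_le fun r _ => gateCount_cnotAt_le _ _ _ _).trans
        (Nat.mul_le_mul_right _ (by simp))
    simpa using this
  have h3 : gateCount (phase3 L) ≤ L * (L * 1) := by
    rw [phase3_eq]
    have := gateCount_flatMap_le (l := List.range L) (b := L * 1)
      (f := fun c : ℕ => (List.range (L - 1)).flatMap fun r : ℕ =>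
        cnotAt L ((r : ℤ) + 1) c r c) fun c _ =>
      (gateCount_flatMap_le fun r _ => gateCount_cnotAt_le _ _ _ _).trans
        (Nat.mul_le_mul_right _ (by simp))
    simpa using this
  have hlen : ∀ p : ℕ → Bool, ((List.range L).filter p).length ≤ L := fun p =>
    (List.length_filter_le _ _).trans (by simp)
  have h2 : gateCount (phase2 L) ≤ L * (162 * L) + L * (162 * L) := by
    rw [phase2, gateCount_append]
    exact Nat.add_le_add
      ((gateCount_flatMap_le fun r _ => gateCount_sweepA_le r hL).trans
        (Nat.mul_le_mul_right _ (hlen _)))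
      ((gateCount_flatMap_le fun r _ => gateCount_sweepA_le r hL).trans
        (Nat.mul_le_mul_right _ (hlen _)))
  have h4 : gateCount (phase4 L) ≤ L * (162 * L) := by
    rw [phase4_eq]
    refine (gateCount_flatMap_le fun r _ => gateCount_pipeSweep_le (by simp) (by simp) ?_ ?_
      hL).trans (Nat.mul_le_mul_right _ (hlen _))
    · simp [gateCount_gCross_le, gateCount_gSame_le]
    · simp [gateCount_gCross_le, gateCount_gZ_le]
  have h5 : gateCount (phase5 L) ≤ 162 * L := by
    unfold phase5
    split_ifs
    · refine gateCount_pipeSweep_le (by simp) (by simp) ?_ ?_ hL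
      · simp [gateCount_gSame_le]
      · simp [gateCount_gZ_le]
    · simp [gateCount]
  simp only [gammaCircuit, gateCount_append]
  -- The sum is at most (2 + 3 · 162) L² + 162 L ≤ 650 L².
  nlinarith

/-! ### The depth of `Γ` -/

theorem layers_line_le {n : ℕ} {K : ℕ → Circuit L} {T : ℕ → ℕ} {τ σ : Site L → ℕ}
    (hK : ∀ k < n, (K k).Pairwise Gate.Apart) (hT : StrictMono T)
    (hτ : ∀ k < n, ∀ g ∈ K k, ∀ x, g.Touches x → τ x < T k ∧ T k ≤ σ x)
    (h0 : ∀ x, τ x ≤ σ x) (x : Site L) : layers τ ((List.range n).flatMap K) x ≤ σ x := by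
  have := layers_steps_le (K := K) (R := fun _ => []) (S := fun k _ => T k) (T := fun _ _ => 0) hK
    (by simp) (by simp)
    (fun i j hij _ x => by simpa using fun _ _ _ _ _ _ => hT hij) hτ (by simp) h0 x
  simpa only [List.append_nil] using this

theorem reverse_range_flatMap {α : Type*} (n : ℕ) (f : ℕ → List α) :
    (List.range n).reverse.flatMap f = (List.range n).flatMap fun k => f (n - 1 - k) := by
  rw [List.range_eq_range', List.reverse_range', List.flatMap_map, ← List.range_eq_range']
  simp

/-- Columns of vertical gates run in parallel. -/
theorem layers_columns_le {n : ℕ} {R : ℕ → ℕ} {T : ℕ → ℕ} {α β τ : Site L → ℕ}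
    (hT : StrictMono T)
    (h : ∀ k < n, ∀ x : Site L, x.1.val = R k ∨ x.1.val = R k + 1 → α x < T k ∧ T k ≤ β x)
    (hτ : ∀ x, τ x ≤ α x) (hβ : ∀ x, α x ≤ β x) (x : Site L) :
    layers τ ((List.range L).flatMap fun c : ℕ => (List.range n).flatMap fun k : ℕ =>
      cnotAt L ((R k : ℤ) + 1) c (R k) c) x ≤ β x := by
  refine layers_flatMap_le (S := fun c x => x.2.val = c) (α := α) ?_ ?_ ?_ (fun _ _ x _ => hτ x)
    (fun x => (hτ x).trans (hβ x)) x
  · refine List.nodup_range.imp ?_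
    intro a b hab x hx hx'
    exact hab (hx.symm.trans hx')
  · intro c _ g hg x hx
    rw [List.mem_flatMap] at hg
    obtain ⟨k, _, hg⟩ := hg
    have := (on_cnotAt hg).2 x hx
    omega
  · intro c _ τ hτ x hx
    have key := layers_line_le (n := n) (T := T) (τ := τ)
      (σ := fun x => if x.2.val = c then β x else τ x)
      (K := fun k : ℕ => cnotAt L ((R k : ℤ) + 1) c (R k) c)
      (fun k _ => pairwise_cnotAt _ _ _ _ _) hT ?_ ?_ x
    · rwa [if_pos hx] at key
    · intro k hk g hg y hy
      have hy' := (on_cnotAt hg).2 y hy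
      have hc : y.2.val = c := by omega
      have h1 := h k hk y (by omega)
      rw [if_pos hc]
      exact ⟨(hτ y hc).trans_lt h1.1, h1.2⟩
    · intro y
      split_ifs with hy
      · exact (hτ y hy).trans (hβ y)
      · exact le_rfl

/-- A row r ≥ 1 is last used in layer L - r, as the control of the CNOT into row r - 1; row 0 is
only a target, in layer L - 1. -/
theorem layers_phase1_le (x : Site L) :
    layers (fun _ => 0) (phase1 L) x ≤ if x.1.val = 0 then L - 1 else L - x.1.val := by
  rw [phase1_eq]
  simp only [reverse_range_flatMap]
  refine layers_columns_le (R := fun k => L - 1 - 1 - k) (T := fun k => k + 1) (α := fun _ => 0)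
    (β := fun x => if x.1.val = 0 then L - 1 else L - x.1.val)
    (fun i j h => Nat.succ_lt_succ h) ?_ (fun _ => le_rfl) (fun _ => Nat.zero_le _) x
  intro k hk y hy
  split_ifs <;> omega

/-- The bounds leave rows 0 and 1 free much earlier, so the first vertical CNOT fits into layer 5L +
10 and the last, L - 2 layers later, into 6L + 8. -/
theorem layers_phase3_le {τ : Site L → ℕ}
    (hτ : ∀ x, τ x ≤ if x.1.val < 2 then 3 * L + 4 else 5 * L + 10) (x : Site L) :
    layers τ (phase3 L) x ≤ 6 * L + 8 := by
  rw [phase3_eq]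
  refine layers_columns_le (R := fun k => k) (T := fun k => 5 * L + 10 + k)
    (α := fun x => if x.1.val < 2 then 3 * L + 4 else 5 * L + 10)
    (β := fun _ => 6 * L + 8) (fun i j h => Nat.add_lt_add_left h _) ?_ hτ ?_ x
  · intro k hk y hy
    split_ifs <;> omega
  · intro y
    split_ifs <;> omega

theorem pairwise_filter_range {p : ℕ → Bool} {w : ℕ}
    (hp : ∀ a b, p a → p b → a < b → a + w < b) :
    ((List.range L).filter p).Pairwise fun a b : ℕ => ∀ x : Site L,
      ((a : ℤ) ≤ x.1.val ∧ (x.1.val : ℤ) ≤ a + w) →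
        ¬ ((b : ℤ) ≤ x.1.val ∧ (x.1.val : ℤ) ≤ b + w) := by
  refine List.Pairwise.imp_of_mem ?_ ((List.pairwise_lt_range (n := L)).filter p)
  intro a b ha hb hab x hx hx'
  have := hp a b (List.mem_filter.1 ha).2 (List.mem_filter.1 hb).2 hab
  omega

/-- In the first batch, row 0 starts one layer later than the other sweeps but its forward leg is
one layer shorter, so all end by 3L + 4. The second batch adds 2L + 6 and does not touch rows 0 and
1. -/
theorem layers_phase2_le {τ : Site L → ℕ}
    (hτ : ∀ x, τ x ≤ if x.1.val = 0 then L - 1 else L - x.1.val) (x : Site L) :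
    layers τ (phase2 L) x ≤ if x.1.val < 2 then 3 * L + 4 else 5 * L + 10 := by
  rw [phase2, layers_append]
  have first : ∀ x, layers τ (((List.range L).filter fun r => r % 4 = 0).flatMap (sweepA L)) x ≤
      3 * L + 4 := by
    refine layers_flatMap_le (S := fun (r : ℕ) x => (r : ℤ) ≤ x.1.val ∧ (x.1.val : ℤ) ≤ r + (2 : ℕ))
      (α := fun x => if x.1.val = 0 then L - 1 else L - x.1.val) (β := fun _ => 3 * L + 4)
      (pairwise_filter_range fun a b ha hb hab => ?_)
      (fun r _ g hg y hy => (withinRows_sweepA r g hg).2 y hy) ?_ (fun _ _ y _ => hτ y) ?_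
    · simp only [decide_eq_true_eq] at ha hb
      omega
    · intro r hr τ hτ y hy
      simp only [List.mem_filter, List.mem_range, decide_eq_true_eq] at hr
      refine (layers_sweepA_le (A := if r = 0 then L - 1 else L - 2) (fun z hz => ?_) y hy).trans ?_
      · have := hτ z hz
        split_ifs at this ⊢ <;> omega
      · split_ifs <;> omega
    · intro y
      have := hτ y
      split_ifs at this <;> omega
  refine layers_flatMap_le (S := fun (r : ℕ) x => (r : ℤ) ≤ x.1.val ∧ (x.1.val : ℤ) ≤ r + (2 : ℕ))
    (α := fun _ => 3 * L + 4) (β := fun x => if x.1.val < 2 then 3 * L + 4 else 5 * L + 10)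
    (pairwise_filter_range fun a b ha hb hab => ?_)
    (fun r _ g hg y hy => (withinRows_sweepA r g hg).2 y hy) ?_ (fun _ _ y _ => first y) ?_ x
  · simp only [decide_eq_true_eq] at ha hb
    omega
  · intro r hr τ hτ y hy
    simp only [List.mem_filter, List.mem_range, decide_eq_true_eq] at hr
    refine (layers_sweepA_le (A := 3 * L + 4) hτ y hy).trans ?_
    split_ifs <;> omega
  · intro y
    have := first y
    split_ifs <;> omega

/-- For odd L the last row is not touched here, so that phase 5 can run in parallel. -/
theorem layers_phase4_le {τ : Site L → ℕ} (hτ : ∀ x, τ x ≤ 6 * L + 8) (x : Site L) :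
    layers τ (phase4 L) x ≤
      if L % 2 = 1 ∧ x.1.val = L - 1 then 6 * L + 8 else 8 * L + 10 := by
  rw [phase4_eq]
  refine layers_flatMap_le (S := fun (r : ℕ) x => (r : ℤ) ≤ x.1.val ∧ (x.1.val : ℤ) ≤ r + (1 : ℕ))
    (α := fun _ => 6 * L + 8)
    (β := fun x => if L % 2 = 1 ∧ x.1.val = L - 1 then 6 * L + 8 else 8 * L + 10)
    (pairwise_filter_range fun a b ha hb hab => ?_)
    (fun r _ g hg y hy => (withinRows_pairSweep r g hg).2 y hy) ?_ (fun _ _ y _ => hτ y) ?_ x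
  · simp only [decide_eq_true_eq] at ha hb
    omega
  · intro r hr τ hτ y hy
    simp only [List.mem_filter, List.mem_range, decide_eq_true_eq] at hr
    refine (layers_pairSweep_le (A := 6 * L + 8) hτ y hy).trans ?_
    split_ifs <;> omega
  · intro y
    have := hτ y
    split_ifs <;> omega

theorem layers_phase5_le {τ : Site L → ℕ}
    (hτ : ∀ x, τ x ≤ if L % 2 = 1 ∧ x.1.val = L - 1 then 6 * L + 8 else 8 * L + 10) (x : Site L) :
    layers τ (phase5 L) x ≤ 8 * L + 10 := by
  have h0 := hτ x
  unfold phase5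
  split_ifs with hL
  · by_cases hx : x.1.val = L - 1
    · refine (layers_lastSweep_le (A := 6 * L + 8) (fun y hy => ?_) x (by omega)).trans (by omega)
      have := hτ y
      rwa [if_pos (by omega)] at this
    · rw [layers_of_not_touches]
      · rwa [if_neg (by omega)] at h0
      · intro g hg hgx
        have := (withinRows_lastSweep _ g hg).2 x hgx
        omega
  · rwa [if_neg (by omega)] at h0

theorem cnotDepth_gammaCircuit_le : cnotDepth (gammaCircuit L) ≤ 8 * L + 10 := by
  rw [cnotDepth_le_iff]
  simp only [gammaCircuit, layers_append]
  exact layers_phase5_le (layers_phase4_le (layers_phase3_le (layers_phase2_le layers_phase1_le)))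

/-! ### The five-stage circuit -/

theorem nearestNeighbor_fiveStage {ρA κ ρB : Equiv.Perm (Site L)} :
    ∀ g ∈ fiveStage ρA κ ρB, g.NearestNeighbor := by
  intro g hg
  simp only [fiveStage, List.mem_append] at hg
  rcases hg with (((hg | hg) | hg) | hg) | hg
  · exact nearestNeighbor_rowStage hg
  · exact nearestNeighbor_gammaCircuit hg
  · exact nearestNeighbor_colStage hg
  · exact nearestNeighbor_gammaCircuit hg
  · exact nearestNeighbor_rowStage hg

theorem cnotDepth_fiveStage_le (ρA κ ρB : Equiv.Perm (Site L)) :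
    cnotDepth (fiveStage ρA κ ρB) ≤ 22 * L + 20 := by
  unfold fiveStage
  have h1 := cnotDepth_append_le (rowStage ρA) (gammaCircuit L)
  have h2 := cnotDepth_append_le (rowStage ρA ++ gammaCircuit L) (colStage κ)
  have h3 := cnotDepth_append_le (rowStage ρA ++ gammaCircuit L ++ colStage κ) (gammaCircuit L)
  have h4 := cnotDepth_append_le
    (rowStage ρA ++ gammaCircuit L ++ colStage κ ++ gammaCircuit L) (rowStage ρB)
  have hA := cnotDepth_rowStage_le ρA
  have hB := cnotDepth_rowStage_le ρB
  have hκ := cnotDepth_colStage_le κ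
  have hΓ := cnotDepth_gammaCircuit_le (L := L)
  omega

theorem gateCount_rowStage_le (ρ : Equiv.Perm (Site L)) :
    gateCount (rowStage ρ) ≤ L * L * L := by
  have := two_mul_gateCount_le_depth (fun g => nearestNeighbor_rowStage) (cnotDepth_rowStage_le ρ)
  linarith

theorem gateCount_colStage_le (κ : Equiv.Perm (Site L)) :
    gateCount (colStage κ) ≤ L * L * L := by
  have := two_mul_gateCount_le_depth (fun g => nearestNeighbor_colStage) (cnotDepth_colStage_le κ)
  linarith

theorem gateCount_fiveStage_le (ρA κ ρB : Equiv.Perm (Site L)) :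
    gateCount (fiveStage ρA κ ρB) ≤ 21 * (L * L * L) := by
  have h := two_mul_gateCount_le_depth nearestNeighbor_fiveStage (cnotDepth_fiveStage_le ρA κ ρB)
  -- Half of L² (22 L + 20) is 11 L³ + 10 L², hence the constant 21.
  have h2 : L * L ≤ L * L * L := by
    rcases Nat.eq_zero_or_pos L with rfl | hL
    · simp
    · exact Nat.le_mul_of_pos_right _ hL
  linarith

end FermionicPermutation

/-! ### The main theorem -/

open FermionicPermutation in
theorem mainTheorem1 :
    ∃ C : ℕ, ∀ (L : ℕ) (π : Equiv.Perm (Fin (L * L))),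
      (∃ ρA κ ρB : Equiv.Perm (Site L), IsRowColRowPlan π ρA κ ρB) ∧
      ∀ ρA κ ρB : Equiv.Perm (Site L), IsRowColRowPlan π ρA κ ρB →
        modeOp (fiveStage ρA κ ρB) = fermionicPerm π ∧
        (∀ g ∈ fiveStage ρA κ ρB, g.NearestNeighbor) ∧
        cnotDepth (fiveStage ρA κ ρB) ≤ 22 * L + 20 ∧
        gateCount (fiveStage ρA κ ρB) ≤ C * (L * L * L) ∧
        (cnotDepth (rowStage ρA) ≤ 2 * L ∧ gateCount (rowStage ρA) ≤ L * L * L) ∧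
        (cnotDepth (colStage κ) ≤ 2 * L ∧ gateCount (colStage κ) ≤ L * L * L) ∧
        (cnotDepth (rowStage ρB) ≤ 2 * L ∧ gateCount (rowStage ρB) ≤ L * L * L) ∧
        (cnotDepth (gammaCircuit L) ≤ 8 * L + 10 ∧ gateCount (gammaCircuit L) ≤ C * (L * L)) := by
  -- The constant is the one needed for Γ; the whole circuit would need only 21.
  refine ⟨650, fun L π => ⟨exists_rowColRowPlan π, fun ρA κ ρB h => ⟨modeOp_fiveStage h,
    nearestNeighbor_fiveStage, cnotDepth_fiveStage_le ρA κ ρB,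
    (gateCount_fiveStage_le ρA κ ρB).trans (Nat.mul_le_mul_right _ (by norm_num)),
    ⟨cnotDepth_rowStage_le ρA, gateCount_rowStage_le ρA⟩,
    ⟨cnotDepth_colStage_le κ, gateCount_colStage_le κ⟩,
    ⟨cnotDepth_rowStage_le ρB, gateCount_rowStage_le ρB⟩,
    cnotDepth_gammaCircuit_le, gateCount_gammaCircuit_le⟩⟩⟩
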